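/- Let $\Gamma$ be a finite group acting by diffeomorphisms on a compact smooth manifold $M$ (without boundary), let $M$ carry a $\Gamma$-invariant Riemannian metric and a $\Gamma$-invariant smooth positive measure (for instance its Riemannian volume), and let $\alpha\in\widehat\Gamma$ be (the class of) an irreducible complex representation. For $\xi\in T^*M$ let $\Gamma_\xi$ be its isotropy group, and put $X_{M,\Gamma}=\{(\xi,\rho) : \xi\in T^*M\smallsetminus\{0\},\ \rho\in\widehat{\Gamma}_\xi\}$. For every connected component of $M/\Gamma$ let $\Gamma_0$ be a minimal element (for inclusion) among the isotropy groups of the points of $M$ over that component. Let $X^\alpha_{M,\Gamma}$ be the set of the $(\xi,\rho)\in X_{M,\Gamma}$ for which there is $g\in\Gamma$ with $\Gamma_0\subset\Gamma_{g\xi}$ and $\operatorname{Hom}_{\Gamma_0}(g\cdot\rho,\alpha)\neq0$, where $\Gamma_0$ belongs to the component over which $\xi$ lies and $(g\cdot\rho)(h)=\rho(g^{-1}hg)$ for $h\in\Gamma_{g\xi}$. For a $\Gamma$-equivariant smooth complex vector bundle $E\to M$ of finite rank with a $\Gamma$-invariant Hermitian metric, let $A_M^\Gamma=C(S^*M;\operatorname{End}(E))^\Gamma$,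 where $S^*M$ is the unit cosphere bundle. Let $\overline{\psi^{k}}(M;E)$ be the norm closure in the bounded operators on $L^2(M;E)$ of the classical pseudodifferential operators of order $k$, for $k=0,-1$. Let $\pi_\alpha$ be the restriction of $\Gamma$-invariant operators to the $\alpha$-isotypical component of $L^2(M;E)$, let $$\mathcal R_M: A_M^\Gamma\simeq\overline{\psi^{0}}(M;E)^\Gamma/\overline{\psi^{-1}}(M;E)^\Gamma\longrightarrow \pi_\alpha(\overline{\psi^{0}}(M;E)^\Gamma)/\pi_\alpha(\overline{\psi^{-1}}(M;E)^\Gamma)$$ be the induced map (the identification on the left being the principal symbol), and let $\Xi=\operatorname{Prim}(A_M^\Gamma/\ker\mathcal R_M)\subset\operatorname{Prim}(A_M^\Gamma)$ be the set of the primitive ideals that contain $\ker\mathcal R_M$. Assume that $\Gamma$ acts freely on a dense subset of $M$. Then for every $\alpha\in\widehat\Gamma$: 1. $X^\alpha_{M,\Gamma}=X_{M,\Gamma}$; 2. $\Xi=\operatorname{Prim}(A_M^\Gamma)$; 3. for all $\Gamma$-equivariant smooth complex vector bundles $E_0,E_1\to M$ of finite rank, all $m\in\mathbb R$ and every $\Gamma$-invariant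 classical pseudodifferential operator $P\in\psi^m(M;E_0,E_1)^\Gamma$, the operator $P$ is $\alpha$-elliptic if and only if it is elliptic. Here $P$ is elliptic if its principal symbol $\sigma_m(P)(\xi):E_{0x}\to E_{1x}$ is invertible for all $\xi\in T^*_xM\smallsetminus\{0\}$, $x\in M$. It is $\alpha$-elliptic if for all $(\xi,\rho)\in X^\alpha_{M,\Gamma}$, $\xi\in T_x^*M$, the restriction $E_{0x\rho}\to E_{1x\rho}$ of $\sigma_m(P)(\xi)$ to the $\rho$-isotypical components is invertible (a map $0\to0$ counts as invertible). -/

import Mathlib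

open Bundle MeasureTheory Topology
open scoped Manifold ContDiff FourierTransform SchwartzMap ComplexConjugate

noncomputable section

namespace EquivariantSymbol

universe u

/-! ## Representations of finite groups -/

/-- A complex irreducible representation of `G`, written on some `ℂ^d`. -/
structure Irrep (G : Type*) [Group G] where
  dim : ℕ
  rep : Representation ℂ G (Fin dim → ℂ)
  irreducible : rep.IsIrreducible

/-- Isomorphism of irreducible representations. -/
instance irrepSetoid (G : Type*) [Group G] : Setoid (Irrep G) where
  r ρ τ := Nonempty (ρ.rep.Equiv τ.rep)
  iseqv := ⟨fun ρ => ⟨Representation.Equiv.refl ρ.rep⟩, fun ⟨e⟩ => ⟨e.symm⟩,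
    fun ⟨e⟩ ⟨f⟩ => ⟨e.trans f⟩⟩

/-- The dual `Ĝ` of a finite group: isomorphism classes of irreducible complex representations. -/
def Dual (G : Type*) [Group G] : Type _ := Quotient (irrepSetoid G)

/-- The space of a representative of the class `ρ`. -/
abbrev Dual.Space {G : Type*} [Group G] (ρ : Dual G) : Type :=
  Fin (Quotient.out (s := irrepSetoid G) ρ).dim → ℂ

/-- A representative of the class `ρ` (the notions below do not depend on its choice). -/
def Dual.rep {G : Type*} [Group G] (ρ : Dual G) : Representation ℂ G ρ.Space :=
  (Quotient.out (s := irrepSetoid G) ρ).rep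

/-- The `α`-isotypical component of a representation `V`: the sum of the images of all equivariant
maps from `α` to `V`. For an irreducible `α` this is the sum of all subrepresentations of `V` that
are isomorphic to `α`. -/
def isotypicPart {G W V : Type*} [Group G] [AddCommGroup W] [Module ℂ W] [AddCommGroup V]
    [Module ℂ V] (α : Representation ℂ G W) (σ : Representation ℂ G V) : Submodule ℂ V :=
  ⨆ T : α.IntertwiningMap σ, LinearMap.range T.toLinearMap

/-! ## The primitive ideal spectrum -/

/-- `Φ` is a non-zero irreducible `*`-representation: it is not the zero map and its only closed
invariant subspaces are the trivial ones. -/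
def IsIrreducibleStarRep {A : Type*} [Ring A] [Algebra ℂ A] [StarRing A] {H : Type*}
    [NormedAddCommGroup H] [InnerProductSpace ℂ H] [CompleteSpace H]
    (Φ : A →⋆ₙₐ[ℂ] (H →L[ℂ] H)) : Prop :=
  (∃ a, Φ a ≠ 0) ∧ ∀ K : Submodule ℂ H, IsClosed (K : Set H) →
    (∀ a, ∀ v ∈ K, Φ a v ∈ K) → K = ⊥ ∨ K = ⊤

/-- The primitive ideals of a `C^*`-algebra `A`: the kernels of its non-zero irreducible
`*`-representations on Hilbert spaces. -/
def primitiveIdeals (A : Type u) [Ring A] [Algebra ℂ A] [StarRing A] : Set (TwoSidedIdeal A) :=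
  {J | ∃ (H : Type u) (_ : NormedAddCommGroup H) (_ : InnerProductSpace ℂ H)
    (_ : CompleteSpace H) (Φ : A →⋆ₙₐ[ℂ] (H →L[ℂ] H)),
    IsIrreducibleStarRep Φ ∧ ∀ a, a ∈ J ↔ Φ a = 0}

/-! ## The action on the manifold and on its cotangent bundle -/

/-- The model space `ℝⁿ`. -/
abbrev Rn (n : ℕ) : Type := EuclideanSpace ℝ (Fin n)

/-- `Γ` acts on the manifold `M` by diffeomorphisms. -/
class SmoothAction (n : ℕ) (Γ M : Type*) [Group Γ] [TopologicalSpace M] [ChartedSpace (Rn n) M]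
    [MulAction Γ M] : Prop where
  contMDiff_smul : ∀ γ : Γ, ContMDiff (𝓡 n) (𝓡 n) ∞ (fun x : M => γ • x)

section Cotangent

variable (n : ℕ) {Γ M : Type*} [Group Γ] [TopologicalSpace M] [ChartedSpace (Rn n) M]

variable (M) in
/-- The cotangent bundle `T^*M`. -/
abbrev Cotangent [IsManifold (𝓡 n) ∞ M] : Type _ :=
  TotalSpace (Rn n →L[ℝ] ℝ) (fun x : M => TangentSpace (𝓡 n) x →L[ℝ] ℝ)

variable [MulAction Γ M]

lemma mfderiv_smul_comp [SmoothAction n Γ M] (γ δ : Γ) (x : M) :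
    mfderiv (𝓡 n) (𝓡 n) (fun y : M => (γ * δ) • y) x =
      (mfderiv (𝓡 n) (𝓡 n) (fun y : M => γ • y) (δ • x)).comp
        (mfderiv (𝓡 n) (𝓡 n) (fun y : M => δ • y) x) := by
  have h := mfderiv_comp (I := 𝓡 n) (I' := 𝓡 n) (I'' := 𝓡 n) (g := fun y : M => γ • y)
    (f := fun y : M => δ • y) x
    (((SmoothAction.contMDiff_smul (n := n) γ) (δ • x)).mdifferentiableAt (by simp))
    (((SmoothAction.contMDiff_smul (n := n) δ) x).mdifferentiableAt (by simp))
  rw [← h]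
  congr 1
  funext y
  simp [mul_smul]


lemma mfderiv_one_smul (x : M) :
    mfderiv (𝓡 n) (𝓡 n) (fun y : M => (1 : Γ) • y) x =
      ContinuousLinearMap.id ℝ (TangentSpace (𝓡 n) x) := by
  have : (fun y : M => (1 : Γ) • y) = id := by funext z; simp
  rw [this]; exact mfderiv_id

lemma isInvertible_mfderiv_smul [SmoothAction n Γ M] (γ : Γ) (x : M) :
    (mfderiv (𝓡 n) (𝓡 n) (fun y : M => γ • y) x).IsInvertible := by
  have key : ∀ (γ δ : Γ) (z : M), γ * δ = 1 → ∀ v : Rn n,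
      (mfderiv (𝓡 n) (𝓡 n) (fun y : M => γ • y) (δ • z) : Rn n →L[ℝ] Rn n)
        ((mfderiv (𝓡 n) (𝓡 n) (fun y : M => δ • y) z : Rn n →L[ℝ] Rn n) v) = v := by
    intro γ δ z h v
    have a := mfderiv_smul_comp n γ δ z
    rw [h, mfderiv_one_smul] at a
    exact (DFunLike.congr_fun a v).symm
  have h1 := key γ⁻¹ γ x (by simp)
  have h2 := key γ γ⁻¹ (γ • x) (by simp)
  rw [inv_smul_smul] at h2
  exact ⟨ContinuousLinearEquiv.equivOfInverse
    (mfderiv (𝓡 n) (𝓡 n) (fun y : M => γ • y) x)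
    (mfderiv (𝓡 n) (𝓡 n) (fun y : M => γ⁻¹ • y) (γ • x) : Rn n →L[ℝ] Rn n) h1 h2, rfl⟩

lemma inverse_mfderiv_smul_mul [SmoothAction n Γ M] (γ δ : Γ) (x : M) :
    (mfderiv (𝓡 n) (𝓡 n) (fun y : M => (γ * δ) • y) x).inverse =
      (mfderiv (𝓡 n) (𝓡 n) (fun y : M => δ • y) x).inverse.comp
        (mfderiv (𝓡 n) (𝓡 n) (fun y : M => γ • y) (δ • x)).inverse := by
  rw [mfderiv_smul_comp]
  exact (isInvertible_mfderiv_smul n δ x).inverse_comp_of_right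

lemma covector_heq {x y : M} (h : x = y) (ξ : TangentSpace (𝓡 n) x →L[ℝ] ℝ)
    (η : TangentSpace (𝓡 n) y →L[ℝ] ℝ)
    (H : ∀ v : Rn n, (ξ : Rn n →L[ℝ] ℝ) v = (η : Rn n →L[ℝ] ℝ) v) : HEq ξ η := by
  subst h
  exact heq_of_eq (ContinuousLinearMap.ext H)

/-- The action of `Γ` on `T^*M`: `γ • (x, ξ) = (γ x, ξ ∘ (d_x γ)⁻¹)`. -/
instance cotangentAction [IsManifold (𝓡 n) ∞ M] [SmoothAction n Γ M] :
    MulAction Γ (Cotangent n M) where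
  smul γ ζ := ⟨γ • ζ.proj,
    ζ.2.comp (mfderiv (𝓡 n) (𝓡 n) (fun y : M => γ • y) ζ.proj).inverse⟩
  one_smul ζ := by
    refine TotalSpace.ext (one_smul Γ ζ.proj) (covector_heq n (one_smul Γ ζ.proj) _ _ fun v => ?_)
    change ζ.2 ((mfderiv (𝓡 n) (𝓡 n) (fun y : M => (1 : Γ) • y) ζ.proj).inverse v) = ζ.2 v
    rw [mfderiv_one_smul]
    erw [ContinuousLinearMap.inverse_id]
    rfl
  mul_smul γ δ ζ := by
    refine TotalSpace.ext (mul_smul γ δ ζ.proj)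
      (covector_heq n (mul_smul γ δ ζ.proj) _ _ fun v => ?_)
    change ζ.2 ((mfderiv (𝓡 n) (𝓡 n) (fun y : M => (γ * δ) • y) ζ.proj).inverse v) = _
    rw [inverse_mfderiv_smul_mul]
    rfl

end Cotangent

/-! ## Complex vector bundles and their smooth sections -/

section Bundles

variable {M F : Type*} [TopologicalSpace M] [NormedAddCommGroup F] [NormedSpace ℂ F]
  {E : M → Type*} [TopologicalSpace (TotalSpace F E)] [∀ x, AddCommGroup (E x)]
  [∀ x, Module ℂ (E x)] [∀ x, TopologicalSpace (E x)] [FiberBundle F E] [VectorBundle ℂ F E]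

/-- The real vector bundle underlying a complex one. -/
instance realVectorBundle : VectorBundle ℝ F E where
  trivialization_linear' e _ := by
    have := trivialization_linear ℂ e
    exact ⟨fun x hx => ⟨(e.linear ℂ hx).1, fun c v => (e.linear ℂ hx).2 (c : ℂ) v⟩⟩
  continuousOn_coordChange' e e' _ _ := by
    have hlin : ∀ e : Trivialization F (TotalSpace.proj : TotalSpace F E → M),
        [MemTrivializationAtlas e] → e.IsLinear ℝ := fun e _ =>
      ⟨fun x hx => ⟨(e.linear ℂ hx).1, fun c v => (e.linear ℂ hx).2 (c : ℂ) v⟩⟩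
    have := hlin e
    have := hlin e'
    refine ((ContinuousLinearMap.restrictScalarsL ℂ F F ℝ ℝ).continuous.comp_continuousOn
      (continuousOn_coordChange ℂ e e')).congr fun b hb => ?_
    ext v
    simp [Trivialization.coordChangeL_apply _ _ hb]

end Bundles

section Sections

variable (n : ℕ) {M F : Type*} [TopologicalSpace M] [ChartedSpace (Rn n) M]
  [NormedAddCommGroup F] [NormedSpace ℂ F]
  (E : M → Type*) [TopologicalSpace (TotalSpace F E)] [∀ x, AddCommGroup (E x)]
  [∀ x, Module ℂ (E x)] [∀ x, TopologicalSpace (E x)] [FiberBundle F E] [VectorBundle ℂ F E]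

variable (F) in
/-- The space `C^∞(M; E)` of smooth sections of a complex vector bundle. -/
def smoothSections : Submodule ℂ (∀ x, E x) where
  carrier := {s | ContMDiff (𝓡 n) ((𝓡 n).prod 𝓘(ℝ, F)) ∞ (fun x => TotalSpace.mk' F x (s x))}
  add_mem' hs ht := ContMDiff.add_section hs ht
  zero_mem' := contMDiff_zeroSection ℝ E
  smul_mem' c s hs := by
    intro x₀
    have h := hs x₀
    rw [← contMDiffWithinAt_univ, contMDiffWithinAt_section] at h ⊢
    set e := trivializationAt F E x₀
    refine ((ContinuousLinearMap.restrictScalars ℝ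
      (c • ContinuousLinearMap.id ℂ F)).contMDiff.contMDiffAt.comp_contMDiffWithinAt x₀
        h).congr_of_eventuallyEq ?_ ?_
    · apply Filter.eventually_of_mem (U := e.baseSet)
      · exact mem_nhdsWithin_of_mem_nhds
          (e.open_baseSet.mem_nhds (FiberBundle.mem_baseSet_trivializationAt' x₀))
      · intro x hx
        exact (e.linear ℂ hx).2 c _
    · exact (e.linear ℂ (FiberBundle.mem_baseSet_trivializationAt' x₀)).2 c _


/-- A smooth section of the dual bundle of `E`. -/
def IsSmoothCosection (ℓ : ∀ x, E x →ₗ[ℂ] ℂ) : Prop :=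
  ∀ s ∈ smoothSections n F E, ContMDiff (𝓡 n) 𝓘(ℝ, ℂ) ∞ (fun x => ℓ x (s x))

end Sections

/-! ## Equivariant bundles -/

/-- A `Γ`-equivariant structure on the complex vector bundle `E`: a smooth action of `Γ` on the
total space that covers the action on `M` and is linear on the fibres. -/
class EquivariantBundle (n : ℕ) (Γ : Type*) {M : Type*} (F : Type*) [Group Γ]
    [TopologicalSpace M] [ChartedSpace (Rn n) M] [MulAction Γ M]
    [NormedAddCommGroup F] [NormedSpace ℂ F]
    (E : M → Type*) [TopologicalSpace (TotalSpace F E)] [∀ x, AddCommGroup (E x)]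
    [∀ x, Module ℂ (E x)] [∀ x, TopologicalSpace (E x)] [FiberBundle F E] where
  act (γ : Γ) (x : M) : E x →ₗ[ℂ] E (γ • x)
  one_act (x : M) (v : E x) : TotalSpace.mk' F _ (act 1 x v) = TotalSpace.mk' F x v
  mul_act (γ δ : Γ) (x : M) (v : E x) :
    TotalSpace.mk' F _ (act (γ * δ) x v) = TotalSpace.mk' F _ (act γ (δ • x) (act δ x v))
  contMDiff_act (γ : Γ) : ContMDiff ((𝓡 n).prod 𝓘(ℝ, F)) ((𝓡 n).prod 𝓘(ℝ, F)) ∞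
    (fun p : TotalSpace F E => TotalSpace.mk' F (γ • p.proj) (act γ p.proj p.2))

section Fibres

variable {M : Type*} (F : Type*) {E : M → Type*} [∀ x, AddCommGroup (E x)]
  [∀ x, Module ℂ (E x)]

/-- The identity map between the fibres over equal points. -/
def fibreCast {x y : M} (h : x = y) : E x →ₗ[ℂ] E y := h ▸ LinearMap.id

lemma mk_fibreCast {x y : M} (h : x = y) (v : E x) :
    TotalSpace.mk' F y (fibreCast h v) = TotalSpace.mk' F x v := by
  subst h; rfl

end Fibres

section FibreRep

variable (n : ℕ) {Γ M : Type*} (F : Type*) [Group Γ]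
  [TopologicalSpace M] [ChartedSpace (Rn n) M] [MulAction Γ M]
  [NormedAddCommGroup F] [NormedSpace ℂ F]
  (E : M → Type*) [TopologicalSpace (TotalSpace F E)] [∀ x, AddCommGroup (E x)]
  [∀ x, Module ℂ (E x)] [∀ x, TopologicalSpace (E x)] [FiberBundle F E]
  [EquivariantBundle n Γ F E]

/-- The representation of the isotropy group `Γ_x` on the fibre `E_x`. -/
def fibreRep (x : M) : Representation ℂ (MulAction.stabilizer Γ x) (E x) where
  toFun γ := (fibreCast (E := E) γ.2).comp (EquivariantBundle.act n F γ.1 x)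
  map_one' := by
    ext v
    refine TotalSpace.mk_injective (F := F) x ?_
    exact (mk_fibreCast F _ _).trans (EquivariantBundle.one_act x v)
  map_mul' γ δ := by
    ext v
    refine TotalSpace.mk_injective (F := F) x ?_
    refine (mk_fibreCast F _ _).trans ((EquivariantBundle.mul_act γ.1 δ.1 x v).trans ?_)
    refine Eq.trans ?_ (mk_fibreCast F _ _).symm
    have key : ∀ (y : M) (w : E y) (z : M) (w' : E z),
        TotalSpace.mk' F y w = TotalSpace.mk' F z w' →
        TotalSpace.mk' F _ (EquivariantBundle.act n F γ.1 y w) =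
          TotalSpace.mk' F _ (EquivariantBundle.act n F γ.1 z w') := by
      intro y w z w' h
      exact congrArg (fun p : TotalSpace F E =>
        TotalSpace.mk' F (γ.1 • p.proj) (EquivariantBundle.act n F γ.1 p.proj p.2)) h
    exact key _ _ _ _ (mk_fibreCast F δ.2 _).symm

variable [IsManifold (𝓡 n) ∞ M] [SmoothAction n Γ M]

/-- The representation of the isotropy group `Γ_ξ ⊆ Γ_x` of a covector `ξ ∈ T^*_x M` on `E_x`. -/
def covectorFibreRep (ζ : Cotangent n M) :
    Representation ℂ (MulAction.stabilizer Γ ζ) (E ζ.proj) :=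
  (fibreRep n F E ζ.proj).comp (Subgroup.inclusion (fun _ h => congrArg TotalSpace.proj h))

/-- `E_{xρ}`, the `ρ`-isotypical component of the fibre `E_x` for `ρ` in the dual of `Γ_ξ`. -/
def fibreIsotypic (ζ : Cotangent n M) (ρ : Dual (MulAction.stabilizer Γ ζ)) :
    Submodule ℂ (E ζ.proj) :=
  isotypicPart ρ.rep (covectorFibreRep n F E ζ)

end FibreRep

/-! ## The spaces `X_{M,Γ}` and `X^α_{M,Γ}` -/

section XSpaces

variable (n : ℕ) (Γ M : Type*) [Group Γ] [TopologicalSpace M] [ChartedSpace (Rn n) M]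
  [IsManifold (𝓡 n) ∞ M] [MulAction Γ M] [SmoothAction n Γ M]

/-- Pairs of a covector `ξ` and an irreducible representation of its isotropy group `Γ_ξ`. -/
abbrev IsotropyPair : Type _ := Σ ζ : Cotangent n M, Dual (MulAction.stabilizer Γ ζ)

/-- `X_{M,Γ} = {(ξ, ρ) | ξ ∈ T^*M ∖ 0, ρ ∈ Γ̂_ξ}`. -/
def XSet : Set (IsotropyPair n Γ M) := {p | p.1.2 ≠ 0}

variable {n Γ M}

/-- The component of `M/Γ` that contains the orbit of `x`. -/
def orbitComponent (Γ : Type*) {M : Type*} [Group Γ] [TopologicalSpace M] [MulAction Γ M] (x : M) :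
    ConnectedComponents (Quotient (MulAction.orbitRel Γ M)) :=
  ConnectedComponents.mk (Quotient.mk (MulAction.orbitRel Γ M) x)

/-- `Γ₀` chooses, for every connected component `C` of `M/Γ`, a minimal element among the isotropy
groups of the points of `M` that lie over `C`. (It is unique up to conjugation.) -/
def IsMinimalIsotropy
    (Γ₀ : ConnectedComponents (Quotient (MulAction.orbitRel Γ M)) → Subgroup Γ) : Prop :=
  ∀ c, Minimal (fun H => ∃ x : M, orbitComponent Γ x = c ∧ MulAction.stabilizer Γ x = H) (Γ₀ c)

/-- The conjugate `g • ρ ∈ Γ̂_{gξ}` of `ρ ∈ Γ̂_ξ`, as a representation of `Γ_{gξ} = g Γ_ξ g⁻¹`: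
`(g • ρ)(h) = ρ(g⁻¹ h g)`. -/
def conjRep (g : Γ) (ζ : Cotangent n M) (ρ : Dual (MulAction.stabilizer Γ ζ)) :
    Representation ℂ (MulAction.stabilizer Γ (g • ζ)) ρ.Space :=
  ρ.rep.comp (MonoidHom.codRestrict
    ((MulAut.conj g⁻¹).toMonoidHom.comp (MulAction.stabilizer Γ (g • ζ)).subtype) _ (by
      intro h
      have := h.2
      rw [MulAction.mem_stabilizer_iff] at this ⊢
      simp only [MonoidHom.comp_apply, Subgroup.coe_subtype, MulEquiv.coe_toMonoidHom,
        MulAut.conj_apply, inv_inv, mul_smul, this, inv_smul_smul]))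

/-- `X^α_{M,Γ}`: the pairs `(ξ, ρ) ∈ X_{M,Γ}` for which there is a `g ∈ Γ` with `Γ₀ ⊆ Γ_{gξ}` and
`Hom_{Γ₀}(g • ρ, α) ≠ 0`, where `Γ₀` belongs to the component of `M/Γ` over which `ξ` lies. -/
def XAlpha (Γ₀ : ConnectedComponents (Quotient (MulAction.orbitRel Γ M)) → Subgroup Γ)
    (α : Dual Γ) : Set (IsotropyPair n Γ M) :=
  {p | p ∈ XSet n Γ M ∧ ∃ (g : Γ)
    (hg : Γ₀ (orbitComponent Γ p.1.proj) ≤ MulAction.stabilizer Γ (g • p.1)),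
    ∃ T : Representation.IntertwiningMap
        ((conjRep g p.1 p.2).comp (Subgroup.inclusion hg))
        (α.rep.comp (Γ₀ (orbitComponent Γ p.1.proj)).subtype), T ≠ 0}

end XSpaces

/-! ## Classical pseudodifferential operators -/

/-- `a` is a classical symbol of order `m` on `ℝⁿ × ℝⁿ` with homogeneous terms `b 0, b 1, …`:
`a` is a smooth symbol of order `m`, each `b j` is smooth for `ξ ≠ 0` and homogeneous of degree
`m - j` in `ξ`, and `a - ∑_{j < N} b j` satisfies for `|ξ| ≥ 1` the estimates of a symbol of
order `m - N`. The estimates are those for all mixed derivatives: `k` derivatives in `y` and `l`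
derivatives in `ξ`. -/
structure IsClassicalSymbol {n : ℕ} (m : ℝ) (a : Rn n → Rn n → ℂ) (b : ℕ → Rn n → Rn n → ℂ) :
    Prop where
  smooth : ContDiff ℝ ∞ (fun p : Rn n × Rn n => a p.1 p.2)
  bound : ∀ k l : ℕ, ∃ C : ℝ, ∀ y ξ : Rn n,
    ‖iteratedFDeriv ℝ l (fun η => iteratedFDeriv ℝ k (fun z => a z η) y) ξ‖ ≤
      C * (1 + ‖ξ‖) ^ (m - l)
  smooth_term : ∀ j, ContDiffOn ℝ ∞ (fun p : Rn n × Rn n => b j p.1 p.2) {p | p.2 ≠ 0}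
  homogeneous : ∀ j y ξ, ξ ≠ 0 → ∀ t : ℝ, 0 < t → b j y (t • ξ) = ((t ^ (m - j) : ℝ) : ℂ) * b j y ξ
  expansion : ∀ N k l : ℕ, ∃ C : ℝ, ∀ y ξ : Rn n, 1 ≤ ‖ξ‖ →
    ‖iteratedFDeriv ℝ l (fun η => iteratedFDeriv ℝ k
      (fun z => a z η - ∑ j ∈ Finset.range N, b j z η) y) ξ‖ ≤ C * ‖ξ‖ ^ (m - N - l)

/-- The operator `Op(a)u(y) = (2π)^{-n} ∫ e^{i y·ξ} a(y, ξ) û(ξ) dξ` with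
`û(ξ) = ∫ e^{-i x·ξ} u(x) dx`, written with the Fourier transform
`𝓕 u(η) = ∫ e^{-2πi x·η} u(x) dx` through `ξ = 2πη`. -/
def quantize {n : ℕ} (a : Rn n → Rn n → ℂ) (u : 𝓢(Rn n, ℂ)) (y : Rn n) : ℂ :=
  ∫ η : Rn n, Complex.exp (2 * Real.pi * Complex.I * (inner ℝ y η : ℝ)) *
    a y ((2 * Real.pi) • η) * 𝓕 (fun x => u x) η

section PsiDO

variable (n : ℕ) {M : Type*} [TopologicalSpace M] [ChartedSpace (Rn n) M]
  {F₀ : Type*} [NormedAddCommGroup F₀] [NormedSpace ℂ F₀]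
  {E₀ : M → Type*} [TopologicalSpace (TotalSpace F₀ E₀)] [∀ x, AddCommGroup (E₀ x)]
  [∀ x, Module ℂ (E₀ x)] [∀ x, TopologicalSpace (E₀ x)] [FiberBundle F₀ E₀] [VectorBundle ℂ F₀ E₀]
  {F₁ : Type*} [NormedAddCommGroup F₁] [NormedSpace ℂ F₁]
  {E₁ : M → Type*} [TopologicalSpace (TotalSpace F₁ E₁)] [∀ x, AddCommGroup (E₁ x)]
  [∀ x, Module ℂ (E₁ x)] [∀ x, TopologicalSpace (E₁ x)] [FiberBundle F₁ E₁] [VectorBundle ℂ F₁ E₁]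

/-- In the chart `e`, the scalar operator `u ↦ ⟨ℓ, P(u s)⟩` is `Op(a)`. Here `s` and `ℓ` are
supported in the domain of `e`; they play the role of the local frames and of the cut-offs. -/
def IsLocalSymbol (P : smoothSections n F₀ E₀ →ₗ[ℂ] smoothSections n F₁ E₁)
    (e : OpenPartialHomeomorph M (Rn n)) (s : smoothSections n F₀ E₀) (ℓ : ∀ x, E₁ x →ₗ[ℂ] ℂ)
    (a : Rn n → Rn n → ℂ) : Prop :=
  ∀ (u : 𝓢(Rn n, ℂ)) (w : smoothSections n F₀ E₀), (∀ x, w.1 x = u (e x) • s.1 x) →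
    ∀ y ∈ e.target, ℓ (e.symm y) ((P w).1 (e.symm y)) = quantize a u y

/-- Admissible data for reading an operator in a chart: a chart `e` of the maximal smooth atlas
(its domain need not be connected), a smooth section `s` of `E₀` and a smooth section `ℓ` of the
dual of `E₁`, both supported in the domain of `e`. -/
structure IsLocalData (e : OpenPartialHomeomorph M (Rn n)) (s : smoothSections n F₀ E₀)
    (ℓ : ∀ x, E₁ x →ₗ[ℂ] ℂ) : Prop where
  mem_atlas : e ∈ IsManifold.maximalAtlas (𝓡 n) ∞ M
  support_section : closure {x | s.1 x ≠ 0} ⊆ e.source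
  smooth_cosection : IsSmoothCosection n (F := F₁) E₁ ℓ
  support_cosection : closure {x | ℓ x ≠ 0} ⊆ e.source

/-- `P ∈ ψ^m(M; E₀, E₁)`: a linear map between the spaces of smooth sections which, in all charts
and after cutting off, is the quantization of a classical symbol of order `m`. (As every two points
of `M` lie in the domain of a common chart, this contains the smoothness of the kernel of `P` off
the diagonal. The manifold is compact, so that there is no condition on supports.) -/
def IsPsiDO (m : ℝ) (P : smoothSections n F₀ E₀ →ₗ[ℂ] smoothSections n F₁ E₁) : Prop :=
  ∀ (e : OpenPartialHomeomorph M (Rn n)) (s : smoothSections n F₀ E₀) (ℓ : ∀ x, E₁ x →ₗ[ℂ] ℂ),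
    IsLocalData n (F₁ := F₁) e s ℓ → ∃ a b, IsClassicalSymbol m a b ∧ IsLocalSymbol n P e s ℓ a

variable [IsManifold (𝓡 n) ∞ M]

/-- The covector at `e⁻¹(y)` with coordinates `η` in the chart `e`: the pull-back of `η` by the
derivative of `e`. -/
def chartCovector (e : OpenPartialHomeomorph M (Rn n)) (y η : Rn n) : Cotangent n M :=
  ⟨e.symm y, (innerSL ℝ η).comp (mfderiv (𝓡 n) 𝓘(ℝ, Rn n) e (e.symm y))⟩

/-- `σ` is the principal symbol `σ_m(P)` of `P ∈ ψ^m(M; E₀, E₁)`, a section of `Hom(E₀, E₁)` over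
`T^*M ∖ 0`: in all charts it is the leading term of the local symbols. (This determines `σ` away
from the zero section; the values on the zero section are irrelevant.) -/
def IsPrincipalSymbol (m : ℝ) (P : smoothSections n F₀ E₀ →ₗ[ℂ] smoothSections n F₁ E₁)
    (σ : ∀ ζ : Cotangent n M, E₀ ζ.proj →ₗ[ℂ] E₁ ζ.proj) : Prop :=
  ∀ (e : OpenPartialHomeomorph M (Rn n)) (s : smoothSections n F₀ E₀) (ℓ : ∀ x, E₁ x →ₗ[ℂ] ℂ)
    (a : Rn n → Rn n → ℂ) (b : ℕ → Rn n → Rn n → ℂ),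
    IsLocalData n (F₁ := F₁) e s ℓ → IsClassicalSymbol m a b → IsLocalSymbol n P e s ℓ a →
    ∀ y ∈ e.target, ∀ η : Rn n, η ≠ 0 →
      ℓ (e.symm y) (σ (chartCovector n e y η) (s.1 (e.symm y))) = b 0 y η

/-- `P ∈ ψ^m(M; E₀, E₁)` is elliptic: its principal symbol is invertible on `T^*M ∖ 0`. -/
def IsElliptic (m : ℝ) (P : smoothSections n F₀ E₀ →ₗ[ℂ] smoothSections n F₁ E₁) : Prop :=
  ∃ σ, IsPrincipalSymbol n m P σ ∧
    ∀ ζ : Cotangent n M, ζ.2 ≠ 0 → Function.Bijective (σ ζ)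

variable {Γ : Type*} [Group Γ] [MulAction Γ M]
  [EquivariantBundle n Γ F₀ E₀] [EquivariantBundle n Γ F₁ E₁]

variable (Γ) in
/-- `P` is `Γ`-invariant: if `t = γ s` then `P t = γ (P s)`, where `(γ s)(γ x) = γ (s(x))`. -/
def IsInvariantOperator (P : smoothSections n F₀ E₀ →ₗ[ℂ] smoothSections n F₁ E₁) : Prop :=
  ∀ (γ : Γ) (s t : smoothSections n F₀ E₀),
    (∀ x, t.1 (γ • x) = EquivariantBundle.act n F₀ γ x (s.1 x)) →
    ∀ x, (P t).1 (γ • x) = EquivariantBundle.act n F₁ γ x ((P s).1 x)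

variable [SmoothAction n Γ M]

/-- `P ∈ ψ^m(M; E₀, E₁)^Γ` is `α`-elliptic: for all `(ξ, ρ) ∈ X^α_{M,Γ}` the restriction
`π_ρ(σ_m(P)(ξ)) : E₀_{xρ} → E₁_{xρ}` of the principal symbol is invertible. -/
def IsAlphaElliptic (Γ₀ : ConnectedComponents (Quotient (MulAction.orbitRel Γ M)) → Subgroup Γ)
    (α : Dual Γ) (m : ℝ) (P : smoothSections n F₀ E₀ →ₗ[ℂ] smoothSections n F₁ E₁) : Prop :=
  ∃ σ, IsPrincipalSymbol n m P σ ∧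
    ∀ p ∈ XAlpha (n := n) Γ₀ α, Set.BijOn (σ p.1)
      (fibreIsotypic n F₀ E₀ p.1 p.2) (fibreIsotypic n F₁ E₁ p.1 p.2)

end PsiDO

/-! ## Hermitian bundles and the Hilbert space `L²(M; E)` -/

/-- The Hermitian metric on the fibres of `E` is smooth. -/
class SmoothHermitian (n : ℕ) {M : Type*} (F : Type*)
    [TopologicalSpace M] [ChartedSpace (Rn n) M] [NormedAddCommGroup F] [NormedSpace ℂ F]
    (E : M → Type*) [TopologicalSpace (TotalSpace F E)] [∀ x, NormedAddCommGroup (E x)]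
    [∀ x, InnerProductSpace ℂ (E x)] [FiberBundle F E] [VectorBundle ℂ F E] : Prop where
  contMDiff_inner : ∀ s ∈ smoothSections n F E, ∀ t ∈ smoothSections n F E,
    ContMDiff (𝓡 n) 𝓘(ℝ, ℂ) ∞ (fun x => inner ℂ (s x) (t x))

/-- `Γ` preserves the Hermitian metric of the equivariant bundle `E`. -/
class InvariantHermitian (n : ℕ) (Γ : Type*) {M : Type*} (F : Type*) [Group Γ]
    [TopologicalSpace M] [ChartedSpace (Rn n) M] [MulAction Γ M]
    [NormedAddCommGroup F] [NormedSpace ℂ F]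
    (E : M → Type*) [TopologicalSpace (TotalSpace F E)] [∀ x, NormedAddCommGroup (E x)]
    [∀ x, InnerProductSpace ℂ (E x)] [FiberBundle F E] [EquivariantBundle n Γ F E] : Prop where
  inner_act : ∀ (γ : Γ) (x : M) (v w : E x),
    inner ℂ (EquivariantBundle.act n F γ x v) (EquivariantBundle.act n F γ x w) = inner ℂ v w

/-- `μ` is a smooth positive measure on `M`: in every chart it has a smooth positive density with
respect to Lebesgue measure. (Riemannian volume measures are of this kind.) -/
def IsSmoothMeasure (n : ℕ) {M : Type*} [TopologicalSpace M] [ChartedSpace (Rn n) M]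
    [MeasurableSpace M] (μ : Measure M) : Prop :=
  ∀ e ∈ IsManifold.maximalAtlas (𝓡 n) ∞ M, ∃ w : Rn n → ℝ, ContDiffOn ℝ ∞ w e.target ∧
    (∀ y ∈ e.target, 0 < w y) ∧
    Measure.map e (μ.restrict e.source) =
      (volume.restrict e.target).withDensity (fun y => ENNReal.ofReal (w y))

section LTwo

variable (n : ℕ) {M : Type*} (F : Type*) [TopologicalSpace M] [ChartedSpace (Rn n) M]
  [NormedAddCommGroup F] [NormedSpace ℂ F]
  (E : M → Type*) [TopologicalSpace (TotalSpace F E)] [∀ x, NormedAddCommGroup (E x)]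
  [∀ x, InnerProductSpace ℂ (E x)] [FiberBundle F E] [VectorBundle ℂ F E]
  [CompactSpace M] [MeasurableSpace M] [BorelSpace M] (μ : Measure M) [IsFiniteMeasure μ]

/-- The smooth sections of `E`, with the inner product `∫ ⟨s(x), t(x)⟩ dμ(x)`. -/
def PreLTwo {n : ℕ} {M : Type*} (F : Type*) [TopologicalSpace M] [ChartedSpace (Rn n) M]
    [NormedAddCommGroup F] [NormedSpace ℂ F]
    (E : M → Type*) [TopologicalSpace (TotalSpace F E)] [∀ x, NormedAddCommGroup (E x)]
    [∀ x, InnerProductSpace ℂ (E x)] [FiberBundle F E] [VectorBundle ℂ F E]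
    [MeasurableSpace M] (_μ : Measure M) : Type _ :=
  smoothSections n F E

instance : AddCommGroup (PreLTwo (n := n) F E μ) :=
  inferInstanceAs (AddCommGroup (smoothSections n F E))

instance : Module ℂ (PreLTwo (n := n) F E μ) :=
  inferInstanceAs (Module ℂ (smoothSections n F E))

variable [SmoothHermitian n F E]

variable {n F E} in
lemma integrable_inner (s t : smoothSections n F E) :
    Integrable (fun x => (inner ℂ (s.1 x) (t.1 x) : ℂ)) μ :=
  (SmoothHermitian.contMDiff_inner s.1 s.2 t.1 t.2).continuous.integrable_of_hasCompactSupport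
    (HasCompactSupport.of_compactSpace _)

/-- The `L²` inner product of smooth sections. -/
@[reducible] def preLTwoCore : PreInnerProductSpace.Core ℂ (PreLTwo (n := n) F E μ) where
  inner s t := ∫ x, inner ℂ (s.1 x) (t.1 x) ∂μ
  conj_inner_symm s t := by
    rw [← integral_conj]
    simp
  re_inner_nonneg s := by
    rw [← integral_re (integrable_inner μ s s)]
    exact integral_nonneg fun x => inner_self_nonneg
  add_left s t w := by
    rw [← integral_add (integrable_inner μ s w) (integrable_inner μ t w)]
    exact integral_congr_ae (.of_forall fun x => inner_add_left (s.1 x) (t.1 x) (w.1 x))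
  smul_left s t c := by
    rw [← integral_const_mul]
    exact integral_congr_ae (.of_forall fun x => inner_smul_left (s.1 x) (t.1 x) c)

instance : SeminormedAddCommGroup (PreLTwo (n := n) F E μ) :=
  @InnerProductSpace.Core.toSeminormedAddCommGroup ℂ _ _ _ _ (preLTwoCore n F E μ)

instance : InnerProductSpace ℂ (PreLTwo (n := n) F E μ) :=
  InnerProductSpace.ofCore (preLTwoCore n F E μ)

/-- The Hilbert space `L²(M; E)`: the completion of the smooth sections. -/
abbrev LTwo : Type _ := UniformSpace.Completion (PreLTwo (n := n) F E μ)

/-- The map from the smooth sections to `L²(M; E)`. -/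
def toLTwo : smoothSections n F E →ₗ[ℂ] LTwo n F E μ :=
  (UniformSpace.Completion.toComplL (𝕜 := ℂ) (E := PreLTwo (n := n) F E μ)).toLinearMap

lemma denseRange_toLTwo : DenseRange (toLTwo n F E μ) :=
  UniformSpace.Completion.denseRange_coe (α := PreLTwo (n := n) F E μ)

lemma norm_toLTwo_sq (s : smoothSections n F E) :
    ‖toLTwo n F E μ s‖ ^ 2 = (∫ x, inner ℂ (s.1 x) (s.1 x) ∂μ).re := by
  have h : ∀ s' : PreLTwo (n := n) F E μ, ‖(s' : LTwo n F E μ)‖ ^ 2 =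
      RCLike.re (inner ℂ s' s') := by
    intro s'
    rw [UniformSpace.Completion.norm_coe, inner_self_eq_norm_sq]
  exact h s

end LTwo

lemma inner_fibreCast {M : Type*} {E : M → Type*} [∀ x, NormedAddCommGroup (E x)]
    [∀ x, InnerProductSpace ℂ (E x)] {x y : M} (h : x = y) (v w : E x) :
    (inner ℂ (fibreCast h v) (fibreCast h w) : ℂ) = inner ℂ v w := by
  subst h; rfl

section Unitary

variable (n : ℕ) {Γ M : Type*} (F : Type*) [Group Γ] [TopologicalSpace M] [ChartedSpace (Rn n) M]
  [MulAction Γ M] [SmoothAction n Γ M]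
  [NormedAddCommGroup F] [NormedSpace ℂ F]
  (E : M → Type*) [TopologicalSpace (TotalSpace F E)]

/-- The action of `γ ∈ Γ` on smooth sections: `(γ s)(x) = γ (s(γ⁻¹ x))`. -/
def translate [∀ x, AddCommGroup (E x)]
    [∀ x, Module ℂ (E x)] [∀ x, TopologicalSpace (E x)] [FiberBundle F E] [VectorBundle ℂ F E]
    [EquivariantBundle n Γ F E] (γ : Γ) : smoothSections n F E →ₗ[ℂ] smoothSections n F E where
  toFun s := ⟨fun x => fibreCast (smul_inv_smul γ x)
      (EquivariantBundle.act n F γ (γ⁻¹ • x) (s.1 (γ⁻¹ • x))), by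
    have h := (EquivariantBundle.contMDiff_act (n := n) (F := F) (E := E) γ).comp
      (s.2.comp (SmoothAction.contMDiff_smul (n := n) (M := M) γ⁻¹))
    refine h.congr fun x => ?_
    exact mk_fibreCast F (smul_inv_smul γ x) _⟩
  map_add' s t := by ext x; simp
  map_smul' c s := by ext x; simp

lemma mk_translate [∀ x, AddCommGroup (E x)]
    [∀ x, Module ℂ (E x)] [∀ x, TopologicalSpace (E x)] [FiberBundle F E] [VectorBundle ℂ F E]
    [EquivariantBundle n Γ F E] (γ : Γ) (s : smoothSections n F E) {x y : M} (h : γ⁻¹ • x = y) :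
    TotalSpace.mk' F x ((translate n F E γ s).1 x) =
      TotalSpace.mk' F (γ • y) (EquivariantBundle.act n F γ y (s.1 y)) := by
  subst h
  exact mk_fibreCast F (smul_inv_smul γ x) _

lemma translate_one [∀ x, AddCommGroup (E x)]
    [∀ x, Module ℂ (E x)] [∀ x, TopologicalSpace (E x)] [FiberBundle F E] [VectorBundle ℂ F E]
    [EquivariantBundle n Γ F E] (s : smoothSections n F E) : translate n F E (1 : Γ) s = s := by
  ext x
  refine TotalSpace.mk_injective (F := F) x ?_
  exact (mk_translate n F E (1 : Γ) s (by simp)).trans (EquivariantBundle.one_act x _)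

lemma translate_mul [∀ x, AddCommGroup (E x)]
    [∀ x, Module ℂ (E x)] [∀ x, TopologicalSpace (E x)] [FiberBundle F E] [VectorBundle ℂ F E]
    [EquivariantBundle n Γ F E] (γ δ : Γ) (s : smoothSections n F E) :
    translate n F E (γ * δ) s = translate n F E γ (translate n F E δ s) := by
  ext x
  refine TotalSpace.mk_injective (F := F) x ?_
  refine (mk_translate n F E (γ * δ) s (y := δ⁻¹ • γ⁻¹ • x) (by simp [mul_smul])).trans ?_
  refine (EquivariantBundle.mul_act γ δ _ _).trans ?_
  refine Eq.trans ?_ (mk_translate n F E γ (translate n F E δ s) rfl).symm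
  exact (congrArg (fun p : TotalSpace F E =>
    TotalSpace.mk' F (γ • p.proj) (EquivariantBundle.act n F γ p.proj p.2))
    (mk_translate n F E δ s rfl)).symm

variable [∀ x, NormedAddCommGroup (E x)]
  [∀ x, InnerProductSpace ℂ (E x)] [FiberBundle F E] [VectorBundle ℂ F E]
  [CompactSpace M] [MeasurableSpace M] [BorelSpace M] (μ : Measure M) [IsFiniteMeasure μ]
  [SmoothHermitian n F E] [EquivariantBundle n Γ F E] [InvariantHermitian n Γ F E]
  [SMulInvariantMeasure Γ M μ]

lemma norm_translate (γ : Γ) (s : smoothSections n F E) :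
    ‖toLTwo n F E μ (translate n F E γ s)‖ = ‖toLTwo n F E μ s‖ := by
  refine (sq_eq_sq₀ (norm_nonneg _) (norm_nonneg _)).1 ?_
  rw [norm_toLTwo_sq, norm_toLTwo_sq]
  congr 1
  have hc : ContinuousConstSMul Γ M :=
    ⟨fun γ => (SmoothAction.contMDiff_smul (n := n) γ).continuous⟩
  have hm : MeasurableConstSMul Γ M := ⟨fun γ => (continuous_const_smul γ).measurable⟩
  rw [← integral_smul_eq_self (fun x => (inner ℂ (s.1 x) (s.1 x) : ℂ)) (g := γ⁻¹)]
  refine integral_congr_ae (.of_forall fun x => ?_)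
  exact (inner_fibreCast _ _ _).trans (InvariantHermitian.inner_act (n := n) (F := F) γ _ _ _)

/-- The unitary operator of `γ ∈ Γ` on `L²(M; E)`: the extension of the action on smooth
sections by continuity. -/
def unitaryOp (γ : Γ) : LTwo n F E μ →L[ℂ] LTwo n F E μ :=
  ((toLTwo n F E μ).comp (translate n F E γ)).extendOfNorm (toLTwo n F E μ)

lemma unitaryOp_toLTwo (γ : Γ) (s : smoothSections n F E) :
    unitaryOp n F E μ γ (toLTwo n F E μ s) = toLTwo n F E μ (translate n F E γ s) :=
  LinearMap.extendOfNorm_eq (denseRange_toLTwo n F E μ)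
    ⟨1, fun s => by rw [one_mul]; exact (norm_translate n F E μ γ s).le⟩ s

lemma clm_ext_toLTwo {S T : LTwo n F E μ →L[ℂ] LTwo n F E μ}
    (h : ∀ s, S (toLTwo n F E μ s) = T (toLTwo n F E μ s)) : S = T :=
  ContinuousLinearMap.ext fun v => congrFun
    ((denseRange_toLTwo n F E μ).equalizer S.continuous T.continuous (funext h)) v

variable (Γ) in
/-- The representation of `Γ` on `L²(M; E)`. -/
def lTwoRep : Representation ℂ Γ (LTwo n F E μ) where
  toFun γ := (unitaryOp n F E μ γ).toLinearMap
  map_one' := congrArg ContinuousLinearMap.toLinearMap (clm_ext_toLTwo n F E μ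
    (S := unitaryOp n F E μ (1 : Γ)) (T := 1) fun s => by
      rw [unitaryOp_toLTwo, translate_one]; rfl)
  map_mul' γ δ := congrArg ContinuousLinearMap.toLinearMap (clm_ext_toLTwo n F E μ
    (S := unitaryOp n F E μ (γ * δ)) (T := unitaryOp n F E μ γ * unitaryOp n F E μ δ) fun s => by
      rw [unitaryOp_toLTwo, translate_mul, mul_apply_eq_comp, unitaryOp_toLTwo,
        unitaryOp_toLTwo])

end Unitary

/-! ## The symbol algebra and the restriction morphism -/

section ActCast

variable (n : ℕ) {Γ M : Type*} (F : Type*) [Group Γ] [TopologicalSpace M] [ChartedSpace (Rn n) M]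
  [MulAction Γ M] [NormedAddCommGroup F] [NormedSpace ℂ F]
  (E : M → Type*) [TopologicalSpace (TotalSpace F E)] [∀ x, NormedAddCommGroup (E x)]
  [∀ x, InnerProductSpace ℂ (E x)] [FiberBundle F E] [EquivariantBundle n Γ F E]

/-- The action of `γ` as a map `E_x → E_y`, where `γ x = y`. -/
def actCast (γ : Γ) {x y : M} (h : γ • x = y) : E x →ₗ[ℂ] E y :=
  (fibreCast h).comp (EquivariantBundle.act n F γ x)

lemma inner_actCast [InvariantHermitian n Γ F E] (γ : Γ) {x y : M} (h : γ • x = y) (v w : E x) :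
    (inner ℂ (actCast n F E γ h v) (actCast n F E γ h w) : ℂ) = inner ℂ v w :=
  (inner_fibreCast _ _ _).trans (InvariantHermitian.inner_act (n := n) (F := F) γ _ _ _)

lemma actCast_surjective (γ : Γ) {x y : M} (h : γ • x = y) :
    Function.Surjective (actCast n F E γ h) := by
  subst h
  intro w
  refine ⟨fibreCast (inv_smul_smul γ x) (EquivariantBundle.act n F γ⁻¹ (γ • x) w), ?_⟩
  refine TotalSpace.mk_injective (F := F) (γ • x) ?_
  refine (congrArg (fun p : TotalSpace F E =>
    TotalSpace.mk' F (γ • p.proj) (EquivariantBundle.act n F γ p.proj p.2))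
    (mk_fibreCast F (inv_smul_smul γ x) (EquivariantBundle.act n F γ⁻¹ (γ • x) w))).trans ?_
  refine (EquivariantBundle.mul_act γ γ⁻¹ (γ • x) w).symm.trans ?_
  rw [mul_inv_cancel]
  exact EquivariantBundle.one_act _ w

lemma adjoint_intertwines {V W : Type*} [NormedAddCommGroup V] [InnerProductSpace ℂ V]
    [CompleteSpace V] [NormedAddCommGroup W] [InnerProductSpace ℂ W] [CompleteSpace W]
    (U : V →ₗ[ℂ] W) (hU : ∀ v w, (inner ℂ (U v) (U w) : ℂ) = inner ℂ v w)
    (hs : Function.Surjective U) {A : V →L[ℂ] V} {B : W →L[ℂ] W} (h : ∀ v, B (U v) = U (A v))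
    (v : V) : ContinuousLinearMap.adjoint B (U v) = U (ContinuousLinearMap.adjoint A v) := by
  refine ext_inner_left ℂ fun w => ?_
  obtain ⟨w, rfl⟩ := hs w
  rw [ContinuousLinearMap.adjoint_inner_right, h, hU, hU, ContinuousLinearMap.adjoint_inner_right]

end ActCast


/-- Families of bounded operators on a family of Hilbert spaces, with the pointwise operations. -/
def FibreEnd {S : Type*} (H : S → Type*) [∀ i, NormedAddCommGroup (H i)]
    [∀ i, InnerProductSpace ℂ (H i)] : Type _ :=
  ∀ i, H i →L[ℂ] H i

section FibreEnd

variable {S : Type*} (H : S → Type*) [∀ i, NormedAddCommGroup (H i)]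
  [∀ i, InnerProductSpace ℂ (H i)]

instance : Ring (FibreEnd H) := inferInstanceAs (Ring (∀ i, H i →L[ℂ] H i))

instance : Algebra ℂ (FibreEnd H) := inferInstanceAs (Algebra ℂ (∀ i, H i →L[ℂ] H i))

instance [∀ i, CompleteSpace (H i)] : StarRing (FibreEnd H) :=
  inferInstanceAs (StarRing (∀ i, H i →L[ℂ] H i))

instance [∀ i, CompleteSpace (H i)] : StarModule ℂ (FibreEnd H) :=
  inferInstanceAs (StarModule ℂ (∀ i, H i →L[ℂ] H i))

end FibreEnd

section Algebra

variable {n : ℕ} {M : Type*} [TopologicalSpace M] [ChartedSpace (Rn n) M] [IsManifold (𝓡 n) ∞ M]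

/-- A smooth Riemannian metric on `M`. -/
abbrev RiemannianMetricOn (n : ℕ) (M : Type*) [TopologicalSpace M] [ChartedSpace (Rn n) M]
    [IsManifold (𝓡 n) ∞ M] : Type _ :=
  ContMDiffRiemannianMetric (𝓡 n) ∞ (Rn n) (fun x : M => TangentSpace (𝓡 n) x)

/-- `Γ` acts by isometries of the Riemannian metric `g`. -/
def IsInvariantMetric (Γ : Type*) [Group Γ] [MulAction Γ M] (g : RiemannianMetricOn n M) : Prop :=
  ∀ (γ : Γ) (x : M) (v w : TangentSpace (𝓡 n) x),
    g.inner (γ • x) (mfderiv (𝓡 n) (𝓡 n) (fun y : M => γ • y) x v)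
      (mfderiv (𝓡 n) (𝓡 n) (fun y : M => γ • y) x w) = g.inner x v w

/-- The unit cosphere bundle `S^*M`: a covector has length `1` if it is dual to a unit vector. -/
abbrev Cosphere (g : RiemannianMetricOn n M) : Type _ :=
  {ζ : Cotangent n M // ∃ v, g.inner ζ.proj v v = 1 ∧ g.inner ζ.proj v = ζ.2}

variable (Γ : Type*) {F : Type*} [Group Γ] [MulAction Γ M] [SmoothAction n Γ M]
  [NormedAddCommGroup F] [NormedSpace ℂ F]
  {E : M → Type*} [TopologicalSpace (TotalSpace F E)] [∀ x, NormedAddCommGroup (E x)]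
  [∀ x, InnerProductSpace ℂ (E x)] [FiberBundle F E] [VectorBundle ℂ F E]

variable (F) in
/-- `f` is a continuous section over `S^*M` of the lift of the bundle `End(E)`. -/
def IsContinuousSymbol (g : RiemannianMetricOn n M)
    (f : ∀ ζ : Cosphere g, E ζ.1.proj →L[ℂ] E ζ.1.proj) : Prop :=
  Continuous (fun ζ : Cosphere g =>
    TotalSpace.mk' (F →L[ℂ] F) (E := fun x : M => E x →L[ℂ] E x) ζ.1.proj (f ζ))

lemma isContinuousSymbol_iff (g : RiemannianMetricOn n M)
    (f : ∀ ζ : Cosphere g, E ζ.1.proj →L[ℂ] E ζ.1.proj) :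
    IsContinuousSymbol F g f ↔ ∀ ζ₀ : Cosphere g, ContinuousAt (fun ζ : Cosphere g =>
      ContinuousLinearMap.inCoordinates F E F E ζ₀.1.proj ζ.1.proj ζ₀.1.proj ζ.1.proj (f ζ)) ζ₀ := by
  have hp : Continuous (fun ζ : Cosphere g => ζ.1.proj) :=
    (FiberBundle.continuous_proj (Rn n →L[ℝ] ℝ)
      (fun x : M => TangentSpace (𝓡 n) x →L[ℝ] ℝ)).comp continuous_subtype_val
  rw [IsContinuousSymbol, continuous_iff_continuousAt]
  refine forall_congr' fun ζ₀ => ?_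
  rw [continuousAt_hom_bundle]
  exact ⟨fun h => h.2, fun h => ⟨hp.continuousAt, h⟩⟩

variable (F) in
/-- The `Γ`-invariance of a section of `End(E)` over `S^*M`: `f(γ ξ) ∘ γ = γ ∘ f(ξ)`. -/
def IsInvariantSymbol [EquivariantBundle n Γ F E] (g : RiemannianMetricOn n M)
    (f : ∀ ζ : Cosphere g, E ζ.1.proj →L[ℂ] E ζ.1.proj) : Prop :=
  ∀ (γ : Γ) (ζ ζ' : Cosphere g) (h : γ • ζ.1 = ζ'.1) (v : E ζ.1.proj),
    f ζ' (actCast n F E γ (congrArg TotalSpace.proj h) v) =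
      actCast n F E γ (congrArg TotalSpace.proj h) (f ζ v)

lemma eventually_mem_base (g : RiemannianMetricOn n M) (F : Type*) [NormedAddCommGroup F]
    (E : M → Type*) [TopologicalSpace (TotalSpace F E)] [∀ x, TopologicalSpace (E x)]
    [FiberBundle F E] (ζ₀ : Cosphere g) :
    ∀ᶠ ζ : Cosphere g in 𝓝 ζ₀, ζ.1.proj ∈ (trivializationAt F E ζ₀.1.proj).baseSet := by
  have hp : Continuous (fun ζ : Cosphere g => ζ.1.proj) :=
    (FiberBundle.continuous_proj (Rn n →L[ℝ] ℝ)
      (fun x : M => TangentSpace (𝓡 n) x →L[ℝ] ℝ)).comp continuous_subtype_val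
  exact hp.continuousAt.eventually_mem ((trivializationAt F E ζ₀.1.proj).open_baseSet.mem_nhds
    (FiberBundle.mem_baseSet_trivializationAt' _))

lemma isContinuousSymbol_algebraMap (g : RiemannianMetricOn n M) (c : ℂ) :
    IsContinuousSymbol F g (fun ζ => algebraMap ℂ (E ζ.1.proj →L[ℂ] E ζ.1.proj) c) := by
  rw [isContinuousSymbol_iff]
  intro ζ₀
  refine (continuousAt_const (y := algebraMap ℂ (F →L[ℂ] F) c)).congr ?_
  filter_upwards [eventually_mem_base g F E ζ₀] with ζ hζ
  rw [ContinuousLinearMap.inCoordinates_eq hζ hζ]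
  ext v
  simp only [Algebra.algebraMap_eq_smul_one, ContinuousLinearMap.comp_apply,
    smul_apply, one_apply_eq_self, map_smul,
    ContinuousLinearEquiv.coe_coe, ContinuousLinearEquiv.apply_symm_apply]

lemma IsContinuousSymbol.add {g : RiemannianMetricOn n M}
    {f f' : ∀ ζ : Cosphere g, E ζ.1.proj →L[ℂ] E ζ.1.proj}
    (h : IsContinuousSymbol F g f) (h' : IsContinuousSymbol F g f') :
    IsContinuousSymbol F g (f + f') := by
  rw [isContinuousSymbol_iff] at h h' ⊢
  intro ζ₀
  refine ((h ζ₀).add (h' ζ₀)).congr ?_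
  filter_upwards [eventually_mem_base g F E ζ₀] with ζ hζ
  ext v
  simp [ContinuousLinearMap.inCoordinates_eq hζ hζ]

lemma IsContinuousSymbol.congr {g : RiemannianMetricOn n M}
    {f f' : ∀ ζ : Cosphere g, E ζ.1.proj →L[ℂ] E ζ.1.proj}
    (h : IsContinuousSymbol F g f) (e : ∀ ζ, f ζ = f' ζ) : IsContinuousSymbol F g f' := by
  have e' : f = f' := funext e
  subst e'
  exact h

lemma inCoordinates_comp {F : Type*} [NormedAddCommGroup F] [NormedSpace ℂ F]
    {E : M → Type*} [TopologicalSpace (TotalSpace F E)] [∀ x, AddCommGroup (E x)]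
    [∀ x, Module ℂ (E x)] [∀ x, TopologicalSpace (E x)] [FiberBundle F E] [VectorBundle ℂ F E]
    {x₀ x : M} (hx : x ∈ (trivializationAt F E x₀).baseSet) (A B : E x →L[ℂ] E x) :
    (ContinuousLinearMap.inCoordinates F E F E x₀ x x₀ x A).comp
      (ContinuousLinearMap.inCoordinates F E F E x₀ x x₀ x B) =
      ContinuousLinearMap.inCoordinates F E F E x₀ x x₀ x (A.comp B) := by
  ext v
  exact congrArg (fun w => (trivializationAt F E x₀).continuousLinearMapAt ℂ x (A w))
    ((trivializationAt F E x₀).symmL_continuousLinearMapAt hx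
      (B ((trivializationAt F E x₀).symmL ℂ x v)))

lemma IsContinuousSymbol.mul {g : RiemannianMetricOn n M}
    {f f' : ∀ ζ : Cosphere g, E ζ.1.proj →L[ℂ] E ζ.1.proj}
    (h : IsContinuousSymbol F g f) (h' : IsContinuousSymbol F g f') :
    IsContinuousSymbol F g (fun ζ => (f ζ).comp (f' ζ)) := by
  rw [isContinuousSymbol_iff] at h h' ⊢
  intro ζ₀
  have hc := (h ζ₀).clm_comp (h' ζ₀)
  refine hc.congr ?_
  filter_upwards [eventually_mem_base g F E ζ₀] with ζ hζ
  exact inCoordinates_comp hζ (f ζ) (f' ζ)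

lemma IsInvariantSymbol.star {Γ : Type*} {F : Type*} [Group Γ] [MulAction Γ M] [SmoothAction n Γ M]
    [NormedAddCommGroup F] [NormedSpace ℂ F] {E : M → Type*} [TopologicalSpace (TotalSpace F E)]
    [∀ x, NormedAddCommGroup (E x)] [∀ x, InnerProductSpace ℂ (E x)] [FiberBundle F E] [∀ x, CompleteSpace (E x)] [EquivariantBundle n Γ F E]
    [InvariantHermitian n Γ F E] {g : RiemannianMetricOn n M}
    {f : ∀ ζ : Cosphere g, E ζ.1.proj →L[ℂ] E ζ.1.proj} (h : IsInvariantSymbol Γ F g f) :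
    IsInvariantSymbol Γ F g (fun ζ => ContinuousLinearMap.adjoint (f ζ)) := by
  intro γ ζ ζ' hζ v
  exact adjoint_intertwines (actCast n F E γ (congrArg TotalSpace.proj hζ))
    (inner_actCast n F E γ _) (actCast_surjective n F E γ _) (h γ ζ ζ' hζ) v

variable (n F E) in
/-- The algebra `A_M^Γ = C(S^*M; End(E))^Γ` of `Γ`-invariant continuous symbols. (The adjoint of a
continuous section is continuous, so that the second condition follows from the first.) -/
def symbolAlgebra [∀ x, CompleteSpace (E x)] [EquivariantBundle n Γ F E]
    [InvariantHermitian n Γ F E] (g : RiemannianMetricOn n M) :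
    StarSubalgebra ℂ (FibreEnd (fun ζ : Cosphere g => E ζ.1.proj)) where
  carrier := {f | IsContinuousSymbol F g f ∧
    IsContinuousSymbol F g (fun ζ => ContinuousLinearMap.adjoint (f ζ)) ∧ IsInvariantSymbol Γ F g f}
  mul_mem' {f f'} h h' := by
    refine ⟨h.1.mul h'.1, (h'.2.1.mul h.2.1).congr fun ζ => ?_, fun γ ζ ζ' hζ v => ?_⟩
    · exact (ContinuousLinearMap.adjoint_comp (f ζ) (f' ζ)).symm
    · exact (congrArg (f ζ') (h'.2.2 γ ζ ζ' hζ v)).trans (h.2.2 γ ζ ζ' hζ (f' ζ v))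
  add_mem' {f f'} h h' := by
    refine ⟨h.1.add h'.1, (h.2.1.add h'.2.1).congr fun ζ => ?_, fun γ ζ ζ' hζ v => ?_⟩
    · exact (map_add ContinuousLinearMap.adjoint (f ζ) (f' ζ)).symm
    · exact (congrArg₂ (· + ·) (h.2.2 γ ζ ζ' hζ v) (h'.2.2 γ ζ ζ' hζ v)).trans
        (map_add _ _ _).symm
  algebraMap_mem' c := by
    refine ⟨isContinuousSymbol_algebraMap g c,
      (isContinuousSymbol_algebraMap g (star c)).congr fun ζ => ?_, fun γ ζ ζ' hζ v => ?_⟩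
    · exact algebraMap_star_comm (A := E ζ.1.proj →L[ℂ] E ζ.1.proj) c
    · exact (map_smul (actCast n F E γ (congrArg TotalSpace.proj hζ)) c v).symm
  star_mem' {f} h := by
    refine ⟨h.2.1, h.1.congr fun ζ => ?_, IsInvariantSymbol.star h.2.2⟩
    exact (ContinuousLinearMap.adjoint_adjoint (f ζ)).symm

end Algebra

section Restriction

variable (n : ℕ) (Γ : Type*) {M : Type*} (F : Type*) [Group Γ] [TopologicalSpace M]
  [ChartedSpace (Rn n) M] [IsManifold (𝓡 n) ∞ M]
  [CompactSpace M] [MeasurableSpace M] [BorelSpace M] (μ : Measure M) [IsFiniteMeasure μ]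
  [MulAction Γ M] [SmoothAction n Γ M] [SMulInvariantMeasure Γ M μ]
  [NormedAddCommGroup F] [NormedSpace ℂ F]
  (E : M → Type*) [TopologicalSpace (TotalSpace F E)] [∀ x, NormedAddCommGroup (E x)]
  [∀ x, InnerProductSpace ℂ (E x)] [∀ x, CompleteSpace (E x)] [FiberBundle F E]
  [VectorBundle ℂ F E] [SmoothHermitian n F E] [EquivariantBundle n Γ F E]
  [InvariantHermitian n Γ F E]

variable {n F E} in
/-- The bounded operator `T` on `L²(M; E)` extends the operator `P` on smooth sections. -/
def Extends (P : smoothSections n F E →ₗ[ℂ] smoothSections n F E)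
    (T : LTwo n F E μ →L[ℂ] LTwo n F E μ) : Prop :=
  ∀ s, T (toLTwo n F E μ s) = toLTwo n F E μ (P s)

/-- The norm closure of `ψ^k(M; E)` in the bounded operators on `L²(M; E)`, for `k ≤ 0`. -/
def psiClosure (k : ℝ) : Set (LTwo n F E μ →L[ℂ] LTwo n F E μ) :=
  closure {T | ∃ P, IsPsiDO n k P ∧ Extends μ P T}

/-- The `Γ`-invariant elements of the norm closure of `ψ^k(M; E)`. -/
def psiClosureInv (k : ℝ) : Set (LTwo n F E μ →L[ℂ] LTwo n F E μ) :=
  {T | T ∈ psiClosure n F μ E k ∧ ∀ (γ : Γ) (v : LTwo n F E μ),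
    T (lTwoRep n Γ F E μ γ v) = lTwoRep n Γ F E μ γ (T v)}

variable {n F E} in
/-- `f` is the principal symbol `σ_0(T)` of `T` in the norm closure of `ψ^0(M; E)`, where `σ_0` is
extended by continuity: `(T, f)` is the limit, for the operator norm and for uniform convergence on
`S^*M`, of pairs of an operator in `ψ^0(M; E)` and its principal symbol. -/
def HasSymbol (g : RiemannianMetricOn n M) (T : LTwo n F E μ →L[ℂ] LTwo n F E μ)
    (f : ∀ ζ : Cosphere g, E ζ.1.proj →L[ℂ] E ζ.1.proj) : Prop :=
  ∀ ε : ℝ, 0 < ε → ∃ P S σ, IsPsiDO n 0 P ∧ Extends μ P S ∧ IsPrincipalSymbol n 0 P σ ∧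
    ‖T - S‖ ≤ ε ∧ ∀ (ζ : Cosphere g) (v : E ζ.1.proj), ‖f ζ v - σ ζ.1 v‖ ≤ ε * ‖v‖

/-- The kernel of the map
`R_M : A_M^Γ ≃ ψ⁰(M; E)^Γ / ψ⁻¹(M; E)^Γ → π_α(ψ⁰(M; E)^Γ) / π_α(ψ⁻¹(M; E)^Γ)`
(norm closures understood), where `π_α` is the restriction to the `α`-isotypical component of
`L²(M; E)`: the symbols of the `T` whose restriction `π_α(T)` equals `π_α(K)` for some `K` in the
invariant part of the closure of `ψ⁻¹(M; E)`. -/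
def kerR (g : RiemannianMetricOn n M) (α : Dual Γ) : Set (symbolAlgebra n Γ F E g) :=
  {f | ∃ T ∈ psiClosureInv n Γ F μ E 0, HasSymbol μ g T f.1 ∧
    ∃ K ∈ psiClosureInv n Γ F μ E (-1), ∀ v ∈ isotypicPart α.rep (lTwoRep n Γ F E μ), T v = K v}

/-- The primitive ideal spectrum of `A_M^Γ`. -/
def primSymbolAlgebra (g : RiemannianMetricOn n M) : Set (TwoSidedIdeal (symbolAlgebra n Γ F E g)) :=
  primitiveIdeals (symbolAlgebra n Γ F E g)

/-- `Ξ = Prim(A_M^Γ / ker R_M)`, as the closed subset of `Prim(A_M^Γ)` that consists of the primitive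
ideals containing `ker R_M`. -/
def Xi (g : RiemannianMetricOn n M) (α : Dual Γ) :
    Set (TwoSidedIdeal (symbolAlgebra n Γ F E g)) :=
  {J | J ∈ primSymbolAlgebra n Γ F E g ∧ ∀ f ∈ kerR n Γ F μ E g α, f ∈ J}

end Restriction

end EquivariantSymbol

end

open EquivariantSymbol

/-!
If the free points are dense, then no isotropy group obstructs: the minimal ones are trivial, and
symbols, being continuous, are determined by their values over the free points.

**The isotropy pairs.** The components of `M/Γ` are open because `M/Γ` is locally connected, so each
of them contains the orbit of a free point and every minimal isotropy group `Γ₀` is trivial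
(`minimalIsotropy_eq_bot`). Then `Hom_{Γ₀}(g • ρ, α)` is the space of all linear maps between two
non-zero spaces, whence `xAlpha_eq_xSet`.

**Ellipticity.** By the first statement, `P` is `α`-elliptic if and only if its symbol at every
`ξ ≠ 0` is bijective on all isotypical components of the fibres. The symbol at `ξ` commutes with
`Γ_ξ`: a chart `e` can be transported to the chart `e ∘ γ⁻¹`, the local symbols of an invariant
operator are the same in both (`IsLocalSymbol.translate`), and a principal symbol is unique off the
zero section (`IsPrincipalSymbol.eq_of_ne_zero`). By Maschke's theorem an intertwining map of finite
dimensional representations is bijective if and only if it is so on all isotypical components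
(`bijOn_isotypicPart_iff`).

**The spectrum.** The kernel of `R_M` is zero (`eq_zero_of_mem_kerR`), so every primitive ideal
contains it. Let `T = K` on the `α`-isotypical part, with `T` and `K` in the closures of `ψ⁰` and
`ψ⁻¹`. Near a free point `x₁`, take sections `w_τ = e^{iτ⟨·,η⟩} χ² s` and `v_τ = e^{iτ⟨·,η⟩} χ² t`.
The average `∑_γ l(α(γ⁻¹) a) γ w_τ` with `l(a) = 1` lies in the `α`-isotypical part
(`sum_coeff_mem_isotypicPart`). For an operator `P` of order zero, `⟨v_τ, P w_τ⟩` tends to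
`∫ |χ|⁴ b₀(·, η)`, where `b₀` is the leading local symbol of `⟨t, P s⟩`
(`tendsto_inner_cutSection`), while `⟨v_τ, P γ w_τ⟩` tends to zero for `γ ≠ 1`: the supports of
`v_τ` and `γ w_τ` are disjoint and lie in one, disconnected, chart, so that this is the same limit
with two amplitudes of disjoint support (`tendsto_inner_unitaryOp`). For an operator of order `-1`
all limits vanish. Comparing `T` with `K` on the averages therefore bounds the symbol of `T` at `x₁`
by the errors of the approximations of `T` and `K` by pseudodifferential operators
(`norm_leading_term_le_of_free`). The symbol is continuous and the free points are dense, so the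
bound holds everywhere, and the errors are arbitrarily small.
-/

namespace EquivariantSymbol

/-! ### Isotypical components of representations of finite groups -/

section Representations

variable {G V W : Type*} [Group G] [AddCommGroup V] [Module ℂ V] [AddCommGroup W] [Module ℂ W]

/-- The image of a subrepresentation under an intertwining map. -/
def mapSubrep {τ : Representation ℂ G W} {σ : Representation ℂ G V} (T : τ.IntertwiningMap σ)
    (N : Subrepresentation τ) : Subrepresentation σ where
  toSubmodule := N.toSubmodule.map T.toLinearMap
  apply_mem_toSubmodule g v hv := by
    obtain ⟨w, hw, rfl⟩ := hv
    exact ⟨τ g w, N.apply_mem_toSubmodule g hw, LinearMap.congr_fun (T.isIntertwining' g) w⟩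

lemma isIrreducible_of_isAtom_range {τ : Representation ℂ G W} {σ : Representation ℂ G V}
    (T : τ.IntertwiningMap σ) (hT : Function.Injective T) (hr : IsAtom T.range) :
    τ.IsIrreducible := by
  have hbot : ∀ N : Subrepresentation τ, mapSubrep T N = ⊥ → N = ⊥ := by
    intro N hN
    refine Subrepresentation.toSubmodule_injective ((Submodule.eq_bot_iff _).2 fun w hw => ?_)
    have h1 : T w ∈ (mapSubrep T N).toSubmodule := ⟨w, hw, rfl⟩
    rw [hN] at h1
    have h2 : T w = 0 := h1
    exact hT (h2.trans (map_zero T).symm)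
  have hle : ∀ N : Subrepresentation τ, mapSubrep T N ≤ T.range := by
    rintro N v ⟨w, _, rfl⟩
    exact ⟨w, rfl⟩
  have hnt : Nontrivial (Subrepresentation τ) := by
    refine ⟨⊥, ⊤, fun h => hr.1 ?_⟩
    refine Subrepresentation.toSubmodule_injective ((Submodule.eq_bot_iff _).2 ?_)
    rintro v ⟨w, rfl⟩
    have h1 : w ∈ (⊤ : Subrepresentation τ) := trivial
    rw [← h] at h1
    have h2 : w = 0 := h1
    rw [h2]
    exact map_zero T
  refine { hnt with eq_bot_or_eq_top := fun N => ?_ }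
  rcases eq_or_lt_of_le (hle N) with h | h
  · right
    refine Subrepresentation.toSubmodule_injective (eq_top_iff.2 fun w _ => ?_)
    have h1 : T w ∈ T.range := ⟨w, rfl⟩
    rw [← h] at h1
    obtain ⟨w', hw', h2⟩ := h1
    exact hT h2 ▸ hw'
  · exact Or.inl (hbot N (hr.2 _ h))

/-- Every non-zero subrepresentation of a finite dimensional representation contains an irreducible
one, so that it meets some isotypical component. -/
lemma exists_mem_isotypicPart [FiniteDimensional ℂ V] {σ : Representation ℂ G V}
    (N : Subrepresentation σ) (hN : N ≠ ⊥) :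
    ∃ ρ : Dual G, ∃ v ∈ isotypicPart ρ.rep σ, v ∈ N ∧ v ≠ 0 := by
  have hmono : StrictMono (Subrepresentation.toSubmodule : Subrepresentation σ → Submodule ℂ V) :=
    fun A B h => lt_of_le_of_ne h.le fun he => h.ne (Subrepresentation.toSubmodule_injective he)
  have : WellFoundedLT (Subrepresentation σ) := hmono.wellFoundedLT
  obtain ⟨A, hA, hAN⟩ := (isAtomic_of_orderBot_wellFounded_lt
    (wellFounded_lt (α := Subrepresentation σ))).eq_bot_or_exists_atom_le N |>.resolve_left hN
  have e : (Fin (Module.finrank ℂ A.toSubmodule) → ℂ) ≃ₗ[ℂ] A.toSubmodule :=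
    (Module.finBasis ℂ A.toSubmodule).equivFun.symm
  -- The dual consists of representations on some `ℂ^d`, so the minimal subrepresentation `A` is
  -- read in a basis.
  let r : Representation ℂ G (Fin (Module.finrank ℂ A.toSubmodule) → ℂ) :=
    { toFun := fun g => e.symm.toLinearMap ∘ₗ A.toRepresentation g ∘ₗ e.toLinearMap
      map_one' := by ext; simp
      map_mul' := fun g h => by ext; simp }
  let T : r.IntertwiningMap σ :=
    ⟨A.toSubmodule.subtype ∘ₗ e.toLinearMap, fun g => by
      ext w; simp [r, Subrepresentation.toRepresentation]⟩
  have hTi : Function.Injective T := fun a b h => e.injective (Subtype.ext h)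
  have hTr : T.range = A := by
    refine Subrepresentation.toSubmodule_injective (Submodule.ext fun v => ⟨?_, fun hv => ?_⟩)
    · rintro ⟨w, rfl⟩
      exact (e w).2
    · exact ⟨e.symm ⟨v, hv⟩, by
        change ((e (e.symm ⟨v, hv⟩) : A.toSubmodule) : V) = v
        simp⟩
  let I : Irrep G := ⟨_, r, isIrreducible_of_isAtom_range T hTi (by rw [hTr]; exact hA)⟩
  obtain ⟨φ⟩ : Nonempty ((Quotient.out (s := irrepSetoid G) (Quotient.mk _ I)).rep.Equiv r) :=
    Quotient.mk_out (s := irrepSetoid G) I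
  have hex : ∃ v : V, v ∈ A ∧ v ≠ 0 := by
    by_contra! h
    exact hA.1 (Subrepresentation.toSubmodule_injective ((Submodule.eq_bot_iff _).2 h))
  obtain ⟨v, hv, hv0⟩ := hex
  have hv' : v ∈ T.range := by rw [hTr]; exact hv
  obtain ⟨w, rfl⟩ := hv'
  refine ⟨Quotient.mk (irrepSetoid G) I, T w, ?_, hAN hv, hv0⟩
  refine Submodule.mem_iSup_of_mem (T.comp φ.toIntertwiningMap) ⟨φ.symm w, ?_⟩
  change T (φ (φ.symm w)) = T w
  rw [Representation.Equiv.apply_symm_apply]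

lemma mapsTo_isotypicPart {U : Type*} [AddCommGroup U] [Module ℂ U]
    (ρ : Representation ℂ G U) {τ : Representation ℂ G W} {σ : Representation ℂ G V}
    (T : τ.IntertwiningMap σ) : Set.MapsTo T (isotypicPart ρ τ) (isotypicPart ρ σ) := by
  intro w hw
  have h : isotypicPart ρ τ ≤ (isotypicPart ρ σ).comap T.toLinearMap := by
    refine iSup_le fun S => ?_
    rintro _ ⟨u, rfl⟩
    exact Submodule.mem_iSup_of_mem (T.comp S) ⟨u, rfl⟩
  exact h hw

/-- An intertwining map is bijective if and only if it restricts to bijections of all isotypical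
components. -/
lemma bijOn_isotypicPart_iff [Finite G] [FiniteDimensional ℂ V] [FiniteDimensional ℂ W]
    {τ : Representation ℂ G W} {σ : Representation ℂ G V} (T : τ.IntertwiningMap σ) :
    (∀ ρ : Dual G, Set.BijOn T (isotypicPart ρ.rep τ) (isotypicPart ρ.rep σ)) ↔
      Function.Bijective T := by
  constructor
  · intro h
    constructor
    · have hk : T.ker = ⊥ := by
        by_contra hk
        obtain ⟨ρ, v, hv, hvk, hv0⟩ := exists_mem_isotypicPart _ hk
        exact hv0 ((h ρ).injOn hv (Submodule.zero_mem _)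
          (((Representation.IntertwiningMap.mem_ker _ _ _ _).1 hvk).trans (map_zero T).symm))
      refine (injective_iff_map_eq_zero T).2 fun v hv => ?_
      have h1 : v ∈ T.ker := (Representation.IntertwiningMap.mem_ker _ _ _ _).2 hv
      rw [hk] at h1
      exact h1
    · have : NeZero (Nat.card G : ℂ) := ⟨by exact_mod_cast Nat.card_pos.ne'⟩
      -- By Maschke's theorem the range has an invariant complement.
      obtain ⟨N, hN⟩ := exists_isCompl T.range
      have hNb : N = ⊥ := by
        by_contra hNb
        obtain ⟨ρ, v, hv, hvN, hv0⟩ := exists_mem_isotypicPart _ hNb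
        obtain ⟨w, -, rfl⟩ := (h ρ).surjOn hv
        have h1 : T w ∈ T.range ⊓ N := ⟨⟨w, rfl⟩, hvN⟩
        rw [hN.inf_eq_bot] at h1
        exact hv0 h1
      rw [hNb] at hN
      have htop := hN.sup_eq_top
      rw [sup_bot_eq] at htop
      intro v
      have h1 : v ∈ (⊤ : Subrepresentation σ) := trivial
      rw [← htop] at h1
      exact h1
  · intro h ρ
    refine ⟨mapsTo_isotypicPart _ T, h.1.injOn, fun v hv => ?_⟩
    let e := Representation.IntertwiningMap.ofBijective T h
    refine ⟨e.symm v, mapsTo_isotypicPart _ e.symm.toIntertwiningMap hv, ?_⟩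
    exact Representation.Equiv.apply_symm_apply e v

/-- Averaging against a matrix coefficient of `α` produces vectors of the `α`-isotypical part. -/
lemma sum_coeff_mem_isotypicPart [Fintype G] (α : Representation ℂ G W) (σ : Representation ℂ G V)
    (l : W →ₗ[ℂ] ℂ) (a : W) (v : V) :
    ∑ γ : G, l (α γ⁻¹ a) • σ γ v ∈ isotypicPart α σ := by
  let T : α.IntertwiningMap σ :=
    ⟨∑ γ : G, (l ∘ₗ α γ⁻¹).smulRight (σ γ v), fun δ => by
      ext b
      simp only [LinearMap.comp_apply, LinearMap.sum_apply, LinearMap.smulRight_apply, map_sum,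
        map_smul]
      refine (Fintype.sum_equiv (Equiv.mulLeft δ) _ _ fun γ => ?_).symm
      simp only [Equiv.coe_mulLeft, mul_inv_rev, map_mul, Module.End.mul_apply]
      rw [← Module.End.mul_apply (α δ⁻¹), ← map_mul]
      simp⟩
  refine Submodule.mem_iSup_of_mem T ⟨a, ?_⟩
  simp [T, LinearMap.sum_apply]

lemma nontrivial_dual_space (ρ : Dual G) : Nontrivial ρ.Space := by
  by_contra h
  rw [not_nontrivial_iff_subsingleton] at h
  have hi : ρ.rep.IsIrreducible := (Quotient.out (s := irrepSetoid G) ρ).irreducible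
  obtain ⟨A, B, hAB⟩ := hi.toNontrivial
  exact hAB (Subrepresentation.toSubmodule_injective (Subsingleton.elim _ _))

end Representations

/-! ### Minimal isotropy groups -/

section FreePoints

variable {n : ℕ} {Γ : Type*} [Group Γ] {M : Type*} [TopologicalSpace M] [ChartedSpace (Rn n) M]
  [MulAction Γ M]

/-- The components of the orbit space are open, hence contain orbits of free points. -/
lemma minimalIsotropy_eq_bot [SmoothAction n Γ M]
    {U : Set M} (hU : Dense U) (hfree : ∀ x ∈ U, ∀ γ : Γ, γ • x = x → γ = 1)
    {Γ₀ : ConnectedComponents (Quotient (MulAction.orbitRel Γ M)) → Subgroup Γ}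
    (hΓ₀ : IsMinimalIsotropy Γ₀) (c) : Γ₀ c = ⊥ := by
  have hc : ContinuousConstSMul Γ M :=
    ⟨fun γ => (SmoothAction.contMDiff_smul (n := n) γ).continuous⟩
  have : LocallyConnectedSpace M := ChartedSpace.locallyConnectedSpace (Rn n) M
  have : LocallyConnectedSpace (Quotient (MulAction.orbitRel Γ M)) :=
    isQuotientMap_quotient_mk'.isCoinducing.locallyConnectedSpace
  obtain ⟨x, hx, -⟩ := (hΓ₀ c).prop
  have hcont : Continuous (orbitComponent Γ : M → _) :=
    ConnectedComponents.continuous_coe.comp continuous_quotient_mk'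
  have hopen : IsOpen (orbitComponent Γ ⁻¹' {c} : Set M) :=
    (isOpen_discrete _).preimage hcont
  obtain ⟨y, hy, hyU⟩ := hU.inter_open_nonempty _ hopen ⟨x, hx⟩
  have hs : MulAction.stabilizer Γ y = ⊥ :=
    (Subgroup.eq_bot_iff_forall _).2 fun γ hγ => hfree y hyU γ hγ
  exact le_bot_iff.1 ((hΓ₀ c).le_of_le ⟨y, hy, hs⟩ bot_le)

lemma xAlpha_eq_xSet [IsManifold (𝓡 n) ∞ M] [SmoothAction n Γ M]
    {U : Set M} (hU : Dense U) (hfree : ∀ x ∈ U, ∀ γ : Γ, γ • x = x → γ = 1)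
    {Γ₀ : ConnectedComponents (Quotient (MulAction.orbitRel Γ M)) → Subgroup Γ}
    (hΓ₀ : IsMinimalIsotropy Γ₀) (α : Dual Γ) :
    XAlpha (n := n) (M := M) Γ₀ α = XSet n Γ M := by
  refine Set.Subset.antisymm (fun p hp => hp.1) fun p hp => ⟨hp, 1, ?_, ?_⟩
  · rw [minimalIsotropy_eq_bot (n := n) hU hfree hΓ₀]
    exact bot_le
  · have := nontrivial_dual_space p.2
    have := nontrivial_dual_space α
    obtain ⟨v, hv⟩ := exists_ne (0 : p.2.Space)
    obtain ⟨w, hw⟩ := exists_ne (0 : α.Space)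
    obtain ⟨l, hl⟩ := Module.Projective.exists_dual_ne_zero ℂ hv
    refine ⟨⟨l.smulRight w, fun h => ?_⟩, fun h => ?_⟩
    · obtain ⟨h, hh⟩ := h
      obtain rfl : h = 1 := by
        rw [minimalIsotropy_eq_bot (n := n) hU hfree hΓ₀] at hh
        exact hh
      have h1 : (⟨1, hh⟩ : Γ₀ (orbitComponent Γ p.1.proj)) = 1 := rfl
      rw [h1, map_one, map_one]
      rfl
    · have h1 := congrArg (fun T => T.toLinearMap v) h
      exact smul_ne_zero hl hw h1

end FreePoints

/-! ### Sections and cosections with given values -/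

section Localisation

variable {n : ℕ} {M : Type*} [TopologicalSpace M] [T2Space M] [ChartedSpace (Rn n) M]
  [IsManifold (𝓡 n) ∞ M]
  {F : Type*} [NormedAddCommGroup F] [NormedSpace ℂ F]
  {E : M → Type*} [TopologicalSpace (TotalSpace F E)] [∀ x, AddCommGroup (E x)]
  [∀ x, Module ℂ (E x)] [∀ x, TopologicalSpace (E x)] [FiberBundle F E] [VectorBundle ℂ F E]
  [ContMDiffVectorBundle ∞ F E (𝓡 n)]

lemma exists_smoothSection (x₀ : M) (v : E x₀) {O : Set M} (hO : O ∈ 𝓝 x₀) :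
    ∃ s : smoothSections n F E, s.1 x₀ = v ∧ closure {x | s.1 x ≠ 0} ⊆ O := by
  obtain ⟨N, hN, hs⟩ := FiberBundle.exists_contMDiffOn_extend (k := ∞) (𝓡 n) F v
  obtain ⟨f, -, hf⟩ := (SmoothBumpFunction.nhds_basis_tsupport (I := 𝓡 n) x₀).mem_iff.1
    (Filter.inter_mem hO (interior_mem_nhds.2 hN))
  refine ⟨⟨fun x => f x • FiberBundle.extend F v x, ?_⟩, ?_, ?_⟩
  · exact ContMDiffOn.smul_section_of_tsupport f.contMDiff.contMDiffOn isOpen_interior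
      (hf.trans Set.inter_subset_right) (hs.mono interior_subset)
  · simp
  · refine Set.Subset.trans (closure_mono fun x hx => ?_) (hf.trans Set.inter_subset_left)
    exact left_ne_zero_of_smul hx

lemma exists_smoothCosection [FiniteDimensional ℂ F] (x₀ : M) {w : E x₀} (hw : w ≠ 0) {O : Set M}
    (hO : O ∈ 𝓝 x₀) :
    ∃ ℓ : ∀ x, E x →ₗ[ℂ] ℂ, IsSmoothCosection n (F := F) E ℓ ∧ ℓ x₀ w ≠ 0 ∧
      closure {x | ℓ x ≠ 0} ⊆ O := by
  set e := trivializationAt F E x₀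
  have hx₀ : x₀ ∈ e.baseSet := FiberBundle.mem_baseSet_trivializationAt' x₀
  have hw' : e.continuousLinearMapAt ℂ x₀ w ≠ 0 := by
    intro h
    refine hw ?_
    rw [← e.symmL_continuousLinearMapAt (R := ℂ) hx₀ w, h, map_zero]
  obtain ⟨l, hl⟩ := Module.Projective.exists_dual_ne_zero ℂ hw'
  obtain ⟨f, -, hf⟩ := (SmoothBumpFunction.nhds_basis_tsupport (I := 𝓡 n) x₀).mem_iff.1
    (Filter.inter_mem hO (e.open_baseSet.mem_nhds hx₀))
  refine ⟨fun x => (f x : ℂ) • l ∘ₗ (e.continuousLinearMapAt ℂ x).toLinearMap, ?_, ?_, ?_⟩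
  · intro s hs
    refine contMDiff_of_tsupport fun x hx => ?_
    have hx' : x ∈ tsupport f := by
      refine closure_mono (fun y hy => ?_) hx
      intro h
      exact hy (by simp [h])
    have hxe : x ∈ e.baseSet := (hf hx').2
    have h1 := (e.contMDiffAt_section_iff (IB := 𝓡 n) (n := ∞) hxe).1 (hs x)
    let l' : F →L[ℝ] ℂ := (LinearMap.toContinuousLinearMap l).restrictScalars ℝ
    have h2 : ContMDiffAt (𝓡 n) 𝓘(ℝ, ℂ) ∞ (fun y => l' (e (TotalSpace.mk' F y (s y))).2) x :=
      l'.contMDiff.contMDiffAt.comp x h1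
    refine (ContMDiffAt.smul (f.contMDiff x) h2).congr_of_eventuallyEq ?_
    filter_upwards [e.open_baseSet.mem_nhds hxe] with y hy
    change (f y : ℂ) * l (e.linearMapAt ℂ y (s y)) = f y • l (e (TotalSpace.mk' F y (s y))).2
    rw [e.linearMapAt_apply, if_pos hy, Complex.real_smul]
  · change (f x₀ : ℂ) * l _ ≠ 0
    rw [f.eq_one, Complex.ofReal_one, one_mul]
    exact hl
  · refine Set.Subset.trans (closure_mono fun x hx => ?_) (hf.trans Set.inter_subset_left)
    intro h
    exact hx (by simp [h])

end Localisation

/-! ### Covectors in charts -/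

section Coordinates

variable {n : ℕ} {M : Type*} [TopologicalSpace M] [ChartedSpace (Rn n) M]

lemma exists_inner_eq (D : Rn n ≃L[ℝ] Rn n) (ξ : Rn n →L[ℝ] ℝ) :
    ∃ η : Rn n, ∀ v, inner ℝ η (D v) = ξ v := by
  refine ⟨(InnerProductSpace.toDual ℝ (Rn n)).symm (ξ.comp (D.symm : Rn n →L[ℝ] Rn n)),
    fun v => ?_⟩
  rw [InnerProductSpace.toDual_symm_apply]
  simp

/-- In a chart around its base point, every covector has coordinates. -/
lemma exists_chartCovector_eq [IsManifold (𝓡 n) ∞ M] {e : OpenPartialHomeomorph M (Rn n)}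
    (he : e ∈ IsManifold.maximalAtlas (𝓡 n) ∞ M) (ζ : Cotangent n M) (hζ : ζ.proj ∈ e.source)
    (h0 : ζ.2 ≠ 0) :
    ∃ η : Rn n, η ≠ 0 ∧ ζ = chartCovector n e (e ζ.proj) η := by
  obtain ⟨x, ξ⟩ := ζ
  have hm : e.MDifferentiable (𝓡 n) (𝓡 n) :=
    ⟨(contMDiffOn_of_mem_maximalAtlas he).mdifferentiableOn (by simp),
      (contMDiffOn_symm_of_mem_maximalAtlas he).mdifferentiableOn (by simp)⟩
  let D : Rn n ≃L[ℝ] Rn n := hm.mfderiv hζ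
  obtain ⟨η, hη⟩ := exists_inner_eq D ξ
  refine ⟨η, fun h => h0 ?_, ?_⟩
  · refine ContinuousLinearMap.ext fun v => (hη v).symm.trans ?_
    rw [h, inner_zero_left]
    rfl
  · refine TotalSpace.ext (e.left_inv hζ).symm (covector_heq n (e.left_inv hζ).symm _ _ fun v => ?_)
    refine (hη v).symm.trans ?_
    change inner ℝ η ((mfderiv (𝓡 n) (𝓡 n) e x : Rn n →L[ℝ] Rn n) v) =
      inner ℝ η ((mfderiv (𝓡 n) (𝓡 n) e (e.symm (e x)) : Rn n →L[ℝ] Rn n) v)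
    rw [e.left_inv hζ]

lemma exists_eq_chartCovector [IsManifold (𝓡 n) ∞ M] (ζ : Cotangent n M) (h0 : ζ.2 ≠ 0) :
    ∃ e ∈ IsManifold.maximalAtlas (𝓡 n) ∞ M, ∃ y η : Rn n,
      η ≠ 0 ∧ y ∈ e.target ∧ ζ = chartCovector n e y η := by
  have he := IsManifold.chart_mem_maximalAtlas (I := 𝓡 n) (n := ∞) ζ.proj
  obtain ⟨η, hη, h⟩ := exists_chartCovector_eq he ζ (mem_chart_source _ _) h0
  exact ⟨_, he, _, η, hη, (chartAt (Rn n) ζ.proj).map_source (mem_chart_source _ _), h⟩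

lemma Cosphere.ne_zero [IsManifold (𝓡 n) ∞ M] {g : RiemannianMetricOn n M} (ζ : Cosphere g) :
    ζ.1.2 ≠ 0 := by
  obtain ⟨w, hw, hw'⟩ := ζ.2
  intro h
  rw [h] at hw'
  rw [hw'] at hw
  exact zero_ne_one hw

end Coordinates

lemma finiteDimensional_fibre {M F : Type*} [TopologicalSpace M] [NormedAddCommGroup F]
    [NormedSpace ℂ F] {E : M → Type*} [TopologicalSpace (TotalSpace F E)] [∀ x, AddCommGroup (E x)]
    [∀ x, Module ℂ (E x)] [∀ x, TopologicalSpace (E x)] [FiberBundle F E] [VectorBundle ℂ F E]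
    [FiniteDimensional ℂ F] (x : M) : FiniteDimensional ℂ (E x) :=
  LinearEquiv.finiteDimensional
    ((trivializationAt F E x).continuousLinearEquivAt ℂ x
      (FiberBundle.mem_baseSet_trivializationAt' x)).symm.toLinearEquiv

/-! ### Uniqueness of the principal symbol -/

section Uniqueness

variable {n : ℕ} {M : Type*} [TopologicalSpace M] [T2Space M] [ChartedSpace (Rn n) M]
  [IsManifold (𝓡 n) ∞ M]
  {F₀ : Type*} [NormedAddCommGroup F₀] [NormedSpace ℂ F₀]
  {E₀ : M → Type*} [TopologicalSpace (TotalSpace F₀ E₀)] [∀ x, AddCommGroup (E₀ x)]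
  [∀ x, Module ℂ (E₀ x)] [∀ x, TopologicalSpace (E₀ x)] [FiberBundle F₀ E₀] [VectorBundle ℂ F₀ E₀]
  [ContMDiffVectorBundle ∞ F₀ E₀ (𝓡 n)]
  {F₁ : Type*} [NormedAddCommGroup F₁] [NormedSpace ℂ F₁] [FiniteDimensional ℂ F₁]
  {E₁ : M → Type*} [TopologicalSpace (TotalSpace F₁ E₁)] [∀ x, AddCommGroup (E₁ x)]
  [∀ x, Module ℂ (E₁ x)] [∀ x, TopologicalSpace (E₁ x)] [FiberBundle F₁ E₁] [VectorBundle ℂ F₁ E₁]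
  [ContMDiffVectorBundle ∞ F₁ E₁ (𝓡 n)]

/-- The principal symbol is determined by the operator away from the zero section. -/
lemma IsPrincipalSymbol.eq_of_ne_zero {m : ℝ}
    {P : smoothSections n F₀ E₀ →ₗ[ℂ] smoothSections n F₁ E₁} (hP : IsPsiDO n m P)
    {σ σ' : ∀ ζ : Cotangent n M, E₀ ζ.proj →ₗ[ℂ] E₁ ζ.proj} (h : IsPrincipalSymbol n m P σ)
    (h' : IsPrincipalSymbol n m P σ') {ζ : Cotangent n M} (hζ : ζ.2 ≠ 0) : σ ζ = σ' ζ := by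
  obtain ⟨e, he, y, η, hη, hy, rfl⟩ := exists_eq_chartCovector ζ hζ
  ext v
  by_contra hne
  have hO : e.source ∈ 𝓝 (e.symm y) := e.open_source.mem_nhds (e.map_target hy)
  obtain ⟨s, hs, hsO⟩ := exists_smoothSection (n := n) (F := F₀) (e.symm y) v hO
  obtain ⟨ℓ, hℓ, hℓ0, hℓO⟩ := exists_smoothCosection (n := n) (F := F₁) (e.symm y)
    (sub_ne_zero.2 hne) hO
  have hd : IsLocalData n (F₁ := F₁) e s ℓ := ⟨he, hsO, hℓ, hℓO⟩
  obtain ⟨a, b, hab, hl⟩ := hP e s ℓ hd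
  have h1 := (h e s ℓ a b hd hab hl y hy η hη).trans (h' e s ℓ a b hd hab hl y hy η hη).symm
  rw [hs] at h1
  exact hℓ0 (((ℓ (e.symm y)).map_sub _ _).trans (sub_eq_zero.2 h1))

end Uniqueness

/-! ### Transport of charts and covectors by the action -/

section TransportChart

variable (n : ℕ) {Γ M : Type*} [Group Γ] [TopologicalSpace M] [ChartedSpace (Rn n) M]
  [MulAction Γ M] [SmoothAction n Γ M]

/-- The diffeomorphism `x ↦ γ x` as a homeomorphism. -/
noncomputable def smulHomeo (γ : Γ) : M ≃ₜ M where
  toFun x := γ • x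
  invFun x := γ⁻¹ • x
  left_inv x := inv_smul_smul γ x
  right_inv x := smul_inv_smul γ x
  continuous_toFun := (SmoothAction.contMDiff_smul (n := n) γ).continuous
  continuous_invFun := (SmoothAction.contMDiff_smul (n := n) γ⁻¹).continuous

/-- The chart `e ∘ γ⁻¹` on the translate by `γ` of the domain of `e`. -/
noncomputable def smulChart (γ : Γ) (e : OpenPartialHomeomorph M (Rn n)) :
    OpenPartialHomeomorph M (Rn n) :=
  (smulHomeo n γ).symm.transOpenPartialHomeomorph e

variable {n}

lemma smulChart_mem_maximalAtlas [IsManifold (𝓡 n) ∞ M] (γ : Γ)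
    {e : OpenPartialHomeomorph M (Rn n)} (he : e ∈ IsManifold.maximalAtlas (𝓡 n) ∞ M) :
    smulChart n γ e ∈ IsManifold.maximalAtlas (𝓡 n) ∞ M := by
  refine OpenPartialHomeomorph.mem_maximalAtlas_of_contMDiffOn _ ?_ ?_
  · exact (contMDiffOn_of_mem_maximalAtlas he).comp
      (SmoothAction.contMDiff_smul (n := n) γ⁻¹).contMDiffOn (fun x hx => hx)
  · exact (SmoothAction.contMDiff_smul (n := n) γ).comp_contMDiffOn
      (contMDiffOn_symm_of_mem_maximalAtlas he)

lemma chartCovector_smulChart [IsManifold (𝓡 n) ∞ M] (γ : Γ)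
    {e : OpenPartialHomeomorph M (Rn n)} (he : e ∈ IsManifold.maximalAtlas (𝓡 n) ∞ M)
    {y : Rn n} (hy : y ∈ e.target) (η : Rn n) :
    chartCovector n (smulChart n γ e) y η = γ • chartCovector n e y η := by
  refine TotalSpace.ext rfl (heq_of_eq (ContinuousLinearMap.ext fun v => ?_))
  set z := e.symm y
  set D : Rn n →L[ℝ] Rn n := mfderiv (𝓡 n) (𝓡 n) (fun x : M => γ • x) z
  have hz : z ∈ e.source := e.map_target hy
  have hz' : γ • z ∈ (smulChart n γ e).source := by
    change γ⁻¹ • γ • z ∈ e.source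
    rwa [inv_smul_smul]
  have hc : (mfderiv (𝓡 n) (𝓡 n) e z : Rn n →L[ℝ] Rn n) =
      (mfderiv (𝓡 n) (𝓡 n) (smulChart n γ e) (γ • z) : Rn n →L[ℝ] Rn n).comp D := by
    have h := mfderiv_comp (I := 𝓡 n) (I' := 𝓡 n) (I'' := 𝓡 n) (g := smulChart n γ e)
      (f := fun x : M => γ • x) z
      ((contMDiffAt_of_mem_maximalAtlas (smulChart_mem_maximalAtlas γ he) hz').mdifferentiableAt
        (by simp))
      ((SmoothAction.contMDiff_smul (n := n) γ z).mdifferentiableAt (by simp))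
    have hf : (smulChart n γ e : M → Rn n) ∘ (fun x : M => γ • x) = e := by
      funext x
      exact congrArg e (inv_smul_smul γ x)
    rw [hf] at h
    exact h
  have hD : D.IsInvertible := isInvertible_mfderiv_smul n γ z
  change inner ℝ η ((mfderiv (𝓡 n) (𝓡 n) (smulChart n γ e) (γ • z) : Rn n →L[ℝ] Rn n) v) =
    inner ℝ η ((mfderiv (𝓡 n) (𝓡 n) e z : Rn n →L[ℝ] Rn n) (D.inverse v))
  rw [hc]
  exact congrArg (fun w => inner ℝ η
    ((mfderiv (𝓡 n) (𝓡 n) (smulChart n γ e) (γ • z) : Rn n →L[ℝ] Rn n) w))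
    (hD.self_apply_inverse v).symm

end TransportChart

/-! ### Transport between fibres -/

section FibreTransport

lemma mk_cosection_congr {M F₁ : Type*} {E₁ : M → Type*} [∀ x, AddCommGroup (E₁ x)]
    [∀ x, Module ℂ (E₁ x)] (ℓ : ∀ x, E₁ x →ₗ[ℂ] ℂ) {x y : M} {v : E₁ x} {w : E₁ y}
    (h : TotalSpace.mk' F₁ x v = TotalSpace.mk' F₁ y w) : ℓ x v = ℓ y w :=
  congrArg (fun p : TotalSpace F₁ E₁ => ℓ p.proj p.2) h

lemma mk_symbol_congr {n : ℕ} {M F₀ F₁ : Type*} [TopologicalSpace M] [ChartedSpace (Rn n) M]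
    [IsManifold (𝓡 n) ∞ M] {E₀ : M → Type*} [∀ x, AddCommGroup (E₀ x)] [∀ x, Module ℂ (E₀ x)]
    {E₁ : M → Type*} [∀ x, AddCommGroup (E₁ x)] [∀ x, Module ℂ (E₁ x)]
    (σ : ∀ ζ : Cotangent n M, E₀ ζ.proj →ₗ[ℂ] E₁ ζ.proj)
    {ζ ζ' : Cotangent n M} (h : ζ = ζ') {v : E₀ ζ.proj} {v' : E₀ ζ'.proj}
    (hv : TotalSpace.mk' F₀ ζ.proj v = TotalSpace.mk' F₀ ζ'.proj v') :
    TotalSpace.mk' F₁ ζ.proj (σ ζ v) = TotalSpace.mk' F₁ ζ'.proj (σ ζ' v') := by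
  subst h
  rw [TotalSpace.mk_injective (F := F₀) _ hv]

variable (n : ℕ) {Γ M : Type*} [Group Γ] [TopologicalSpace M] [ChartedSpace (Rn n) M]
  [MulAction Γ M] (F : Type*) [NormedAddCommGroup F] [NormedSpace ℂ F]
  {E : M → Type*} [TopologicalSpace (TotalSpace F E)] [∀ x, AddCommGroup (E x)]
  [∀ x, Module ℂ (E x)] [∀ x, TopologicalSpace (E x)] [FiberBundle F E] [EquivariantBundle n Γ F E]

lemma mk_act_congr (γ : Γ) {x y : M} {v : E x} {w : E y}
    (h : TotalSpace.mk' F x v = TotalSpace.mk' F y w) :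
    TotalSpace.mk' F _ (EquivariantBundle.act n F γ x v) =
      TotalSpace.mk' F _ (EquivariantBundle.act n F γ y w) :=
  congrArg (fun p : TotalSpace F E =>
    TotalSpace.mk' F (γ • p.proj) (EquivariantBundle.act n F γ p.proj p.2)) h

lemma mk_act_inv_act (γ : Γ) (x : M) (v : E x) :
    TotalSpace.mk' F _ (EquivariantBundle.act n F γ⁻¹ (γ • x)
      (EquivariantBundle.act n F γ x v)) = TotalSpace.mk' F x v := by
  refine (EquivariantBundle.mul_act γ⁻¹ γ x v).symm.trans ?_
  rw [inv_mul_cancel]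
  exact EquivariantBundle.one_act x v

lemma mk_act_act_inv (γ : Γ) (x : M) (v : E x) :
    TotalSpace.mk' F _ (EquivariantBundle.act n F γ (γ⁻¹ • x)
      (EquivariantBundle.act n F γ⁻¹ x v)) = TotalSpace.mk' F x v := by
  refine (EquivariantBundle.mul_act γ γ⁻¹ x v).symm.trans ?_
  rw [mul_inv_cancel]
  exact EquivariantBundle.one_act x v

end FibreTransport

/-! ### Equivariance of the principal symbol and ellipticity -/

section TransportSymbol

variable {n : ℕ} {Γ M : Type*} [Group Γ] [TopologicalSpace M]
  [ChartedSpace (Rn n) M] [MulAction Γ M] [SmoothAction n Γ M]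
  {F₀ : Type*} [NormedAddCommGroup F₀] [NormedSpace ℂ F₀]
  {E₀ : M → Type*} [TopologicalSpace (TotalSpace F₀ E₀)] [∀ x, AddCommGroup (E₀ x)]
  [∀ x, Module ℂ (E₀ x)] [∀ x, TopologicalSpace (E₀ x)] [FiberBundle F₀ E₀] [VectorBundle ℂ F₀ E₀]
  [EquivariantBundle n Γ F₀ E₀]
  {F₁ : Type*} [NormedAddCommGroup F₁] [NormedSpace ℂ F₁]
  {E₁ : M → Type*} [TopologicalSpace (TotalSpace F₁ E₁)] [∀ x, AddCommGroup (E₁ x)]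
  [∀ x, Module ℂ (E₁ x)] [∀ x, TopologicalSpace (E₁ x)] [FiberBundle F₁ E₁] [VectorBundle ℂ F₁ E₁]
  [EquivariantBundle n Γ F₁ E₁]

lemma translate_apply_smul (γ : Γ) (s : smoothSections n F₀ E₀) (x : M) :
    (translate n F₀ E₀ γ s).1 (γ • x) = EquivariantBundle.act n F₀ γ x (s.1 x) :=
  TotalSpace.mk_injective (F := F₀) (γ • x) (mk_translate n F₀ E₀ γ s (inv_smul_smul γ x))

variable (n F₁) in
/-- The translate by `γ` of a family of functionals on the fibres. -/
noncomputable def translateCosection (γ : Γ) (ℓ : ∀ x, E₁ x →ₗ[ℂ] ℂ) (x : M) : E₁ x →ₗ[ℂ] ℂ :=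
  ℓ (γ⁻¹ • x) ∘ₗ EquivariantBundle.act n F₁ γ⁻¹ x

lemma closure_subset_smulChart_source {Z : M → Prop} {γ : Γ} {e : OpenPartialHomeomorph M (Rn n)}
    (h : closure {x | Z x} ⊆ e.source) {Z' : M → Prop} (hZ : ∀ x, Z' x → Z (γ⁻¹ • x)) :
    closure {x | Z' x} ⊆ (smulChart n γ e).source := by
  have hc : IsClosed ((fun x : M => γ⁻¹ • x) ⁻¹' closure {x | Z x}) :=
    isClosed_closure.preimage (SmoothAction.contMDiff_smul (n := n) γ⁻¹).continuous
  have hs : {x | Z' x} ⊆ (fun x : M => γ⁻¹ • x) ⁻¹' closure {x | Z x} :=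
    fun x hx => subset_closure (hZ x hx)
  exact fun x hx => h (closure_minimal hs hc hx)

lemma closure_translate_subset {e : OpenPartialHomeomorph M (Rn n)}
    {s : smoothSections n F₀ E₀} (hs : closure {x | s.1 x ≠ 0} ⊆ e.source) (γ : Γ) :
    closure {x | (translate n F₀ E₀ γ s).1 x ≠ 0} ⊆ (smulChart n γ e).source := by
  refine closure_subset_smulChart_source hs fun x hx h0 => hx ?_
  obtain ⟨z, rfl⟩ : ∃ z, x = γ • z := ⟨γ⁻¹ • x, (smul_inv_smul γ x).symm⟩
  rw [inv_smul_smul] at h0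
  rw [translate_apply_smul, h0, map_zero]

lemma IsLocalData.translate [IsManifold (𝓡 n) ∞ M] {e : OpenPartialHomeomorph M (Rn n)}
    {s : smoothSections n F₀ E₀} {ℓ : ∀ x, E₁ x →ₗ[ℂ] ℂ}
    (h : IsLocalData n (F₁ := F₁) e s ℓ) (γ : Γ) :
    IsLocalData n (F₁ := F₁) (smulChart n γ e) (translate n F₀ E₀ γ s)
      (translateCosection n F₁ γ ℓ) where
  mem_atlas := smulChart_mem_maximalAtlas γ h.mem_atlas
  support_section := closure_translate_subset h.support_section γ
  smooth_cosection := by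
    intro t ht
    have h1 := (h.smooth_cosection (EquivariantSymbol.translate n F₁ E₁ γ⁻¹ ⟨t, ht⟩).1
      (EquivariantSymbol.translate n F₁ E₁ γ⁻¹ ⟨t, ht⟩).2).comp
        (SmoothAction.contMDiff_smul (n := n) (M := M) γ⁻¹)
    refine h1.congr fun x => ?_
    exact (congrArg (ℓ (γ⁻¹ • x)) (translate_apply_smul γ⁻¹ ⟨t, ht⟩ x)).symm
  support_cosection := by
    refine closure_subset_smulChart_source h.support_cosection fun x hx h0 => hx ?_
    simp [translateCosection, h0]

/-- The local symbols of an invariant operator are transported by the action. -/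
lemma IsLocalSymbol.translate {P : smoothSections n F₀ E₀ →ₗ[ℂ] smoothSections n F₁ E₁}
    (hinv : IsInvariantOperator n Γ P) {e : OpenPartialHomeomorph M (Rn n)}
    {s : smoothSections n F₀ E₀} {ℓ : ∀ x, E₁ x →ₗ[ℂ] ℂ} {a : Rn n → Rn n → ℂ}
    (h : IsLocalSymbol n P e s ℓ a) (γ : Γ) :
    IsLocalSymbol n P (smulChart n γ e) (translate n F₀ E₀ γ s)
      (translateCosection n F₁ γ ℓ) a := by
  intro u w hw y hy
  set z := e.symm y
  have hw₀ : ∀ x, (EquivariantSymbol.translate n F₀ E₀ γ⁻¹ w).1 x = u (e x) • s.1 x := by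
    intro x
    refine TotalSpace.mk_injective (F := F₀) x ?_
    refine (mk_translate n F₀ E₀ γ⁻¹ w (y := γ • x) (by rw [inv_inv])).trans ?_
    have h1 : w.1 (γ • x) = EquivariantBundle.act n F₀ γ x (u (e x) • s.1 x) := by
      rw [hw, translate_apply_smul, map_smul]
      change u (e (γ⁻¹ • γ • x)) • _ = _
      rw [inv_smul_smul]
    rw [h1]
    exact mk_act_inv_act n F₀ γ x _
  have h2 := hinv γ (EquivariantSymbol.translate n F₀ E₀ γ⁻¹ w) w (fun x => by
    have h3 := translate_apply_smul γ⁻¹ w (γ • x)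
    refine TotalSpace.mk_injective (F := F₀) (γ • x) ?_
    refine Eq.trans (mk_act_act_inv n F₀ γ (γ • x) (w.1 (γ • x))).symm ?_
    refine mk_act_congr n F₀ γ ?_
    rw [← h3]
    exact congrArg (fun x => TotalSpace.mk' F₀ x ((EquivariantSymbol.translate n F₀ E₀ γ⁻¹ w).1 x))
      (inv_smul_smul γ x)) z
  rw [← h u _ hw₀ y hy]
  change ℓ (γ⁻¹ • γ • z) (EquivariantBundle.act n F₁ γ⁻¹ (γ • z) ((P w).1 (γ • z))) = _
  rw [h2]
  exact mk_cosection_congr ℓ (mk_act_inv_act n F₁ γ z _)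

variable [IsManifold (𝓡 n) ∞ M]

/-- The pull-back by `γ` of a section of `Hom(E₀, E₁)` over the cotangent bundle. -/
noncomputable def pullbackSymbol (γ : Γ) (σ : ∀ ζ : Cotangent n M, E₀ ζ.proj →ₗ[ℂ] E₁ ζ.proj)
    (ζ : Cotangent n M) : E₀ ζ.proj →ₗ[ℂ] E₁ ζ.proj :=
  fibreCast (inv_smul_smul γ ζ.proj) ∘ₗ EquivariantBundle.act n F₁ γ⁻¹ (γ • ζ.proj) ∘ₗ
    σ (γ • ζ) ∘ₗ EquivariantBundle.act n F₀ γ ζ.proj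

lemma IsPrincipalSymbol.pullback {m : ℝ}
    {P : smoothSections n F₀ E₀ →ₗ[ℂ] smoothSections n F₁ E₁}
    (hinv : IsInvariantOperator n Γ P)
    {σ : ∀ ζ : Cotangent n M, E₀ ζ.proj →ₗ[ℂ] E₁ ζ.proj} (h : IsPrincipalSymbol n m P σ) (γ : Γ) :
    IsPrincipalSymbol n m P (pullbackSymbol (F₀ := F₀) (F₁ := F₁) γ σ) := by
  intro e s ℓ a b hd hab hl y hy η hη
  rw [← h (smulChart n γ e) _ _ a b (hd.translate γ) hab (hl.translate hinv γ) y hy η hη]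
  set z := e.symm y
  change ℓ z _ = ℓ (γ⁻¹ • γ • z) _
  refine mk_cosection_congr (F₁ := F₁) ℓ ((mk_fibreCast F₁ (inv_smul_smul γ z) _).trans ?_)
  refine mk_act_congr n F₁ γ⁻¹ (mk_symbol_congr (F₀ := F₀) σ
    (chartCovector_smulChart γ hd.mem_atlas hy η).symm ?_)
  exact congrArg (TotalSpace.mk' F₀ (γ • z)) (translate_apply_smul γ s z).symm

variable [T2Space M] [FiniteDimensional ℂ F₁] [ContMDiffVectorBundle ∞ F₀ E₀ (𝓡 n)]
  [ContMDiffVectorBundle ∞ F₁ E₁ (𝓡 n)]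

/-- The principal symbol of an invariant operator is equivariant. -/
lemma IsPrincipalSymbol.mk_smul {m : ℝ}
    {P : smoothSections n F₀ E₀ →ₗ[ℂ] smoothSections n F₁ E₁} (hP : IsPsiDO n m P)
    (hinv : IsInvariantOperator n Γ P)
    {σ : ∀ ζ : Cotangent n M, E₀ ζ.proj →ₗ[ℂ] E₁ ζ.proj} (h : IsPrincipalSymbol n m P σ) (γ : Γ)
    {ζ : Cotangent n M} (hζ : ζ.2 ≠ 0) (v : E₀ ζ.proj) :
    TotalSpace.mk' F₁ (γ • ζ.proj) (σ (γ • ζ) (EquivariantBundle.act n F₀ γ ζ.proj v)) =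
      TotalSpace.mk' F₁ (γ • ζ.proj) (EquivariantBundle.act n F₁ γ ζ.proj (σ ζ v)) := by
  rw [h.eq_of_ne_zero hP (h.pullback hinv γ) hζ]
  refine Eq.trans ?_ (mk_act_congr n F₁ γ (mk_fibreCast F₁ (inv_smul_smul γ ζ.proj) _)).symm
  exact (mk_act_act_inv n F₁ γ (γ • ζ.proj) _).symm

/-- The principal symbol at `ξ` of an invariant operator, as a map of representations of `Γ_ξ`. -/
noncomputable def IsPrincipalSymbol.intertwiningMap {m : ℝ}
    {P : smoothSections n F₀ E₀ →ₗ[ℂ] smoothSections n F₁ E₁} (hP : IsPsiDO n m P)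
    (hinv : IsInvariantOperator n Γ P)
    {σ : ∀ ζ : Cotangent n M, E₀ ζ.proj →ₗ[ℂ] E₁ ζ.proj} (h : IsPrincipalSymbol n m P σ)
    {ζ : Cotangent n M} (hζ : ζ.2 ≠ 0) :
    (covectorFibreRep (Γ := Γ) n F₀ E₀ ζ).IntertwiningMap (covectorFibreRep n F₁ E₁ ζ) :=
  ⟨σ ζ, fun γ => by
    ext v
    refine TotalSpace.mk_injective (F := F₁) ζ.proj ?_
    have hγ : γ.1 • ζ.proj = ζ.proj := congrArg TotalSpace.proj γ.2
    refine Eq.trans ?_ ((h.mk_smul hP hinv γ.1 hζ v).trans (mk_fibreCast F₁ hγ _).symm)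
    exact mk_symbol_congr σ γ.2.symm (mk_fibreCast F₀ hγ _)⟩

variable [Finite Γ] [FiniteDimensional ℂ F₀]

lemma isAlphaElliptic_iff_isElliptic {U : Set M} (hU : Dense U)
    (hfree : ∀ x ∈ U, ∀ γ : Γ, γ • x = x → γ = 1)
    {Γ₀ : ConnectedComponents (Quotient (MulAction.orbitRel Γ M)) → Subgroup Γ}
    (hΓ₀ : IsMinimalIsotropy Γ₀) (α : Dual Γ) {m : ℝ}
    {P : smoothSections n F₀ E₀ →ₗ[ℂ] smoothSections n F₁ E₁} (hP : IsPsiDO n m P)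
    (hinv : IsInvariantOperator n Γ P) : IsAlphaElliptic n Γ₀ α m P ↔ IsElliptic n m P := by
  unfold IsAlphaElliptic IsElliptic
  rw [xAlpha_eq_xSet (n := n) hU hfree hΓ₀ α]
  refine exists_congr fun σ => and_congr_right fun hσ => ?_
  have key : ∀ ζ : Cotangent n M, ζ.2 ≠ 0 →
      ((∀ ρ : Dual (MulAction.stabilizer Γ ζ), Set.BijOn (σ ζ)
        (fibreIsotypic n F₀ E₀ ζ ρ) (fibreIsotypic n F₁ E₁ ζ ρ)) ↔ Function.Bijective (σ ζ)) := by
    intro ζ hζ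
    have := finiteDimensional_fibre (F := F₀) (E := E₀) ζ.proj
    have := finiteDimensional_fibre (F := F₁) (E := E₁) ζ.proj
    exact bijOn_isotypicPart_iff (hσ.intertwiningMap hP hinv hζ)
  exact ⟨fun h ζ hζ => (key ζ hζ).1 fun ρ => h ⟨ζ, ρ⟩ hζ,
    fun h p hp => (key p.1 hp).2 (h p.1 hp) p.2⟩

end TransportSymbol

/-! ### Quantizations applied to oscillating functions -/

section Oscillation

variable {n : ℕ}

/-- The oscillating function `y ↦ e^{i τ ⟨y, η⟩} u(y)`. -/
noncomputable def oscillate (τ : ℝ) (η : Rn n) (u : Rn n → ℂ) (y : Rn n) : ℂ :=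
  Complex.exp ((τ * inner ℝ y η : ℝ) * Complex.I) * u y

lemma norm_oscillate (τ : ℝ) (η : Rn n) (u : Rn n → ℂ) (y : Rn n) :
    ‖oscillate τ η u y‖ = ‖u y‖ := by
  rw [oscillate, norm_mul, Complex.norm_exp_ofReal_mul_I, one_mul]

lemma contDiff_oscillate (τ : ℝ) (η : Rn n) {u : Rn n → ℂ} (hu : ContDiff ℝ ∞ u) :
    ContDiff ℝ ∞ (oscillate τ η u) := by
  unfold oscillate
  refine ContDiff.mul (Complex.contDiff_exp.comp ?_) hu
  refine ContDiff.mul (Complex.ofRealCLM.contDiff.comp ?_) contDiff_const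
  exact contDiff_const.mul (contDiff_id.inner ℝ contDiff_const)

lemma hasCompactSupport_oscillate (τ : ℝ) (η : Rn n) {u : Rn n → ℂ} (hu : HasCompactSupport u) :
    HasCompactSupport (oscillate τ η u) :=
  hu.mul_left

/-- `oscillate τ η u` as a Schwartz function. -/
noncomputable def oscillateSchwartz (τ : ℝ) (η : Rn n) {u : Rn n → ℂ} (hu : ContDiff ℝ ∞ u)
    (hc : HasCompactSupport u) : 𝓢(Rn n, ℂ) :=
  (hasCompactSupport_oscillate τ η hc).toSchwartzMap (contDiff_oscillate τ η hu)

lemma fourier_oscillate (τ : ℝ) (η : Rn n) (u : Rn n → ℂ) (ξ : Rn n) :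
    𝓕 (oscillate τ η u) ξ = 𝓕 u (ξ - (τ / (2 * Real.pi)) • η) := by
  rw [Real.fourier_eq', Real.fourier_eq']
  refine integral_congr_ae (.of_forall fun y => ?_)
  simp only [oscillate, smul_eq_mul]
  rw [← mul_assoc, ← Complex.exp_add]
  congr 2
  rw [inner_sub_right, inner_smul_right]
  have : (Real.pi : ℂ) ≠ 0 := by exact_mod_cast Real.pi_ne_zero
  push_cast
  field_simp
  ring

lemma quantize_oscillate (a : Rn n → Rn n → ℂ) (τ : ℝ) (η : Rn n) {u : Rn n → ℂ}
    (hu : ContDiff ℝ ∞ u) (hc : HasCompactSupport u) (y : Rn n) :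
    quantize a (oscillateSchwartz τ η hu hc) y =
      Complex.exp ((τ * inner ℝ y η : ℝ) * Complex.I) *
        ∫ ξ : Rn n, Complex.exp (2 * Real.pi * Complex.I * (inner ℝ y ξ : ℝ)) *
          a y ((2 * Real.pi) • ξ + τ • η) * 𝓕 u ξ := by
  unfold quantize
  rw [← integral_const_mul, ← integral_add_right_eq_self _ ((τ / (2 * Real.pi)) • η)]
  refine integral_congr_ae (.of_forall fun ξ => ?_)
  have hπ : (2 * Real.pi) ≠ 0 := by positivity
  have h1 : 𝓕 (fun x => oscillateSchwartz τ η hu hc x) (ξ + (τ / (2 * Real.pi)) • η) = 𝓕 u ξ := by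
    refine (fourier_oscillate τ η u _).trans ?_
    rw [add_sub_cancel_right]
  have h2 : (2 * Real.pi) • (ξ + (τ / (2 * Real.pi)) • η) = (2 * Real.pi) • ξ + τ • η := by
    rw [smul_add, smul_smul, mul_div_cancel₀ _ hπ]
  simp only [h1, h2]
  rw [← mul_assoc, ← mul_assoc, ← Complex.exp_add]
  congr 3
  rw [inner_add_right, inner_smul_right]
  have : (Real.pi : ℂ) ≠ 0 := by exact_mod_cast Real.pi_ne_zero
  push_cast
  field_simp
  ring

/-- The amplitude `a` is bounded, continuous in `ξ`, and converges to `β(y)` along the rays with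
direction `η`. -/
structure HasRayLimit (a : Rn n → Rn n → ℂ) (η : Rn n) (β : Rn n → ℂ) : Prop where
  bounded : ∃ C : ℝ, ∀ y ξ, ‖a y ξ‖ ≤ C
  continuous : ∀ y, Continuous (a y)
  tendsto : ∀ y ξ, Filter.Tendsto (fun τ : ℝ => a y (ξ + τ • η)) Filter.atTop (𝓝 (β y))

lemma tendsto_norm_add_smul {η : Rn n} (hη : η ≠ 0) (ξ : Rn n) :
    Filter.Tendsto (fun τ : ℝ => ‖ξ + τ • η‖) Filter.atTop Filter.atTop := by
  have h1 : Filter.Tendsto (fun τ : ℝ => τ * ‖η‖ - ‖ξ‖) Filter.atTop Filter.atTop :=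
    Filter.tendsto_atTop_add_const_right _ _
      (Filter.tendsto_id.atTop_mul_const (norm_pos_iff.2 hη))
  refine Filter.tendsto_atTop_mono' _ ?_ h1
  filter_upwards [Filter.eventually_ge_atTop 0] with τ hτ
  have h2 := norm_sub_norm_le (τ • η) (-ξ)
  rw [norm_smul, Real.norm_of_nonneg hτ, norm_neg, sub_neg_eq_add, add_comm (τ • η)] at h2
  exact h2

lemma IsClassicalSymbol.norm_le {m : ℝ} {a : Rn n → Rn n → ℂ} {b : ℕ → Rn n → Rn n → ℂ}
    (h : IsClassicalSymbol m a b) : ∃ C : ℝ, ∀ y ξ, ‖a y ξ‖ ≤ C * (1 + ‖ξ‖) ^ m := by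
  obtain ⟨C, hC⟩ := h.bound 0 0
  refine ⟨C, fun y ξ => ?_⟩
  have h1 := hC y ξ
  rw [norm_iteratedFDeriv_zero, norm_iteratedFDeriv_zero] at h1
  simpa using h1

lemma IsClassicalSymbol.continuous {m : ℝ} {a : Rn n → Rn n → ℂ} {b : ℕ → Rn n → Rn n → ℂ}
    (h : IsClassicalSymbol m a b) (y : Rn n) : Continuous (a y) :=
  h.smooth.continuous.comp (by fun_prop : Continuous fun ξ : Rn n => (y, ξ))

lemma IsClassicalSymbol.continuous_term {m : ℝ} {a : Rn n → Rn n → ℂ} {b : ℕ → Rn n → Rn n → ℂ}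
    (h : IsClassicalSymbol m a b) (j : ℕ) {y η : Rn n} (hη : η ≠ 0) :
    ContinuousAt (fun p : Rn n × Rn n => b j p.1 p.2) (y, η) := by
  have ho : IsOpen {p : Rn n × Rn n | p.2 ≠ 0} := isOpen_ne_fun continuous_snd continuous_const
  exact (h.smooth_term j).continuousOn.continuousAt (ho.mem_nhds hη)

/-- Along a ray, a classical symbol of order zero converges to its leading term. -/
lemma IsClassicalSymbol.hasRayLimit_zero {a : Rn n → Rn n → ℂ} {b : ℕ → Rn n → Rn n → ℂ}
    (h : IsClassicalSymbol 0 a b) {η : Rn n} (hη : η ≠ 0) :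
    HasRayLimit a η (fun y => b 0 y η) where
  bounded := by
    obtain ⟨C, hC⟩ := h.norm_le
    exact ⟨C, fun y ξ => by simpa using hC y ξ⟩
  continuous := h.continuous
  tendsto y ξ := by
    have hinf := tendsto_norm_add_smul hη ξ
    obtain ⟨C, hC⟩ := h.expansion 1 0 0
    have hdiff : Filter.Tendsto (fun τ : ℝ => a y (ξ + τ • η) - b 0 y (ξ + τ • η)) Filter.atTop
        (𝓝 0) := by
      refine squeeze_zero_norm' (a := fun τ : ℝ => C * ‖ξ + τ • η‖⁻¹) ?_ ?_
      · filter_upwards [hinf.eventually_ge_atTop 1] with τ hτ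
        have h1 := hC y _ hτ
        rw [norm_iteratedFDeriv_zero, norm_iteratedFDeriv_zero] at h1
        simpa [Real.rpow_neg_one] using h1
      · simpa using (tendsto_inv_atTop_zero.comp hinf).const_mul C
    have hlead : Filter.Tendsto (fun τ : ℝ => b 0 y (ξ + τ • η)) Filter.atTop (𝓝 (b 0 y η)) := by
      have h1 : Filter.Tendsto (fun τ : ℝ => τ⁻¹ • ξ + η) Filter.atTop (𝓝 η) := by
        have h3 : Filter.Tendsto (fun τ : ℝ => τ⁻¹ • ξ + η) Filter.atTop (𝓝 ((0 : ℝ) • ξ + η)) :=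
          (Filter.Tendsto.smul_const tendsto_inv_atTop_zero ξ).add_const η
        rwa [zero_smul, zero_add] at h3
      have h2 := (h.continuous_term 0 (y := y) hη).tendsto.comp (tendsto_const_nhds.prodMk_nhds h1)
      refine h2.congr' ?_
      filter_upwards [h1.eventually_ne hη, Filter.eventually_gt_atTop 0] with τ h3 hτ
      have h4 := h.homogeneous 0 y _ h3 τ hτ
      rw [smul_add, smul_smul, mul_inv_cancel₀ hτ.ne', one_smul] at h4
      simp only [Function.comp_apply]
      rw [h4]
      simp
    simpa using hdiff.add hlead

lemma IsClassicalSymbol.hasRayLimit_neg_one {a : Rn n → Rn n → ℂ} {b : ℕ → Rn n → Rn n → ℂ}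
    (h : IsClassicalSymbol (-1) a b) {η : Rn n} (hη : η ≠ 0) : HasRayLimit a η 0 where
  bounded := by
    obtain ⟨C, hC⟩ := h.norm_le
    refine ⟨|C|, fun y ξ => (hC y ξ).trans ?_⟩
    rw [Real.rpow_neg_one]
    refine (mul_le_mul_of_nonneg_right (le_abs_self C) (by positivity)).trans ?_
    exact mul_le_of_le_one_right (abs_nonneg C)
      (inv_le_one_of_one_le₀ (by linarith [norm_nonneg ξ]))
  continuous := h.continuous
  tendsto y ξ := by
    obtain ⟨C, hC⟩ := h.norm_le
    refine squeeze_zero_norm (a := fun τ : ℝ => C * (1 + ‖ξ + τ • η‖)⁻¹)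
      (fun τ => (hC y _).trans_eq (by rw [Real.rpow_neg_one])) ?_
    have h1 := tendsto_inv_atTop_zero.comp
      (Filter.tendsto_atTop_add_const_left _ 1 (tendsto_norm_add_smul hη ξ))
    simpa using h1.const_mul C

lemma integrable_fourier {u : Rn n → ℂ} (hu : ContDiff ℝ ∞ u) (hc : HasCompactSupport u) :
    Integrable (𝓕 u) :=
  (𝓕 (hc.toSchwartzMap hu)).integrable

lemma norm_exp_two_pi_inner (y ξ : Rn n) :
    ‖Complex.exp (2 * Real.pi * Complex.I * (inner ℝ y ξ : ℝ))‖ = 1 := by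
  rw [show (2 * Real.pi * Complex.I * (inner ℝ y ξ : ℝ) : ℂ) =
    ((2 * Real.pi * inner ℝ y ξ : ℝ) : ℂ) * Complex.I by push_cast; ring]
  exact Complex.norm_exp_ofReal_mul_I _

lemma norm_quantize_integral_le {a : Rn n → Rn n → ℂ} {C : ℝ} (hC : ∀ y ξ, ‖a y ξ‖ ≤ C)
    (τ : ℝ) (η : Rn n) {u : Rn n → ℂ} (hu : ContDiff ℝ ∞ u) (hc : HasCompactSupport u) (y : Rn n) :
    ‖∫ ξ : Rn n, Complex.exp (2 * Real.pi * Complex.I * (inner ℝ y ξ : ℝ)) *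
      a y ((2 * Real.pi) • ξ + τ • η) * 𝓕 u ξ‖ ≤ ∫ ξ : Rn n, C * ‖𝓕 u ξ‖ := by
  refine norm_integral_le_of_norm_le ((integrable_fourier hu hc).norm.const_mul C)
    (.of_forall fun ξ => ?_)
  rw [norm_mul, norm_mul]
  refine mul_le_mul_of_nonneg_right ?_ (norm_nonneg _)
  rw [norm_exp_two_pi_inner, one_mul]
  exact hC y _

/-- Applied to `e^{iτ⟨·,η⟩} u`, the operator `Op(a)` is asymptotically, after removal of the
oscillating factor, the multiplication of `u` by the limit of `a` in the direction `η`. -/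
lemma HasRayLimit.tendsto_integral {a : Rn n → Rn n → ℂ} {η : Rn n} {β : Rn n → ℂ}
    (h : HasRayLimit a η β) {u : Rn n → ℂ} (hu : ContDiff ℝ ∞ u) (hc : HasCompactSupport u)
    (y : Rn n) :
    Filter.Tendsto (fun τ : ℝ => ∫ ξ : Rn n,
      Complex.exp (2 * Real.pi * Complex.I * (inner ℝ y ξ : ℝ)) *
        a y ((2 * Real.pi) • ξ + τ • η) * 𝓕 u ξ) Filter.atTop (𝓝 (β y * u y)) := by
  obtain ⟨C, hC⟩ := h.bounded
  have hF := integrable_fourier hu hc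
  have hinv : ∫ ξ : Rn n, Complex.exp (2 * Real.pi * Complex.I * (inner ℝ y ξ : ℝ)) * β y * 𝓕 u ξ =
      β y * u y := by
    have h1 : 𝓕⁻ (𝓕 u) y = u y :=
      congrFun (hu.continuous.fourierInv_fourier_eq
        (hu.continuous.integrable_of_hasCompactSupport hc)
        hF) y
    rw [Real.fourierInv_eq'] at h1
    rw [← h1, ← integral_const_mul]
    refine integral_congr_ae (.of_forall fun ξ => ?_)
    simp only [smul_eq_mul]
    rw [mul_comm _ (β y), mul_assoc, real_inner_comm]
    congr 3
    push_cast
    ring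
  rw [← hinv]
  refine tendsto_integral_filter_of_dominated_convergence (fun ξ => C * ‖𝓕 u ξ‖) ?_ ?_
    (hF.norm.const_mul C) ?_
  · refine .of_forall fun τ => ?_
    have hcont : Continuous fun ξ : Rn n =>
        Complex.exp (2 * Real.pi * Complex.I * (inner ℝ y ξ : ℝ)) *
          a y ((2 * Real.pi) • ξ + τ • η) := by
      refine Continuous.mul (by fun_prop) ((h.continuous y).comp (by fun_prop))
    exact hcont.aestronglyMeasurable.mul hF.1
  · refine .of_forall fun τ => .of_forall fun ξ => ?_
    rw [norm_mul, norm_mul, norm_exp_two_pi_inner, one_mul]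
    exact mul_le_mul_of_nonneg_right (hC y _) (norm_nonneg _)
  · refine .of_forall fun ξ => ?_
    exact ((h.tendsto y _).const_mul _).mul_const _

end Oscillation

/-! ### Sections cut off in a chart -/

section CutSection

variable {n : ℕ} {M : Type*} [TopologicalSpace M] [ChartedSpace (Rn n) M]
  {F : Type*} [NormedAddCommGroup F] [NormedSpace ℂ F]
  {E : M → Type*} [TopologicalSpace (TotalSpace F E)] [∀ x, AddCommGroup (E x)]
  [∀ x, Module ℂ (E x)] [∀ x, TopologicalSpace (E x)] [FiberBundle F E] [VectorBundle ℂ F E]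

lemma eq_zero_of_notMem_source {e : OpenPartialHomeomorph M (Rn n)} {s : smoothSections n F E}
    (hs : closure {x | s.1 x ≠ 0} ⊆ e.source) {x : M} (hx : x ∉ e.source) : s.1 x = 0 := by
  by_contra h
  exact hx (hs (subset_closure h))

variable [ContMDiffVectorBundle ∞ F E (𝓡 n)]

lemma contMDiffAt_smul_section {s : ∀ x, E x} {c : M → ℂ} {x : M}
    (hs : ContMDiffAt (𝓡 n) ((𝓡 n).prod 𝓘(ℝ, F)) ∞ (fun x => TotalSpace.mk' F x (s x)) x)
    (hc : ContMDiffAt (𝓡 n) 𝓘(ℝ, ℂ) ∞ c x) :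
    ContMDiffAt (𝓡 n) ((𝓡 n).prod 𝓘(ℝ, F)) ∞ (fun x => TotalSpace.mk' F x (c x • s x)) x := by
  set e := trivializationAt F E x
  have hx : x ∈ e.baseSet := FiberBundle.mem_baseSet_trivializationAt' x
  rw [e.contMDiffAt_section_iff (IB := 𝓡 n) hx] at hs ⊢
  have h1 : ContMDiffAt (𝓡 n) 𝓘(ℝ, ℂ →L[ℝ] F →L[ℝ] F) ∞
      (fun _ : M => (ContinuousLinearMap.lsmul ℝ ℂ : ℂ →L[ℝ] F →L[ℝ] F)) x := contMDiffAt_const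
  refine ((h1.clm_apply hc).clm_apply hs).congr_of_eventuallyEq ?_
  filter_upwards [e.open_baseSet.mem_nhds hx] with y hy
  exact (e.linear ℂ hy).2 (c y) (s y)

/-- The section `x ↦ u(e(x)) s(x)`, where `s` is supported in the domain of the chart `e`. -/
noncomputable def cutSection {e : OpenPartialHomeomorph M (Rn n)}
    (he : e ∈ IsManifold.maximalAtlas (𝓡 n) ∞ M) {s : smoothSections n F E}
    (hs : closure {x | s.1 x ≠ 0} ⊆ e.source) {u : Rn n → ℂ} (hu : ContDiff ℝ ∞ u) :
    smoothSections n F E :=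
  ⟨fun x => u (e x) • s.1 x, by
    intro x
    by_cases hx : x ∈ closure {x | s.1 x ≠ 0}
    · exact contMDiffAt_smul_section (s.2 x)
        (hu.contMDiff.contMDiffAt.comp x (contMDiffAt_of_mem_maximalAtlas he (hs hx)))
    · refine (contMDiff_zeroSection ℝ E x).congr_of_eventuallyEq ?_
      filter_upwards [isClosed_closure.isOpen_compl.mem_nhds hx] with y hy
      have h0 : s.1 y = 0 := by
        by_contra h
        exact hy (subset_closure h)
      rw [h0, smul_zero]
      rfl⟩

lemma cutSection_apply {e : OpenPartialHomeomorph M (Rn n)}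
    (he : e ∈ IsManifold.maximalAtlas (𝓡 n) ∞ M) {s : smoothSections n F E}
    (hs : closure {x | s.1 x ≠ 0} ⊆ e.source) {u : Rn n → ℂ} (hu : ContDiff ℝ ∞ u) (x : M) :
    (cutSection he hs hu).1 x = u (e x) • s.1 x := rfl

end CutSection

/-! ### Matrix coefficients between oscillating sections -/

section Pairing

variable {n : ℕ} {M : Type*} [TopologicalSpace M] [ChartedSpace (Rn n) M]
  {F : Type*} [NormedAddCommGroup F] [NormedSpace ℂ F]
  {E : M → Type*} [TopologicalSpace (TotalSpace F E)] [∀ x, NormedAddCommGroup (E x)]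
  [∀ x, InnerProductSpace ℂ (E x)] [FiberBundle F E] [VectorBundle ℂ F E]

/-- The functionals `⟨t(x), ·⟩` on the fibres. -/
noncomputable def innerCosection (t : smoothSections n F E) (x : M) : E x →ₗ[ℂ] ℂ :=
  innerₛₗ ℂ (t.1 x)

lemma innerCosection_apply (t : smoothSections n F E) (x : M) (v : E x) :
    innerCosection t x v = inner ℂ (t.1 x) v := rfl

variable [SmoothHermitian n F E]

lemma isLocalData_innerCosection {e : OpenPartialHomeomorph M (Rn n)}
    (he : e ∈ IsManifold.maximalAtlas (𝓡 n) ∞ M) {s t : smoothSections n F E}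
    (hs : closure {x | s.1 x ≠ 0} ⊆ e.source) (ht : closure {x | t.1 x ≠ 0} ⊆ e.source) :
    IsLocalData n (F₁ := F) e s (innerCosection t) where
  mem_atlas := he
  support_section := hs
  smooth_cosection w hw := SmoothHermitian.contMDiff_inner t.1 t.2 w hw
  support_cosection := by
    have h : {x | innerCosection t x ≠ 0} ⊆ {x | t.1 x ≠ 0} := by
      intro x hx h
      refine hx (LinearMap.ext fun v => ?_)
      rw [innerCosection_apply, h, inner_zero_left]
      rfl
    exact (closure_mono h).trans ht

variable [CompactSpace M]

lemma exists_norm_le (s : smoothSections n F E) : ∃ C : ℝ, 0 < C ∧ ∀ x, ‖s.1 x‖ ≤ C := by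
  obtain ⟨C, hC⟩ := isCompact_univ.exists_bound_of_continuousOn
    (SmoothHermitian.contMDiff_inner s.1 s.2 s.1 s.2).continuous.continuousOn
  refine ⟨√C + 1, by positivity, fun x => ?_⟩
  have h1 := hC x (Set.mem_univ x)
  rw [inner_self_eq_norm_sq_to_K, norm_pow, RCLike.norm_ofReal, abs_norm] at h1
  exact (Real.le_sqrt_of_sq_le h1).trans (by linarith)

variable [MeasurableSpace M] [BorelSpace M] (μ : Measure M) [IsFiniteMeasure μ]

lemma inner_toLTwo (s t : smoothSections n F E) :
    (inner ℂ (toLTwo n F E μ s) (toLTwo n F E μ t) : ℂ) = ∫ x, inner ℂ (s.1 x) (t.1 x) ∂μ :=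
  UniformSpace.Completion.inner_coe (𝕜 := ℂ) (E := PreLTwo (n := n) F E μ) s t

variable [ContMDiffVectorBundle ∞ F E (𝓡 n)]

variable {μ} in
/-- The matrix coefficients of a pseudodifferential operator between sections that oscillate with
frequency `τ η` converge as `τ → ∞`, and the limit is given by the limit of the local symbol. -/
lemma tendsto_inner_cutSection {P : smoothSections n F E →ₗ[ℂ] smoothSections n F E}
    {S : LTwo n F E μ →L[ℂ] LTwo n F E μ} (hPS : Extends μ P S)
    {e : OpenPartialHomeomorph M (Rn n)} (he : e ∈ IsManifold.maximalAtlas (𝓡 n) ∞ M)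
    {s t : smoothSections n F E} (hs : closure {x | s.1 x ≠ 0} ⊆ e.source)
    (ht : closure {x | t.1 x ≠ 0} ⊆ e.source) {a : Rn n → Rn n → ℂ} {η : Rn n} {β : Rn n → ℂ}
    (hl : IsLocalSymbol n P e s (innerCosection t) a) (ha : HasRayLimit a η β)
    {u₀ u₁ : Rn n → ℂ} (hu₀ : ContDiff ℝ ∞ u₀) (hc₀ : HasCompactSupport u₀)
    (hu₁ : ContDiff ℝ ∞ u₁) (hc₁ : HasCompactSupport u₁) :
    Integrable (e.source.indicator fun x => conj (u₁ (e x)) * (β (e x) * u₀ (e x))) μ ∧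
    Filter.Tendsto (fun τ : ℝ =>
      (inner ℂ (toLTwo n F E μ (cutSection he ht (contDiff_oscillate τ η hu₁)))
        (S (toLTwo n F E μ (cutSection he hs (contDiff_oscillate τ η hu₀)))) : ℂ)) Filter.atTop
      (𝓝 (∫ x, e.source.indicator (fun x => conj (u₁ (e x)) * (β (e x) * u₀ (e x))) x ∂μ)) := by
  set w : ℝ → smoothSections n F E := fun τ => cutSection he hs (contDiff_oscillate τ η hu₀)
  set v : ℝ → smoothSections n F E := fun τ => cutSection he ht (contDiff_oscillate τ η hu₁)
  have hval : ∀ τ x, (inner ℂ ((v τ).1 x) ((P (w τ)).1 x) : ℂ) =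
      e.source.indicator (fun x => conj (u₁ (e x)) * ∫ ξ : Rn n,
        Complex.exp (2 * Real.pi * Complex.I * (inner ℝ (e x) ξ : ℝ)) *
          a (e x) ((2 * Real.pi) • ξ + τ • η) * 𝓕 u₀ ξ) x := by
    intro τ x
    by_cases hx : x ∈ e.source
    · rw [Set.indicator_of_mem hx]
      have h1 := hl (oscillateSchwartz τ η hu₀ hc₀) (w τ) (fun x => rfl) (e x) (e.map_source hx)
      rw [e.left_inv hx, quantize_oscillate, innerCosection_apply] at h1
      rw [cutSection_apply, inner_smul_left, h1, oscillate, map_mul, ← Complex.exp_conj]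
      have h2 : Complex.exp (conj (((τ * inner ℝ (e x) η : ℝ) : ℂ) * Complex.I)) *
          Complex.exp (((τ * inner ℝ (e x) η : ℝ) : ℂ) * Complex.I) = 1 := by
        rw [map_mul, Complex.conj_I, Complex.conj_ofReal, ← Complex.exp_add]
        simp
      linear_combination (conj (u₁ (e x)) * ∫ ξ : Rn n,
        Complex.exp (2 * Real.pi * Complex.I * (inner ℝ (e x) ξ : ℝ)) *
          a (e x) ((2 * Real.pi) • ξ + τ • η) * 𝓕 u₀ ξ) * h2
    · rw [Set.indicator_of_notMem hx, cutSection_apply, eq_zero_of_notMem_source ht hx, smul_zero,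
        inner_zero_left]
  obtain ⟨C, hC⟩ := ha.bounded
  obtain ⟨C₁, hC₁⟩ := hu₁.continuous.bounded_above_of_compact_support hc₁
  have hC₁0 : 0 ≤ C₁ := (norm_nonneg _).trans (hC₁ 0)
  set B : ℝ := C₁ * ∫ ξ : Rn n, C * ‖𝓕 u₀ ξ‖
  have hB : ∀ τ x, ‖(inner ℂ ((v τ).1 x) ((P (w τ)).1 x) : ℂ)‖ ≤ B := by
    intro τ x
    have h1 := norm_quantize_integral_le hC τ η hu₀ hc₀ (e x)
    rw [hval]
    refine (norm_indicator_le_norm_self _ _).trans ?_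
    rw [norm_mul, RCLike.norm_conj]
    exact mul_le_mul (hC₁ _) h1 (norm_nonneg _) hC₁0
  have hlim : ∀ x, Filter.Tendsto (fun τ => (inner ℂ ((v τ).1 x) ((P (w τ)).1 x) : ℂ)) Filter.atTop
      (𝓝 (e.source.indicator (fun x => conj (u₁ (e x)) * (β (e x) * u₀ (e x))) x)) := by
    intro x
    simp only [hval]
    by_cases hx : x ∈ e.source
    · simp only [Set.indicator_of_mem hx]
      exact (ha.tendsto_integral hu₀ hc₀ (e x)).const_mul _
    · simp only [Set.indicator_of_notMem hx]
      exact tendsto_const_nhds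
  have hmeas : ∀ τ, AEStronglyMeasurable
      (fun x => (inner ℂ ((v τ).1 x) ((P (w τ)).1 x) : ℂ)) μ := fun τ =>
    (integrable_inner μ (v τ) (P (w τ))).1
  constructor
  · refine Integrable.of_bound (aestronglyMeasurable_of_tendsto_ae Filter.atTop hmeas
      (.of_forall hlim)) B (.of_forall fun x => ?_)
    exact le_of_tendsto (hlim x).norm (.of_forall fun τ => hB τ x)
  · have h1 := tendsto_integral_filter_of_dominated_convergence (μ := μ) (fun _ => B)
      (.of_forall hmeas) (.of_forall fun τ => .of_forall (hB τ)) (integrable_const B)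
      (.of_forall hlim)
    refine h1.congr fun τ => ?_
    rw [hPS, inner_toLTwo]

end Pairing

/-! ### A chart that contains two translates of a domain -/

section DoubleChart

variable {n : ℕ} {Γ M : Type*} [Group Γ] [TopologicalSpace M] [ChartedSpace (Rn n) M]
  [MulAction Γ M] [SmoothAction n Γ M] [IsManifold (𝓡 n) ∞ M]

/-- A bounded chart `e` and a translate of it with disjoint domain are parts of one chart, in which
`γ` acts as the translation by a suitable vector `c`. -/
lemma exists_doubleChart {e : OpenPartialHomeomorph M (Rn n)}
    (he : e ∈ IsManifold.maximalAtlas (𝓡 n) ∞ M) (γ : Γ)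
    (hd : Disjoint e.source (smulChart n γ e).source) {c : Rn n}
    (hc : ∀ y ∈ e.target, y - c ∉ e.target) :
    ∃ e₂ ∈ IsManifold.maximalAtlas (𝓡 n) ∞ M, e.source ⊆ e₂.source ∧
      (smulChart n γ e).source ⊆ e₂.source ∧ ∀ x ∈ e.source, e₂ x = e x ∧ e₂ (γ • x) = e x + c := by
  classical
  set e₁ := (smulChart n γ e).transHomeomorph (Homeomorph.addRight c)
  have hs₁ : e₁.source = (smulChart n γ e).source := rfl
  have he₁ : ∀ x, e₁ x = smulChart n γ e x + c := fun x => rfl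
  have he₁s : ∀ y, e₁.symm y = (smulChart n γ e).symm (y - c) := fun y => by
    rw [sub_eq_add_neg]; rfl
  have ht₁ : ∀ y ∈ e₁.target, y - c ∈ e.target := fun y hy => by
    rw [sub_eq_add_neg]; exact hy
  have ht : Disjoint e.target e₁.target :=
    Set.disjoint_left.2 fun y hy hy' => hc y hy (ht₁ y hy')
  have hm := smulChart_mem_maximalAtlas γ he
  have hsm : ContMDiffOn (𝓡 n) (𝓡 n) ∞ e₁ e₁.source :=
    (contDiff_id.add contDiff_const : ContDiff ℝ ∞ fun y : Rn n => y + c).contMDiff.comp_contMDiffOn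
      (contMDiffOn_of_mem_maximalAtlas hm)
  have hsm' : ContMDiffOn (𝓡 n) (𝓡 n) ∞ e₁.symm e₁.target := by
    refine ((contMDiffOn_symm_of_mem_maximalAtlas hm).comp
      (contDiff_id.sub contDiff_const : ContDiff ℝ ∞ fun y : Rn n => y - c).contMDiff.contMDiffOn
      (fun y hy => ht₁ y hy)).congr fun y _ => he₁s y
  refine ⟨e.disjointUnion e₁ (hs₁ ▸ hd) ht, ?_, Set.subset_union_left, Set.subset_union_right, ?_⟩
  · refine OpenPartialHomeomorph.mem_maximalAtlas_of_contMDiffOn _ ?_ ?_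
    · refine ContMDiffOn.union_of_isOpen (s := e.source) (t := e₁.source) ?_ ?_ e.open_source
        e₁.open_source
      · exact (contMDiffOn_of_mem_maximalAtlas he).congr fun x hx =>
          Set.piecewise_eq_of_mem _ _ _ hx
      · exact hsm.congr fun x hx =>
          Set.piecewise_eq_of_notMem _ _ _ (Set.disjoint_right.1 hd hx)
    · refine ContMDiffOn.union_of_isOpen (s := e.target) (t := e₁.target) ?_ ?_ e.open_target
        e₁.open_target
      · exact (contMDiffOn_symm_of_mem_maximalAtlas he).congr
          fun x hx => Set.piecewise_eq_of_mem _ _ _ hx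
      · exact hsm'.congr fun x hx =>
          Set.piecewise_eq_of_notMem _ _ _ (Set.disjoint_right.1 ht hx)
  · intro x hx
    have hx' : γ • x ∈ (smulChart n γ e).source := by
      change γ⁻¹ • γ • x ∈ e.source
      rwa [inv_smul_smul]
    refine ⟨Set.piecewise_eq_of_mem _ _ _ hx,
      (Set.piecewise_eq_of_notMem _ _ _ (Set.disjoint_right.1 hd hx')).trans ?_⟩
    change e (γ⁻¹ • γ • x) + c = _
    rw [inv_smul_smul]

end DoubleChart

/-! ### Asymptotic orthogonality of translates -/

section OffDiagonal

variable {n : ℕ} {Γ M : Type*} [Group Γ] [TopologicalSpace M] [ChartedSpace (Rn n) M]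
  [MulAction Γ M] [SmoothAction n Γ M] [IsManifold (𝓡 n) ∞ M]
  {F : Type*} [NormedAddCommGroup F] [NormedSpace ℂ F]
  {E : M → Type*} [TopologicalSpace (TotalSpace F E)] [∀ x, NormedAddCommGroup (E x)]
  [∀ x, InnerProductSpace ℂ (E x)] [FiberBundle F E] [VectorBundle ℂ F E]
  [ContMDiffVectorBundle ∞ F E (𝓡 n)] [SmoothHermitian n F E] [EquivariantBundle n Γ F E]
  [InvariantHermitian n Γ F E]
  [CompactSpace M] [MeasurableSpace M] [BorelSpace M] {μ : Measure M} [IsFiniteMeasure μ]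
  [SMulInvariantMeasure Γ M μ]

/-- The local symbols of `P` are bounded and have limits in the direction `η`. -/
def HasLocalRayLimits (P : smoothSections n F E →ₗ[ℂ] smoothSections n F E) (η : Rn n) : Prop :=
  ∀ (e : OpenPartialHomeomorph M (Rn n)) (s : smoothSections n F E) (ℓ : ∀ x, E x →ₗ[ℂ] ℂ),
    IsLocalData n (F₁ := F) e s ℓ → ∃ a β, HasRayLimit a η β ∧ IsLocalSymbol n P e s ℓ a

/-- If `γ` moves the domain of the chart off itself, then the matrix coefficients of `P` between
sections that oscillate there and their translates by `γ` tend to zero: in a chart that contains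
both domains, the limit is the integral of a product of functions with disjoint supports. -/
lemma tendsto_inner_unitaryOp {P : smoothSections n F E →ₗ[ℂ] smoothSections n F E}
    {S : LTwo n F E μ →L[ℂ] LTwo n F E μ} (hPS : Extends μ P S) {η : Rn n} (hη : η ≠ 0)
    (hP : HasLocalRayLimits P η) {e : OpenPartialHomeomorph M (Rn n)}
    (he : e ∈ IsManifold.maximalAtlas (𝓡 n) ∞ M) (hb : Bornology.IsBounded e.target) (γ : Γ)
    (hd : Disjoint e.source (smulChart n γ e).source)
    {s t : smoothSections n F E} (hs : closure {x | s.1 x ≠ 0} ⊆ e.source)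
    (ht : closure {x | t.1 x ≠ 0} ⊆ e.source)
    {u : Rn n → ℂ} (hu : ContDiff ℝ ∞ u) (hc : HasCompactSupport u) :
    Filter.Tendsto (fun τ : ℝ =>
      (inner ℂ (toLTwo n F E μ (cutSection he ht (contDiff_oscillate τ η hu)))
        (S (unitaryOp n F E μ γ
          (toLTwo n F E μ (cutSection he hs (contDiff_oscillate τ η hu))))) : ℂ))
      Filter.atTop (𝓝 0) := by
  obtain ⟨R, hR, hR'⟩ : ∃ R : ℝ, 0 < R ∧ ∀ y : Rn n, y ∈ e.target ∪ tsupport u → ‖y‖ ≤ R := by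
    obtain ⟨R, hR⟩ := (hb.union hc.isCompact.isBounded).exists_norm_le
    exact ⟨max R 1, by positivity, fun y hy => (hR y hy).trans (le_max_left _ _)⟩
  -- A translation by `c` separates the target of the chart and the support of the amplitude from
  -- their translates.
  obtain ⟨c, hcR⟩ : ∃ c : Rn n, 2 * R < ‖c‖ := by
    refine ⟨(3 * R / ‖η‖) • η, ?_⟩
    rw [norm_smul, norm_div, norm_norm, div_mul_cancel₀ _ (norm_ne_zero_iff.2 hη),
      Real.norm_of_nonneg (by positivity)]
    linarith
  have hfar : ∀ y : Rn n, y ∈ e.target ∪ tsupport u → y - c ∉ e.target ∪ tsupport u := by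
    intro y hy hy'
    have h1 := norm_sub_le y (y - c)
    rw [sub_sub_cancel] at h1
    linarith [hR' y hy, hR' _ hy']
  obtain ⟨e₂, he₂, hs₂, hs₂', hval⟩ := exists_doubleChart he γ hd (c := c)
    fun y hy hy' => hfar y (.inl hy) (.inl hy')
  have hst : closure {x | (translate n F E γ s).1 x ≠ 0} ⊆ e₂.source :=
    (closure_translate_subset hs γ).trans hs₂'
  have ht₂ := ht.trans hs₂
  have hu₀ : ContDiff ℝ ∞ (fun y => u (y - c)) := hu.comp (contDiff_id.sub contDiff_const)
  have hc₀ : HasCompactSupport (fun y => u (y - c)) :=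
    hc.comp_homeomorph (Homeomorph.subRight c)
  obtain ⟨a, β, hβ, hl⟩ := hP e₂ _ _ (isLocalData_innerCosection he₂ hst ht₂)
  have hlim := (tendsto_inner_cutSection hPS he₂ hst ht₂ hl hβ hu₀ hc₀ hu hc).2
  have hzero : ∀ x, e₂.source.indicator
      (fun x => conj (u (e₂ x)) * (β (e₂ x) * u (e₂ x - c))) x = 0 := by
    intro x
    refine Set.indicator_apply_eq_zero.2 fun _ => ?_
    by_cases h : e₂ x ∈ tsupport u
    · rw [image_eq_zero_of_notMem_tsupport fun h' => hfar _ (.inr h) (.inr h'), mul_zero, mul_zero]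
    · rw [image_eq_zero_of_notMem_tsupport h, map_zero, zero_mul]
  simp only [hzero, integral_zero] at hlim
  refine tendsto_zero_iff_norm_tendsto_zero.2 ((tendsto_zero_iff_norm_tendsto_zero.1 hlim).congr
    fun τ => ?_)
  have h1 : cutSection he₂ ht₂ (contDiff_oscillate τ η hu) =
      cutSection he ht (contDiff_oscillate τ η hu) := by
    refine Subtype.ext (funext fun x => ?_)
    rw [cutSection_apply, cutSection_apply]
    by_cases hx : x ∈ e.source
    · rw [(hval x hx).1]
    · rw [eq_zero_of_notMem_source ht hx, smul_zero, smul_zero]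
  have h2 : cutSection he₂ hst (contDiff_oscillate τ η hu₀) =
      Complex.exp ((τ * inner ℝ c η : ℝ) * Complex.I) •
        translate n F E γ (cutSection he hs (contDiff_oscillate τ η hu)) := by
    refine Subtype.ext (funext fun x => ?_)
    obtain ⟨z, rfl⟩ : ∃ z, x = γ • z := ⟨γ⁻¹ • x, (smul_inv_smul γ x).symm⟩
    change _ = Complex.exp ((τ * inner ℝ c η : ℝ) * Complex.I) • (translate n F E γ _).1 (γ • z)
    rw [cutSection_apply, translate_apply_smul, translate_apply_smul, cutSection_apply]
    by_cases hz : z ∈ e.source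
    · rw [(hval z hz).2, map_smul, smul_smul]
      congr 1
      rw [oscillate, oscillate, add_sub_cancel_right, ← mul_assoc, ← Complex.exp_add,
        inner_add_left]
      congr 2
      push_cast
      ring
    · rw [eq_zero_of_notMem_source hs hz, smul_zero, map_zero, smul_zero, smul_zero]
  rw [h1, h2, map_smul, map_smul, inner_smul_right, norm_mul, Complex.norm_exp_ofReal_mul_I,
    one_mul, unitaryOp_toLTwo]

end OffDiagonal

/-! ### Smooth measures in charts -/

section Mass

variable {n : ℕ} {M : Type*} [TopologicalSpace M] [ChartedSpace (Rn n) M]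
  [MeasurableSpace M] [BorelSpace M] {μ : Measure M}

lemma measure_chart_preimage_pos (hμ : IsSmoothMeasure n μ) {e : OpenPartialHomeomorph M (Rn n)}
    (he : e ∈ IsManifold.maximalAtlas (𝓡 n) ∞ M) {O : Set (Rn n)} (hO : IsOpen O)
    (hne : O.Nonempty) (hOe : O ⊆ e.target) : 0 < μ (e.source ∩ e ⁻¹' O) := by
  obtain ⟨w, hsm, hpos, hmap⟩ := hμ e he
  refine pos_iff_ne_zero.2 fun h0 => ?_
  have hem : AEMeasurable e (μ.restrict e.source) :=
    e.continuousOn.aemeasurable e.open_source.measurableSet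
  have h1 : (volume.restrict e.target).withDensity (fun y => ENNReal.ofReal (w y)) O = 0 := by
    rw [← hmap, Measure.map_apply_of_aemeasurable hem hO.measurableSet,
      Measure.restrict_apply₀' e.open_source.measurableSet.nullMeasurableSet, Set.inter_comm]
    exact h0
  rw [withDensity_apply _ hO.measurableSet, Measure.restrict_restrict hO.measurableSet,
    Set.inter_eq_left.2 hOe] at h1
  have h2 := (setLIntegral_eq_zero_iff' hO.measurableSet
    ((hsm.continuousOn.mono hOe).aemeasurable hO.measurableSet).ennreal_ofReal).1 h1
  refine (hO.measure_pos volume hne).ne' (measure_eq_zero_iff_ae_notMem.2 ?_)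
  filter_upwards [h2] with y hy hyO
  exact (ENNReal.ofReal_pos.2 (hpos y (hOe hyO))).ne' (hy hyO)

end Mass

lemma integrable_indicator_comp_chart {n : ℕ} {M : Type*} [TopologicalSpace M]
    [MeasurableSpace M] [BorelSpace M] {μ : Measure M} [IsFiniteMeasure μ]
    (e : OpenPartialHomeomorph M (Rn n)) {f : Rn n → ℝ}
    (hf : Continuous f) (hc : HasCompactSupport f) :
    Integrable (e.source.indicator fun x => f (e x)) μ := by
  obtain ⟨C, hC⟩ := hf.bounded_above_of_compact_support hc
  refine Integrable.of_bound ?_ C (.of_forall fun x =>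
    (norm_indicator_le_norm_self _ _).trans (hC _))
  refine (aestronglyMeasurable_indicator_iff e.open_source.measurableSet).2 ?_
  exact (hf.comp_continuousOn e.continuousOn).aestronglyMeasurable e.open_source.measurableSet

/-! ### Norms of oscillating sections -/

section NormBounds

variable {n : ℕ} {Γ M : Type*} [Group Γ] [TopologicalSpace M] [ChartedSpace (Rn n) M]
  [MulAction Γ M] [SmoothAction n Γ M]
  {F : Type*} [NormedAddCommGroup F] [NormedSpace ℂ F]
  {E : M → Type*} [TopologicalSpace (TotalSpace F E)] [∀ x, NormedAddCommGroup (E x)]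
  [∀ x, InnerProductSpace ℂ (E x)] [FiberBundle F E] [VectorBundle ℂ F E]
  [SmoothHermitian n F E]
  [CompactSpace M] [MeasurableSpace M] [BorelSpace M] {μ : Measure M} [IsFiniteMeasure μ]

lemma norm_toLTwo_cutSection_le [ContMDiffVectorBundle ∞ F E (𝓡 n)]
    {e : OpenPartialHomeomorph M (Rn n)}
    (he : e ∈ IsManifold.maximalAtlas (𝓡 n) ∞ M) {s : smoothSections n F E}
    (hs : closure {x | s.1 x ≠ 0} ⊆ e.source) {C : ℝ} (hC0 : 0 ≤ C) (hC : ∀ x, ‖s.1 x‖ ≤ C)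
    (τ : ℝ) (η : Rn n) {u : Rn n → ℂ} (hu : ContDiff ℝ ∞ u) (hc : HasCompactSupport u) :
    ‖toLTwo n F E μ (cutSection he hs (contDiff_oscillate τ η hu))‖ ≤
      C * √(∫ x, e.source.indicator (fun x => ‖u (e x)‖ ^ 2) x ∂μ) := by
  set w := cutSection he hs (contDiff_oscillate τ η hu)
  have hk : Integrable (e.source.indicator fun x => ‖u (e x)‖ ^ 2) μ :=
    integrable_indicator_comp_chart e (f := fun y => ‖u y‖ ^ 2) (by have := hu.continuous; fun_prop)
      (hc.norm.comp_left (g := fun r : ℝ => r ^ 2) (by simp))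
  have h1 : ‖toLTwo n F E μ w‖ ^ 2 ≤
      C ^ 2 * ∫ x, e.source.indicator (fun x => ‖u (e x)‖ ^ 2) x ∂μ := by
    rw [norm_toLTwo_sq, ← integral_const_mul]
    change RCLike.re (∫ x, (inner ℂ (w.1 x) (w.1 x) : ℂ) ∂μ) ≤ _
    rw [← integral_re (integrable_inner μ w w)]
    refine integral_mono (integrable_inner μ w w).re (hk.const_mul _) fun x => ?_
    change RCLike.re (inner ℂ (w.1 x) (w.1 x) : ℂ) ≤ _
    rw [inner_self_eq_norm_sq]
    by_cases hx : x ∈ e.source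
    · rw [Set.indicator_of_mem hx, cutSection_apply, norm_smul, norm_oscillate, mul_pow, mul_comm]
      gcongr
      exact hC x
    · rw [Set.indicator_of_notMem hx, cutSection_apply, eq_zero_of_notMem_source hs hx, smul_zero,
        norm_zero]
      simp
  refine (Real.le_sqrt_of_sq_le h1).trans_eq ?_
  rw [Real.sqrt_mul (sq_nonneg C), Real.sqrt_sq hC0]

lemma norm_unitaryOp [EquivariantBundle n Γ F E] [InvariantHermitian n Γ F E]
    [SMulInvariantMeasure Γ M μ] (γ : Γ) (s : smoothSections n F E) :
    ‖unitaryOp n F E μ γ (toLTwo n F E μ s)‖ = ‖toLTwo n F E μ s‖ := by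
  rw [unitaryOp_toLTwo, norm_translate]

end NormBounds

/-! ### Averages over the group near a free point -/

section FreePointEstimate

lemma exists_nhds_forall_smul_notMem (n : ℕ) {Γ M : Type*} [Group Γ] [Finite Γ]
    [TopologicalSpace M] [T2Space M] [ChartedSpace (Rn n) M] [MulAction Γ M] [SmoothAction n Γ M]
    {x₁ : M} (hx₁ : ∀ γ : Γ, γ • x₁ = x₁ → γ = 1) :
    ∃ N ∈ 𝓝 x₁, ∀ γ : Γ, γ ≠ 1 → ∀ x ∈ N, γ • x ∉ N := by
  have h : ∀ γ : Γ, ∃ N ∈ 𝓝 x₁, γ ≠ 1 → ∀ x ∈ N, γ • x ∉ N := by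
    intro γ
    by_cases hγ : γ = 1
    · exact ⟨Set.univ, Filter.univ_mem, fun h => absurd hγ h⟩
    · obtain ⟨A, B, hA, hB, hxA, hxB, hAB⟩ := t2_separation fun h => hγ (hx₁ γ h)
      refine ⟨B ∩ (fun x => γ • x) ⁻¹' A, Filter.inter_mem (hB.mem_nhds hxB) ?_, ?_⟩
      · exact (SmoothAction.contMDiff_smul (n := n) γ).continuous.continuousAt.preimage_mem_nhds
          (hA.mem_nhds hxA)
      · exact fun _ x hx hx' => Set.disjoint_left.1 hAB hx.2 hx'.1
  choose N hN hN' using h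
  exact ⟨⋂ γ, N γ, Filter.iInter_mem.2 hN, fun γ hγ x hx hx' =>
    hN' γ hγ x (Set.mem_iInter.1 hx γ) (Set.mem_iInter.1 hx' γ)⟩

variable {n : ℕ} {Γ M : Type*} [Group Γ] [TopologicalSpace M]
  [ChartedSpace (Rn n) M] [MulAction Γ M] [SmoothAction n Γ M] [IsManifold (𝓡 n) ∞ M]
  {F : Type*} [NormedAddCommGroup F] [NormedSpace ℂ F]
  {E : M → Type*} [TopologicalSpace (TotalSpace F E)] [∀ x, NormedAddCommGroup (E x)]
  [∀ x, InnerProductSpace ℂ (E x)] [FiberBundle F E] [VectorBundle ℂ F E]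
  [ContMDiffVectorBundle ∞ F E (𝓡 n)] [SmoothHermitian n F E] [EquivariantBundle n Γ F E]
  [InvariantHermitian n Γ F E]
  [CompactSpace M] [MeasurableSpace M] [BorelSpace M] {μ : Measure M} [IsFiniteMeasure μ]
  [SMulInvariantMeasure Γ M μ]

/-- If all `γ ≠ 1` move the domain of the chart off itself, then only the summand of `γ = 1`
contributes to the limit of the matrix coefficients of `P` on a weighted average of translates. The
local symbol is read in the larger chart `e`, in which it does not depend on the cut-off `χ`. -/
lemma tendsto_inner_sum_unitaryOp [Fintype Γ]
    {P : smoothSections n F E →ₗ[ℂ] smoothSections n F E}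
    {S : LTwo n F E μ →L[ℂ] LTwo n F E μ} (hPS : Extends μ P S) {η : Rn n} (hη : η ≠ 0)
    (hP : HasLocalRayLimits P η) {e e' : OpenPartialHomeomorph M (Rn n)}
    (he : e ∈ IsManifold.maximalAtlas (𝓡 n) ∞ M) (he' : e' ∈ IsManifold.maximalAtlas (𝓡 n) ∞ M)
    (hee' : (e' : M → Rn n) = e) (hb : Bornology.IsBounded e'.target)
    (hd : ∀ γ : Γ, γ ≠ 1 → Disjoint e'.source (smulChart n γ e').source)
    {s t : smoothSections n F E} (hs : closure {x | s.1 x ≠ 0} ⊆ e.source)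
    (ht : closure {x | t.1 x ≠ 0} ⊆ e.source)
    {χ : Rn n → ℂ} (hχ : ContDiff ℝ ∞ χ) (hc : HasCompactSupport χ)
    (hs' : closure {x | (cutSection he hs hχ).1 x ≠ 0} ⊆ e'.source)
    (ht' : closure {x | (cutSection he ht hχ).1 x ≠ 0} ⊆ e'.source)
    {a : Rn n → Rn n → ℂ} {β : Rn n → ℂ}
    (hl : IsLocalSymbol n P e s (innerCosection t) a) (ha : HasRayLimit a η β)
    (d : Γ → ℂ) (hd1 : d 1 = 1) :
    Filter.Tendsto (fun τ : ℝ =>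
      (inner ℂ (toLTwo n F E μ (cutSection he ht (contDiff_oscillate τ η (hχ.mul hχ))))
        (S (∑ γ : Γ, d γ • unitaryOp n F E μ γ
          (toLTwo n F E μ (cutSection he hs (contDiff_oscillate τ η (hχ.mul hχ)))))) : ℂ))
      Filter.atTop (𝓝 (∫ x, e.source.indicator
        (fun x => conj (χ (e x) * χ (e x)) * (β (e x) * (χ (e x) * χ (e x)))) x ∂μ)) := by
  classical
  have hcut : ∀ (τ : ℝ) (r : smoothSections n F E) (hr : closure {x | r.1 x ≠ 0} ⊆ e.source)
      (hr' : closure {x | (cutSection he hr hχ).1 x ≠ 0} ⊆ e'.source),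
      cutSection he hr (contDiff_oscillate τ η (hχ.mul hχ)) =
        cutSection he' hr' (contDiff_oscillate τ η hχ) := by
    intro τ r hr hr'
    refine Subtype.ext (funext fun x => ?_)
    rw [cutSection_apply, cutSection_apply, cutSection_apply, hee', smul_smul, oscillate,
      oscillate, mul_assoc]
  have hterm : ∀ γ : Γ, Filter.Tendsto (fun τ : ℝ =>
      d γ * (inner ℂ (toLTwo n F E μ (cutSection he ht (contDiff_oscillate τ η (hχ.mul hχ))))
        (S (unitaryOp n F E μ γ
          (toLTwo n F E μ (cutSection he hs (contDiff_oscillate τ η (hχ.mul hχ)))))) : ℂ))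
      Filter.atTop (𝓝 (if γ = 1 then (∫ x, e.source.indicator
        (fun x => conj (χ (e x) * χ (e x)) * (β (e x) * (χ (e x) * χ (e x)))) x ∂μ) else 0)) := by
    intro γ
    by_cases hγ : γ = 1
    · subst hγ
      have h1 := (tendsto_inner_cutSection hPS he hs ht hl ha (hχ.mul hχ) hc.mul_left (hχ.mul hχ)
        hc.mul_left).2
      rw [if_pos rfl, hd1]
      refine h1.congr fun τ => ?_
      rw [unitaryOp_toLTwo, translate_one, one_mul]
    · rw [if_neg hγ]
      have h1 := tendsto_inner_unitaryOp hPS hη hP he' hb γ (hd γ hγ) hs' ht' hχ hc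
      rw [← mul_zero (d γ)]
      refine (h1.const_mul (d γ)).congr fun τ => ?_
      rw [hcut τ s hs hs', hcut τ t ht ht']
  have hsum := tendsto_finsetSum Finset.univ fun γ _ => hterm γ
  rw [Finset.sum_ite_eq' Finset.univ (1 : Γ), if_pos (Finset.mem_univ _)] at hsum
  refine hsum.congr fun τ => ?_
  rw [map_sum, inner_sum]
  refine Finset.sum_congr rfl fun γ _ => ?_
  rw [map_smul, inner_smul_right]

end FreePointEstimate

/-! ### Small charts around free points -/

section SmallChart

variable {n : ℕ} {Γ M : Type*} [Group Γ] [Finite Γ] [TopologicalSpace M] [T2Space M]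
  [ChartedSpace (Rn n) M] [MulAction Γ M] [SmoothAction n Γ M] [IsManifold (𝓡 n) ∞ M]

/-- Around a free point, a chart can be shrunk so that its domain is disjoint from all its
translates. -/
lemma exists_small_chart {e : OpenPartialHomeomorph M (Rn n)}
    (he : e ∈ IsManifold.maximalAtlas (𝓡 n) ∞ M) {x₁ : M} (hx : x₁ ∈ e.source)
    (hx₁ : ∀ γ : Γ, γ • x₁ = x₁ → γ = 1) {r : ℝ} (hr : 0 < r) :
    ∃ e' ∈ IsManifold.maximalAtlas (𝓡 n) ∞ M, (e' : M → Rn n) = e ∧ x₁ ∈ e'.source ∧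
      e'.source ⊆ e.source ∧ e'.target ⊆ Metric.ball (e x₁) r ∧
      (e'.symm : Rn n → M) = e.symm ∧
      ∀ γ : Γ, γ ≠ 1 → Disjoint e'.source (smulChart n γ e').source := by
  obtain ⟨N, hN, hN'⟩ := exists_nhds_forall_smul_notMem n hx₁
  set O : Set M := interior N ∩ (e.source ∩ e ⁻¹' Metric.ball (e x₁) r)
  have hO : IsOpen O := isOpen_interior.inter (e.isOpen_inter_preimage Metric.isOpen_ball)
  have hsrc : (e.restrOpen O hO).source ⊆ e.source := Set.inter_subset_left
  refine ⟨e.restrOpen O hO, ?_, rfl, ⟨hx, mem_interior_iff_mem_nhds.2 hN, hx,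
    Metric.mem_ball_self hr⟩, hsrc, ?_, rfl, ?_⟩
  · exact OpenPartialHomeomorph.mem_maximalAtlas_of_contMDiffOn _
      ((contMDiffOn_of_mem_maximalAtlas he).mono hsrc)
      ((contMDiffOn_symm_of_mem_maximalAtlas he).mono Set.inter_subset_left)
  · rintro y ⟨hy, hyO⟩
    have h1 : e (e.symm y) ∈ Metric.ball (e x₁) r := hyO.2.2
    rwa [e.right_inv hy] at h1
  · intro γ hγ
    refine Set.disjoint_left.2 fun x hx hx' => ?_
    have h1 : x ∈ N := interior_subset hx.2.1
    have h2 : γ⁻¹ • x ∈ N := interior_subset (show γ⁻¹ • x ∈ interior N from hx'.2.1)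
    refine hN' γ hγ _ h2 ?_
    rwa [smul_inv_smul]

end SmallChart

/-! ### The kernel of the restriction morphism -/

section Estimate

variable {n : ℕ} {Γ M : Type*} [Group Γ] [TopologicalSpace M] [T2Space M]
  [ChartedSpace (Rn n) M] [MulAction Γ M] [SmoothAction n Γ M] [IsManifold (𝓡 n) ∞ M]
  {F : Type*} [NormedAddCommGroup F] [NormedSpace ℂ F]
  {E : M → Type*} [TopologicalSpace (TotalSpace F E)] [∀ x, NormedAddCommGroup (E x)]
  [∀ x, InnerProductSpace ℂ (E x)] [FiberBundle F E] [VectorBundle ℂ F E]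
  [ContMDiffVectorBundle ∞ F E (𝓡 n)] [SmoothHermitian n F E] [EquivariantBundle n Γ F E]
  [InvariantHermitian n Γ F E]
  [CompactSpace M] [MeasurableSpace M] [BorelSpace M] {μ : Measure M} [IsFiniteMeasure μ]
  [SMulInvariantMeasure Γ M μ]

/-- If `T = K` on the `α`-isotypical part of `L²(M; E)`, then at a free point the leading symbol of
an operator of order zero that is close to `T` is small, provided `K` is close to an operator of
order `-1`: the oscillating sections near a free point and their translates by `Γ` are
asymptotically orthogonal, so that they cannot distinguish the isotypical components. -/
lemma norm_leading_term_le_of_free [Fintype Γ] (hμ : IsSmoothMeasure n μ)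
    {P Q : smoothSections n F E →ₗ[ℂ] smoothSections n F E}
    {T K S S' : LTwo n F E μ →L[ℂ] LTwo n F E μ} (hP : IsPsiDO n 0 P) (hPS : Extends μ P S)
    (hQ : IsPsiDO n (-1) Q) (hQS : Extends μ Q S') {ε : ℝ} (hTS : ‖T - S‖ ≤ ε)
    (hKS : ‖K - S'‖ ≤ ε) {α : Dual Γ}
    (hTK : ∀ v ∈ isotypicPart α.rep (lTwoRep n Γ F E μ), T v = K v)
    {l : α.Space →ₗ[ℂ] ℂ} {a₀ : α.Space} (hla : l a₀ = 1)
    {e : OpenPartialHomeomorph M (Rn n)} (he : e ∈ IsManifold.maximalAtlas (𝓡 n) ∞ M)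
    {s t : smoothSections n F E} (hs : closure {x | s.1 x ≠ 0} ⊆ e.source)
    (ht : closure {x | t.1 x ≠ 0} ⊆ e.source) {Cs Ct : ℝ} (hCs0 : 0 ≤ Cs)
    (hCs : ∀ x, ‖s.1 x‖ ≤ Cs) (hCt0 : 0 ≤ Ct) (hCt : ∀ x, ‖t.1 x‖ ≤ Ct)
    {a : Rn n → Rn n → ℂ} {b : ℕ → Rn n → Rn n → ℂ} (hab : IsClassicalSymbol 0 a b)
    (hl : IsLocalSymbol n P e s (innerCosection t) a) {η : Rn n} (hη : η ≠ 0) {x₁ : M}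
    (hx : x₁ ∈ e.source) (hx₁ : ∀ γ : Γ, γ • x₁ = x₁ → γ = 1) :
    ‖b 0 (e x₁) η‖ ≤ 2 * ε * (∑ γ : Γ, ‖l (α.rep γ⁻¹ a₀)‖) * Cs * Ct := by
  set D := ∑ γ : Γ, ‖l (α.rep γ⁻¹ a₀)‖
  have hε0 : 0 ≤ ε := (norm_nonneg _).trans hTS
  have hD0 : 0 ≤ D := Finset.sum_nonneg fun _ _ => norm_nonneg _
  refine le_of_forall_pos_le_add fun δ hδ => ?_
  set β : Rn n → ℂ := fun y => b 0 y η
  have hβc : ContinuousAt β (e x₁) :=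
    (hab.continuous_term 0 (y := e x₁) hη).comp (f := fun y : Rn n => (y, η)) (by fun_prop)
  obtain ⟨r, hr, hrβ⟩ := Metric.continuousAt_iff.1 hβc δ hδ
  obtain ⟨e', he', hee', hxe', hsub, hball, hsymm, hd⟩ := exists_small_chart he hx hx₁ hr
  have htar : e'.target ∈ 𝓝 (e x₁) := by
    rw [← hee']
    exact e'.open_target.mem_nhds (e'.map_source hxe')
  obtain ⟨r', hr', hr'e⟩ := Metric.nhds_basis_closedBall.mem_iff.1 htar
  let f : ContDiffBump (e x₁) := ⟨r' / 2, r', by positivity, by linarith⟩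
  -- The sections are cut off by `χ²`: one factor localizes them to the small chart `e'`, the other
  -- one serves as the amplitude there.
  set χ : Rn n → ℂ := fun y => (f y : ℂ)
  have hχ : ContDiff ℝ ∞ χ := Complex.ofRealCLM.contDiff.comp f.contDiff
  have hc : HasCompactSupport χ :=
    f.hasCompactSupport.comp_left (g := fun r : ℝ => (r : ℂ)) (by simp)
  have hsupp : ∀ y, χ y ≠ 0 → y ∈ Metric.ball (e x₁) r' := by
    intro y hy
    have : y ∈ Function.support f := fun h => hy (by simp [χ, h])
    rwa [f.support_eq] at this
  have hcl : ∀ (w : smoothSections n F E) (hw : closure {x | w.1 x ≠ 0} ⊆ e.source),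
      closure {x | (cutSection he hw hχ).1 x ≠ 0} ⊆ e'.source := by
    intro w hw
    have hcomp : IsCompact (e'.symm '' Metric.closedBall (e x₁) r') :=
      (isCompact_closedBall _ _).image_of_continuousOn (e'.continuousOn_symm.mono hr'e)
    have hin : {x | (cutSection he hw hχ).1 x ≠ 0} ⊆ e'.symm '' Metric.closedBall (e x₁) r' := by
      intro x hx0
      have h1 : χ (e x) ≠ 0 := left_ne_zero_of_smul hx0
      have h2 : w.1 x ≠ 0 := right_ne_zero_of_smul hx0
      refine ⟨e x, Metric.ball_subset_closedBall (hsupp _ h1), ?_⟩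
      rw [hsymm]
      exact e.left_inv (hw (subset_closure h2))
    refine (closure_minimal hin hcomp.isClosed).trans ?_
    rintro _ ⟨y, hy, rfl⟩
    exact e'.map_target (hr'e hy)
  have hPr : HasLocalRayLimits P η := fun e s ℓ h => by
    obtain ⟨a, b, hab, hl⟩ := hP e s ℓ h
    exact ⟨a, _, hab.hasRayLimit_zero hη, hl⟩
  have hQr : HasLocalRayLimits Q η := fun e s ℓ h => by
    obtain ⟨a, b, hab, hl⟩ := hQ e s ℓ h
    exact ⟨a, _, hab.hasRayLimit_neg_one hη, hl⟩
  have hb : Bornology.IsBounded e'.target := Metric.isBounded_ball.subset hball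
  obtain ⟨a', b', hab', hl'⟩ := hQ e s _ (isLocalData_innerCosection he hs ht)
  -- Averages of translates with these weights lie in the `α`-isotypical part, and the weight of the
  -- identity is `1`.
  set d : Γ → ℂ := fun γ => l (α.rep γ⁻¹ a₀)
  have hd1 : d 1 = 1 := by simp [d, hla]
  have hlimP := tendsto_inner_sum_unitaryOp hPS hη hPr he he' hee' hb hd hs ht hχ hc (hcl s hs)
    (hcl t ht) hl (hab.hasRayLimit_zero hη) d hd1
  have hlimQ := tendsto_inner_sum_unitaryOp hQS hη hQr he he' hee' hb hd hs ht hχ hc (hcl s hs)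
    (hcl t ht) hl' (hab'.hasRayLimit_neg_one hη) d hd1
  -- The leading symbol of order zero of an operator of order `-1` is zero.
  have hzero : ∀ x, e.source.indicator (fun x => conj (χ (e x) * χ (e x)) *
      ((0 : Rn n → ℂ) (e x) * (χ (e x) * χ (e x)))) x = 0 := by
    intro x
    refine Set.indicator_apply_eq_zero.2 fun _ => ?_
    simp
  simp only [hzero, integral_zero] at hlimQ
  have hlim := (hlimP.sub hlimQ).norm
  rw [sub_zero] at hlim
  set G : M → ℂ := e.source.indicator
    (fun x => conj (χ (e x) * χ (e x)) * (b 0 (e x) η * (χ (e x) * χ (e x))))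
  set k : M → ℝ := e.source.indicator fun x => ‖χ (e x) * χ (e x)‖ ^ 2
  set I : ℝ := ∫ x, k x ∂μ
  have hG : Integrable G μ := (tendsto_inner_cutSection hPS he hs ht hl (hab.hasRayLimit_zero hη)
    (hχ.mul hχ) hc.mul_left (hχ.mul hχ) hc.mul_left).1
  have hχχ : ContDiff ℝ ∞ fun y => χ y * χ y := hχ.mul hχ
  have hcc : HasCompactSupport fun y => χ y * χ y := hc.mul_left
  have hk : Integrable k μ := integrable_indicator_comp_chart e
    (f := fun y => ‖χ y * χ y‖ ^ 2) (by have := hχ.continuous; fun_prop)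
    (hcc.norm.comp_left (g := fun r : ℝ => r ^ 2) (by simp))
  have hk0 : ∀ x, 0 ≤ k x := fun x => Set.indicator_nonneg (fun _ _ => by positivity) x
  have hI : 0 < I := by
    refine (integral_pos_iff_support_of_nonneg hk0 hk).2 ?_
    refine (measure_chart_preimage_pos hμ he Metric.isOpen_ball
      ⟨e x₁, Metric.mem_ball_self hr'⟩ fun y hy => ?_).trans_le (measure_mono ?_)
    · have h1 : y ∈ e'.target := hr'e (Metric.ball_subset_closedBall hy)
      have h2 := hsub (e'.map_target h1)
      have h3 := e.map_source h2
      rwa [← hee', e'.right_inv h1] at h3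
    · rintro x ⟨hxe, hxb⟩
      have h1 : f (e x) ≠ 0 := by
        have : e x ∈ Function.support f := by rw [f.support_eq]; exact hxb
        exact this
      have h2 : χ (e x) ≠ 0 := by simpa [χ] using h1
      change k x ≠ 0
      simp only [k, Set.indicator_of_mem hxe]
      exact pow_ne_zero 2 (norm_ne_zero_iff.2 (mul_ne_zero h2 h2))
  -- The limit is bounded by the distances of `T` and `K` to the pseudodifferential operators.
  have hup : ‖∫ x, G x ∂μ‖ ≤ 2 * ε * D * Cs * Ct * I := by
    refine le_of_tendsto hlim (.of_forall fun τ => ?_)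
    set w := cutSection he hs (contDiff_oscillate τ η (hχ.mul hχ))
    set v := cutSection he ht (contDiff_oscillate τ η (hχ.mul hχ))
    set z := ∑ γ : Γ, d γ • unitaryOp n F E μ γ (toLTwo n F E μ w)
    have hz : T z = K z := hTK z (sum_coeff_mem_isotypicPart α.rep (lTwoRep n Γ F E μ) l a₀
      (toLTwo n F E μ w))
    have hzn : ‖z‖ ≤ D * ‖toLTwo n F E μ w‖ := by
      refine (norm_sum_le _ _).trans_eq ?_
      rw [Finset.sum_mul]
      refine Finset.sum_congr rfl fun γ _ => ?_
      rw [norm_smul, norm_unitaryOp]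
    have hSz : S z - S' z = (K - S') z - (T - S) z := by
      rw [sub_apply, sub_apply, hz]
      abel
    have hSn : ‖S z - S' z‖ ≤ 2 * ε * ‖z‖ := by
      rw [hSz]
      have h1 := (K - S').le_of_opNorm_le hKS z
      have h2 := (T - S).le_of_opNorm_le hTS z
      linarith [norm_sub_le ((K - S') z) ((T - S) z)]
    have hw : ‖toLTwo n F E μ w‖ ≤ Cs * √I :=
      norm_toLTwo_cutSection_le he hs hCs0 hCs τ η hχχ hcc
    have hv : ‖toLTwo n F E μ v‖ ≤ Ct * √I :=
      norm_toLTwo_cutSection_le he ht hCt0 hCt τ η hχχ hcc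
    rw [← inner_sub_right]
    calc _ ≤ ‖toLTwo n F E μ v‖ * ‖S z - S' z‖ := norm_inner_le_norm _ _
      _ ≤ (Ct * √I) * (2 * ε * (D * (Cs * √I))) := by
          gcongr
          refine hSn.trans ?_
          gcongr
          exact hzn.trans (by gcongr)
      _ = 2 * ε * D * Cs * Ct * (√I * √I) := by ring
      _ = 2 * ε * D * Cs * Ct * I := by rw [Real.mul_self_sqrt hI.le]
  -- Near `x₁` the leading term is almost constant.
  have hlow : ‖(∫ x, G x ∂μ) - b 0 (e x₁) η * (I : ℂ)‖ ≤ δ * I := by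
    have hk' : Integrable (fun x => b 0 (e x₁) η * (k x : ℂ)) μ := hk.ofReal.const_mul _
    have h1 : (∫ x, G x ∂μ) - b 0 (e x₁) η * (I : ℂ) =
        ∫ x, (G x - b 0 (e x₁) η * (k x : ℂ)) ∂μ := by
      rw [integral_sub hG hk', integral_const_mul, integral_complex_ofReal]
    rw [h1, ← integral_const_mul]
    refine norm_integral_le_of_norm_le (hk.const_mul δ) (.of_forall fun x => ?_)
    by_cases hxe : x ∈ e.source
    · simp only [G, k, Set.indicator_of_mem hxe]
      have h2 : conj (χ (e x) * χ (e x)) * (b 0 (e x) η * (χ (e x) * χ (e x))) -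
          b 0 (e x₁) η * ((‖χ (e x) * χ (e x)‖ ^ 2 : ℝ) : ℂ) =
          (b 0 (e x) η - b 0 (e x₁) η) * ((‖χ (e x) * χ (e x)‖ ^ 2 : ℝ) : ℂ) := by
        have h3 := Complex.conj_mul' (χ (e x) * χ (e x))
        push_cast
        linear_combination b 0 (e x) η * h3
      rw [h2, norm_mul, Complex.norm_real, Real.norm_of_nonneg (by positivity)]
      by_cases hχ0 : χ (e x) = 0
      · simp [hχ0]
      · refine mul_le_mul_of_nonneg_right ?_ (by positivity)
        have h3 := hball (hr'e (Metric.ball_subset_closedBall (hsupp _ hχ0)))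
        have h4 := hrβ h3
        rw [dist_eq_norm] at h4
        exact h4.le
    · simp [G, k, Set.indicator_of_notMem hxe]
  have h1 : ‖b 0 (e x₁) η‖ * I ≤ (2 * ε * D * Cs * Ct + δ) * I := by
    have h2 : ‖b 0 (e x₁) η * (I : ℂ)‖ = ‖b 0 (e x₁) η‖ * I := by
      rw [norm_mul, Complex.norm_real, Real.norm_of_nonneg hI.le]
    rw [← h2]
    have h3 := norm_sub_norm_le (b 0 (e x₁) η * (I : ℂ)) (∫ x, G x ∂μ)
    rw [norm_sub_rev] at h3
    linarith
  exact le_of_mul_le_mul_right h1 hI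

/-- If `T = K` on the `α`-isotypical part of `L²(M; E)`, the action is free on the dense set `U`,
and `T`, `K` are close to operators of order `0` and `-1`, then the principal symbol of the former
is small. -/
lemma norm_inner_symbol_le [Fintype Γ] (hμ : IsSmoothMeasure n μ)
    {U : Set M} (hU : Dense U) (hfree : ∀ x ∈ U, ∀ γ : Γ, γ • x = x → γ = 1)
    {P Q : smoothSections n F E →ₗ[ℂ] smoothSections n F E}
    {T K S S' : LTwo n F E μ →L[ℂ] LTwo n F E μ} (hP : IsPsiDO n 0 P) (hPS : Extends μ P S)
    {σ : ∀ ζ : Cotangent n M, E ζ.proj →ₗ[ℂ] E ζ.proj} (hσ : IsPrincipalSymbol n 0 P σ)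
    (hQ : IsPsiDO n (-1) Q) (hQS : Extends μ Q S') {ε : ℝ} (hTS : ‖T - S‖ ≤ ε)
    (hKS : ‖K - S'‖ ≤ ε) {α : Dual Γ}
    (hTK : ∀ v ∈ isotypicPart α.rep (lTwoRep n Γ F E μ), T v = K v)
    {l : α.Space →ₗ[ℂ] ℂ} {a₀ : α.Space} (hla : l a₀ = 1)
    {e : OpenPartialHomeomorph M (Rn n)} (he : e ∈ IsManifold.maximalAtlas (𝓡 n) ∞ M)
    {s t : smoothSections n F E} (hs : closure {x | s.1 x ≠ 0} ⊆ e.source)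
    (ht : closure {x | t.1 x ≠ 0} ⊆ e.source) {Cs Ct : ℝ} (hCs0 : 0 ≤ Cs)
    (hCs : ∀ x, ‖s.1 x‖ ≤ Cs) (hCt0 : 0 ≤ Ct) (hCt : ∀ x, ‖t.1 x‖ ≤ Ct)
    {y η : Rn n} (hy : y ∈ e.target) (hη : η ≠ 0) :
    ‖(inner ℂ (t.1 (e.symm y)) (σ (chartCovector n e y η) (s.1 (e.symm y))) : ℂ)‖ ≤
      2 * ε * (∑ γ : Γ, ‖l (α.rep γ⁻¹ a₀)‖) * Cs * Ct := by
  have hdata := isLocalData_innerCosection he hs ht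
  obtain ⟨a, b, hab, hl⟩ := hP e s _ hdata
  have hbσ := hσ e s _ a b hdata hab hl y hy η hη
  refine (congrArg norm hbσ).trans_le ?_
  have hbfree : ∀ x ∈ e.source ∩ U,
      ‖b 0 (e x) η‖ ≤ 2 * ε * (∑ γ : Γ, ‖l (α.rep γ⁻¹ a₀)‖) * Cs * Ct := fun x hx =>
    norm_leading_term_le_of_free hμ hP hPS hQ hQS hTS hKS hTK hla he hs ht hCs0 hCs
      hCt0 hCt hab hl hη hx.1 (hfree x hx.2)
  have hx₀ : e.symm y ∈ closure (e.source ∩ U) :=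
    hU.open_subset_closure_inter e.open_source (e.map_target hy)
  have hcont : ContinuousAt (fun x => ‖b 0 (e x) η‖) (e.symm y) := by
    have h1 : ContinuousAt (fun x => (e x, η)) (e.symm y) :=
      (e.continuousAt (e.map_target hy)).prodMk continuousAt_const
    exact (ContinuousAt.comp (f := fun x => (e x, η)) (hab.continuous_term 0 hη) h1).norm
  have := mem_closure_iff_nhdsWithin_neBot.1 hx₀
  have h2 := le_of_tendsto (hcont.tendsto.mono_left nhdsWithin_le_nhds)
    (Filter.eventually_of_mem self_mem_nhdsWithin hbfree)
  rwa [e.right_inv hy] at h2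

lemma inner_eq_zero_of_forall_approx {H : Type*} [NormedAddCommGroup H] [InnerProductSpace ℂ H]
    {A : H → H} {v v' : H} {C : ℝ} (h : ∀ ε : ℝ, 0 < ε → ∃ B : H → H,
      ‖(inner ℂ v' (B v) : ℂ)‖ ≤ ε * C ∧ ‖A v - B v‖ ≤ ε * ‖v‖) : (inner ℂ v' (A v) : ℂ) = 0 := by
  have key : ∀ ε : ℝ, 0 < ε → ‖(inner ℂ v' (A v) : ℂ)‖ ≤ ε * (|C| + ‖v'‖ * ‖v‖) := by
    intro ε hε
    obtain ⟨B, hB, hAB⟩ := h ε hε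
    have h1 : (inner ℂ v' (A v) : ℂ) = inner ℂ v' (A v - B v) + inner ℂ v' (B v) := by
      rw [← inner_add_right, sub_add_cancel]
    calc ‖(inner ℂ v' (A v) : ℂ)‖ ≤ ‖v'‖ * (ε * ‖v‖) + ε * |C| := by
          rw [h1]
          refine (norm_add_le _ _).trans (add_le_add ?_ (hB.trans ?_))
          · exact (norm_inner_le_norm _ _).trans (mul_le_mul_of_nonneg_left hAB (norm_nonneg v'))
          · exact mul_le_mul_of_nonneg_left (le_abs_self C) hε.le
      _ = ε * (|C| + ‖v'‖ * ‖v‖) := by ring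
  have hC0 : 0 ≤ |C| + ‖v'‖ * ‖v‖ := by positivity
  refine norm_le_zero_iff.1 (le_of_forall_pos_le_add fun δ hδ => ?_)
  refine (key (δ / (|C| + ‖v'‖ * ‖v‖ + 1)) (by positivity)).trans ?_
  rw [zero_add, div_mul_eq_mul_div, div_le_iff₀ (by positivity)]
  nlinarith

/-- The estimate of `norm_inner_symbol_le` at two given vectors of one fibre, with a constant that
depends on these vectors only. -/
lemma exists_norm_inner_symbol_le [Fintype Γ] (hμ : IsSmoothMeasure n μ)
    {U : Set M} (hU : Dense U) (hfree : ∀ x ∈ U, ∀ γ : Γ, γ • x = x → γ = 1)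
    {T K : LTwo n F E μ →L[ℂ] LTwo n F E μ} {α : Dual Γ}
    (hTK : ∀ v ∈ isotypicPart α.rep (lTwoRep n Γ F E μ), T v = K v)
    {e : OpenPartialHomeomorph M (Rn n)} (he : e ∈ IsManifold.maximalAtlas (𝓡 n) ∞ M)
    {y η : Rn n} (hy : y ∈ e.target) (hη : η ≠ 0) (v v' : E (e.symm y)) :
    ∃ C : ℝ, ∀ (P Q : smoothSections n F E →ₗ[ℂ] smoothSections n F E)
      (S S' : LTwo n F E μ →L[ℂ] LTwo n F E μ)
      (σ : ∀ ζ : Cotangent n M, E ζ.proj →ₗ[ℂ] E ζ.proj) (ε : ℝ),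
      IsPsiDO n 0 P → Extends μ P S → IsPrincipalSymbol n 0 P σ → IsPsiDO n (-1) Q →
      Extends μ Q S' → ‖T - S‖ ≤ ε → ‖K - S'‖ ≤ ε →
      ‖(inner ℂ v' (σ (chartCovector n e y η) v) : ℂ)‖ ≤ ε * C := by
  have := nontrivial_dual_space α
  obtain ⟨a₁, ha₁⟩ := exists_ne (0 : α.Space)
  obtain ⟨l, hl0⟩ := Module.Projective.exists_dual_ne_zero ℂ ha₁
  have hla : l ((l a₁)⁻¹ • a₁) = 1 := by simp [hl0]
  have hO : e.source ∈ 𝓝 (e.symm y) := e.open_source.mem_nhds (e.map_target hy)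
  obtain ⟨s, rfl, hsO⟩ := exists_smoothSection (n := n) (F := F) (e.symm y) v hO
  obtain ⟨t, rfl, htO⟩ := exists_smoothSection (n := n) (F := F) (e.symm y) v' hO
  obtain ⟨Cs, hCs0, hCs⟩ := exists_norm_le s
  obtain ⟨Ct, hCt0, hCt⟩ := exists_norm_le t
  refine ⟨2 * (∑ γ : Γ, ‖l (α.rep γ⁻¹ ((l a₁)⁻¹ • a₁))‖) * Cs * Ct,
    fun P Q S S' σ ε hP hPS hσ hQ hQS hTS hKS => ?_⟩
  refine (norm_inner_symbol_le hμ hU hfree hP hPS hσ hQ hQS hTS hKS hTK hla he hsO htO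
    hCs0.le hCs hCt0.le hCt hy hη).trans_eq ?_
  ring

set_option maxHeartbeats 1000000 in
/-- In a chart, the symbol of an operator in the closure of `ψ⁰(M; E)` that agrees on the
`α`-isotypical part of `L²(M; E)` with an operator in the closure of `ψ⁻¹(M; E)` vanishes. -/
lemma HasSymbol.inner_chartCovector_eq_zero [Fintype Γ]
    {U : Set M} (hU : Dense U) (hfree : ∀ x ∈ U, ∀ γ : Γ, γ • x = x → γ = 1)
    {g : RiemannianMetricOn n M} (hμ : IsSmoothMeasure n μ) {α : Dual Γ}
    {T K : LTwo n F E μ →L[ℂ] LTwo n F E μ}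
    {f : ∀ ζ : Cosphere g, E ζ.1.proj →L[ℂ] E ζ.1.proj} (hTf : HasSymbol μ g T f)
    (hK : K ∈ psiClosure n F μ E (-1))
    (hTK : ∀ v ∈ isotypicPart α.rep (lTwoRep n Γ F E μ), T v = K v)
    {e : OpenPartialHomeomorph M (Rn n)} (he : e ∈ IsManifold.maximalAtlas (𝓡 n) ∞ M)
    {y η : Rn n} (hy : y ∈ e.target) (hη : η ≠ 0) (hζ) (v v' : E (e.symm y)) :
    (inner ℂ v' (f ⟨chartCovector n e y η, hζ⟩ v) : ℂ) = 0 := by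
  obtain ⟨C, hC⟩ := exists_norm_inner_symbol_le hμ hU hfree hTK he hy hη v v'
  refine inner_eq_zero_of_forall_approx (C := C) fun ε hε => ?_
  obtain ⟨P, S, σ, hP, hPS, hσ, hTS, hfσ⟩ := hTf ε hε
  obtain ⟨S', ⟨Q, hQ, hQS⟩, hKS⟩ := Metric.mem_closure_iff.1 hK ε hε
  rw [dist_eq_norm] at hKS
  exact ⟨σ (chartCovector n e y η), hC P Q S S' σ ε hP hPS hσ hQ hQS hTS hKS.le,
    hfσ ⟨chartCovector n e y η, hζ⟩ v⟩

set_option maxHeartbeats 1000000 in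
/-- The kernel of the restriction morphism is trivial if the free points are dense. -/
lemma eq_zero_of_mem_kerR [Finite Γ] [∀ x, CompleteSpace (E x)]
    {U : Set M} (hU : Dense U) (hfree : ∀ x ∈ U, ∀ γ : Γ, γ • x = x → γ = 1)
    (g : RiemannianMetricOn n M) (hμ : IsSmoothMeasure n μ) (α : Dual Γ)
    {f : symbolAlgebra n Γ F E g} (hf : f ∈ kerR n Γ F μ E g α) : f = 0 := by
  have := Fintype.ofFinite Γ
  obtain ⟨T, -, hTf, K, hK, hTK⟩ := hf
  refine Subtype.ext (funext fun ζ => ContinuousLinearMap.ext fun v => ?_)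
  refine ext_inner_left ℂ fun v' => Eq.trans ?_ (inner_zero_right v').symm
  have h := exists_eq_chartCovector ζ.1 ζ.ne_zero
  obtain ⟨ζ, hζ⟩ := ζ
  obtain ⟨e, he, y, η, hη, hy, rfl⟩ := h
  exact hTf.inner_chartCovector_eq_zero hU hfree hμ hK.1 hTK he hy hη hζ v v'

end Estimate

end EquivariantSymbol

/-! ### Actions that are free on a dense set -/

theorem proposition4p17
    -- a finite group acting by diffeomorphisms on a compact smooth manifold
    {n : ℕ} {Γ : Type*} [Group Γ] [Finite Γ]
    {M : Type*} [TopologicalSpace M] [T2Space M] [CompactSpace M]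
    [ChartedSpace (Rn n) M] [IsManifold (𝓡 n) ∞ M]
    [MulAction Γ M] [SmoothAction n Γ M]
    -- the action is free on a dense subset
    (U : Set M) (hU : Dense U) (hfree : ∀ x ∈ U, ∀ γ : Γ, γ • x = x → γ = 1)
    -- minimal isotropy groups of the components of the orbit space
    (Γ₀ : ConnectedComponents (Quotient (MulAction.orbitRel Γ M)) → Subgroup Γ)
    (hΓ₀ : IsMinimalIsotropy Γ₀)
    -- an invariant Riemannian metric and an invariant smooth measure
    (g : RiemannianMetricOn n M) (hg : IsInvariantMetric Γ g)
    [MeasurableSpace M] [BorelSpace M] (μ : Measure M) [IsFiniteMeasure μ]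
    (hμ : IsSmoothMeasure n μ) [SMulInvariantMeasure Γ M μ]
    -- an equivariant Hermitian vector bundle `E`
    {F : Type*} [NormedAddCommGroup F] [NormedSpace ℂ F] [FiniteDimensional ℂ F]
    (E : M → Type*) [TopologicalSpace (TotalSpace F E)] [∀ x, NormedAddCommGroup (E x)]
    [∀ x, InnerProductSpace ℂ (E x)] [∀ x, CompleteSpace (E x)]
    [FiberBundle F E] [VectorBundle ℂ F E] [ContMDiffVectorBundle ∞ F E (𝓡 n)]
    [SmoothHermitian n F E] [EquivariantBundle n Γ F E] [InvariantHermitian n Γ F E]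
    -- equivariant vector bundles `E₀` and `E₁`
    {F₀ : Type*} [NormedAddCommGroup F₀] [NormedSpace ℂ F₀] [FiniteDimensional ℂ F₀]
    (E₀ : M → Type*) [TopologicalSpace (TotalSpace F₀ E₀)] [∀ x, AddCommGroup (E₀ x)]
    [∀ x, Module ℂ (E₀ x)] [∀ x, TopologicalSpace (E₀ x)]
    [FiberBundle F₀ E₀] [VectorBundle ℂ F₀ E₀] [ContMDiffVectorBundle ∞ F₀ E₀ (𝓡 n)]
    [EquivariantBundle n Γ F₀ E₀]
    {F₁ : Type*} [NormedAddCommGroup F₁] [NormedSpace ℂ F₁] [FiniteDimensional ℂ F₁]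
    (E₁ : M → Type*) [TopologicalSpace (TotalSpace F₁ E₁)] [∀ x, AddCommGroup (E₁ x)]
    [∀ x, Module ℂ (E₁ x)] [∀ x, TopologicalSpace (E₁ x)]
    [FiberBundle F₁ E₁] [VectorBundle ℂ F₁ E₁] [ContMDiffVectorBundle ∞ F₁ E₁ (𝓡 n)]
    [EquivariantBundle n Γ F₁ E₁]
    -- an irreducible representation of `Γ`
    (α : Dual Γ) :
    XAlpha (n := n) (M := M) Γ₀ α = XSet n Γ M ∧
    Xi n Γ F μ E g α = primSymbolAlgebra n Γ F E g ∧
    ∀ (m : ℝ) (P : smoothSections n F₀ E₀ →ₗ[ℂ] smoothSections n F₁ E₁),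
      IsPsiDO n m P → IsInvariantOperator n Γ P →
        (IsAlphaElliptic n Γ₀ α m P ↔ IsElliptic n m P) := by
  refine ⟨xAlpha_eq_xSet (n := n) hU hfree hΓ₀ α, ?_,
    fun m P hP hinv => isAlphaElliptic_iff_isElliptic hU hfree hΓ₀ α hP hinv⟩
  refine Set.Subset.antisymm (fun J hJ => hJ.1) fun J hJ => ⟨hJ, fun f hf => ?_⟩
  rw [eq_zero_of_mem_kerR hU hfree g hμ α hf]
  exact J.zero_mem
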